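/- **Relativised Dependent Choices.** Work in the following intuitionistic first-order theory. Its base is Heyting arithmetic with symbols for all primitive recursive functions. $\langle\cdot,\cdot\rangle$ is the Cantor pairing with projections $(\cdot)_L,(\cdot)_R$; $en$ is the value of the $e$-th partial recursive function at $n$ (via Kleene's $\mathbf T$ and $\mathbf U$) and $en{\downarrow}$ says that it is defined. There are additional predicates $\mathcal V(x)$ ("$x$ is a v-set"), $\mathcal M(p)$ ("$p$ is Meaningful"), $\mathcal T(p)$ ("$p$ is True"), $x\simeq y$ (extensional equality) and $\mathcal R(e,x,y)$ ("$e$ witnesses $x\simeq y$"); induction holds for all formulas of the extended language. Write $\bar x_n=(xn)_R$, $x_n=(xn)_L$, $IND(x)=\{n:\mathcal T(\bar x_n)\}$, $EL(x)=\{x_n:n\in IND(x)\}$. The further axioms are: 1. $\mathcal V$ is inductively defined: for $C_\chi(x):=\forall n\,\bigl(xn{\downarrow}\wedge\mathcal M(\bar x_n)\wedge(\mathcal T(\bar x_n)\to\chi(x_n))\bigr)$, one has $\forall x\,(C_{\mathcal V}(x)\to\mathcal V(x))$ and, for every formula $\chi$, $\forall x\,(C_\chi(x)\to\chi(x))\to\forall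 x\,(\mathcal V(x)\to\chi(x))$. 2. For v-sets $x,y$: $x\simeq y$ iff $\forall a\in EL(x)\,\exists b\in EL(y)\;a\simeq b$ and $\forall b\in EL(y)\,\exists a\in EL(x)\;b\simeq a$. 3. For all $e$ and all v-sets $x,y$: $\mathcal R(e,x,y)$ iff for all $n\in IND(x)$, $e_Ln{\downarrow}$, $(e_Ln)_L\in IND(y)$ and $\mathcal R((e_Ln)_R,x_n,y_{(e_Ln)_L})$, and for all $n\in IND(y)$, $e_Rn{\downarrow}$, $(e_Rn)_L\in IND(x)$ and $\mathcal R((e_Rn)_R,y_n,x_{(e_Rn)_L})$ (here $e_L=(e)_L$, $e_R=(e)_R$). 4. For some fixed numbers $\top,\bot$ and a primitive recursive function $\Pi$ (an arbitrary choice): $\top,\bot$ are Meaningful, $\top$ is True, $\bot$ is not True; $\Pi(p,q)$ is Meaningful if $p$ is Meaningful and $\mathcal T(p)\to\mathcal M(q)$; and if $\Pi(p,q)$ is Meaningful, it is True iff $p$ and $q$ are True. 5. $\mathsf{ECT}_{\mathcal V}$: $\bigl(\forall n\,(\alpha(n)\to\exists m\,\beta(n,m))\bigr)\to\exists e\,\forall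 n\,(\alpha(n)\to en{\downarrow}\wedge\beta(n,en))$ for every formula $\beta$ and every almost-negative formula $\alpha$, i.e. one built by $\wedge,\to,\forall$ from $\Sigma_1$ formulas (existential quantifiers in front of quantifier-free formulas of primitive recursive arithmetic) and atoms $\mathcal V(t),\mathcal M(t),\mathcal T(t),\mathcal R(s,t,u)$. A formula of first-order set theory (built from equality by the intuitionistic connectives, unbounded quantifiers and bounded quantifiers $\forall u\in x,\exists u\in x$, with $u\in x$ standing for $\exists u'\in x\;u=u'$) is interpreted by reading equality as $\simeq$, unbounded quantifiers as ranging over v-sets, and bounded quantifiers over $x$ as ranging over $EL(x)$. Then, for every formula $\varphi(x)$ of first-order set theory (a class, possibly with v-sets as parameters) and every formula $\psi(x,y)$ of the theory (an arbitrary relation, possibly with parameters, not necessarily respecting $\simeq$), the theory proves: if for every v-set $x$ with $\varphi(x)$ there is a v-set $y$ with $\varphi(y)$ and $\psi(x,y)$, then for every v-set $x$ with $\varphi(x)$ there is a choice sequence starting with $x$; that is, there are a (computable) sequence $j$ of v-sets and a v-set $k$ such that $j0=x$; $\varphi(jn)$ and $\psi(jn,j(n+1))$ hold for all $n$; and $k$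 is, in the sense of set theory, a function with domain $\omega$ (a v-set) whose value at the finite von Neumann ordinal $n$ is $jn$, for every $n$. -/

import Mathlib

namespace VSets

/-! ### Primitive recursive function symbols -/

/-- Symbols for the primitive recursive functions, by arity. In `prec f g` the recursion is on the
first argument: `prec f g (0, v) = f v` and `prec f g (n + 1, v) = g (n, prec f g (n, v), v)`. -/
inductive PRFun : ℕ → Type
  | zero : PRFun 0
  | succ : PRFun 1
  | proj {n : ℕ} (i : Fin n) : PRFun n
  | comp {m n : ℕ} (f : PRFun m) (g : Fin m → PRFun n) : PRFun n
  | prec {n : ℕ} (f : PRFun n) (g : PRFun (n + 2)) : PRFun (n + 1)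

namespace PRFun

variable {n : ℕ}

/-- The numeral `k` as a constant function of any arity. -/
def const : ℕ → PRFun n
  | 0 => comp zero ![]
  | k + 1 => comp succ ![const k]

def S (a : PRFun n) : PRFun n := comp succ ![a]

def addF : PRFun 2 := prec (proj 0) (S (proj 1))
def add (a b : PRFun n) : PRFun n := comp addF ![a, b]

def mulF : PRFun 2 := prec (const 0) (add (proj 1) (proj 2))
def mul (a b : PRFun n) : PRFun n := comp mulF ![a, b]

def predF : PRFun 1 := prec zero (proj 0)
def pred (a : PRFun n) : PRFun n := comp predF ![a]

/-- `subF (a, b) = b ∸ a` -/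
def subF : PRFun 2 := prec (proj 0) (pred (proj 1))
/-- `sub a b = a ∸ b` (cut-off subtraction) -/
def sub (a b : PRFun n) : PRFun n := comp subF ![b, a]

/-! Decidable relations are represented by functions with values `1` (true) and `0` (false). -/

def not (a : PRFun n) : PRFun n := sub (const 1) a
def and (a b : PRFun n) : PRFun n := mul a b
def or (a b : PRFun n) : PRFun n := not (and (not a) (not b))
def eq (a b : PRFun n) : PRFun n := not (add (sub a b) (sub b a))

/-- `bexF P (k, v)` decides `∃ i < k, P (i, v)`. -/
def bexF (P : PRFun (n + 1)) : PRFun (n + 1) :=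
  prec (const 0)
    (or (proj 1) (comp P (Matrix.vecCons (proj 0) fun i => proj i.succ.succ)))

/-- `bex b P (v)` decides `∃ i < b (v), P (i, v)`. -/
def bex (b : PRFun n) (P : PRFun (n + 1)) : PRFun n := comp (bexF P) (Matrix.vecCons b proj)

/-! The Cantor pairing function `⟨a, b⟩ = (a + b) (a + b + 1) / 2 + b` and its projections. -/

/-- Triangular numbers. -/
def triF : PRFun 1 := prec zero (add (proj 1) (S (proj 0)))
def tri (a : PRFun n) : PRFun n := comp triF ![a]

def pair (a b : PRFun n) : PRFun n := add (tri (add a b)) b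
def pairF : PRFun 2 := pair (proj 0) (proj 1)

/-- `diagF m` is the largest `s` with `tri s ≤ m`, that is, `a + b` when `m = ⟨a, b⟩`. -/
def diagF : PRFun 1 :=
  prec zero (add (proj 1) (eq (S (proj 0)) (tri (S (proj 1)))))
def diag (a : PRFun n) : PRFun n := comp diagF ![a]

def right (a : PRFun n) : PRFun n := sub a (tri (diag a))
def left (a : PRFun n) : PRFun n := sub (diag a) (right a)
def leftF : PRFun 1 := left (proj 0)
def rightF : PRFun 1 := right (proj 0)

/-! Lists of numbers: `0` is the empty list and `⟨a, l⟩ + 1` is the list with head `a`, tail `l`. -/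

def hd (l : PRFun n) : PRFun n := left (pred l)
def tl (l : PRFun n) : PRFun n := right (pred l)

/-- `dropF (k, l)` is the list `l` without its first `k` entries. -/
def dropF : PRFun 2 := prec (proj 0) (tl (proj 1))
def drop (k l : PRFun n) : PRFun n := comp dropF ![k, l]

/-- `memF (a, l)` decides whether `a` is an entry of the list `l`. -/
def memF : PRFun 2 :=
  bex (proj 1) (and (not (eq (drop (proj 0) (proj 2)) (const 0)))
    (eq (hd (drop (proj 0) (proj 2))) (proj 1)))
def mem (a l : PRFun n) : PRFun n := comp memF ![a, l]

/-! ### Kleene's predicate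

The number `e = ⟨tag, arg⟩` is the index of a partial recursive function of one variable:
`tag = 0`: the constant `0`; `1`: successor; `2`, `3`: the projections of a pair;
`4`: `i ↦ ⟨a i, b i⟩`; `5`: `i ↦ a (b i)`;
`6`: primitive recursion, `⟨x, 0⟩ ↦ a x`, `⟨x, m + 1⟩ ↦ b ⟨x, ⟨m, e ⟨x, m⟩⟩⟩`,
where `arg = ⟨a, b⟩` in the cases `4`, `5`, `6`; and
`7`: unbounded search, `⟨x, m⟩ ↦` the least `m' ≥ m` with `arg ⟨x, m'⟩ = 0`
(with `arg ⟨x, m''⟩` defined for `m ≤ m'' < m'`).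
A computation is a list of statements `e i = v`, coded as `⟨⟨e, i⟩, v⟩`, the conclusion first,
each of which follows from statements further down the list by one of the clauses above. -/

/-- The code of the statement `e i = v`. -/
def stm (e i v : PRFun n) : PRFun n := pair (pair e i) v

/-- `justF (c, l)` decides whether the statement `c` follows by one clause from entries of `l`. -/
def justF : PRFun 2 :=
  let c : PRFun 2 := proj 0
  let l : PRFun 2 := proj 1
  let e := left (left c)
  let i := right (left c)
  let v := right c
  let tag := left e
  let arg := right e
  let a := left arg
  let b := right arg
  let x := left i
  let m := right i
  -- the same under one bounded quantifier, where `u` is the bound variable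
  let u : PRFun 3 := proj 0
  let c' : PRFun 3 := proj 1
  let l' : PRFun 3 := proj 2
  let e' := left (left c')
  let i' := right (left c')
  let v' := right c'
  let arg' := right e'
  let a' := left arg'
  let b' := right arg'
  let x' := left i'
  let m' := right i'
  or (and (eq tag (const 0)) (eq v (const 0)))
  (or (and (eq tag (const 1)) (eq v (S i)))
  (or (and (eq tag (const 2)) (eq v (left i)))
  (or (and (eq tag (const 3)) (eq v (right i)))
  (or (and (eq tag (const 4)) (and (mem (stm a i (left v)) l) (mem (stm b i (right v)) l)))
  (or (and (eq tag (const 5)) (bex l (and (mem (stm b' i' u) l') (mem (stm a' u v') l'))))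
  (or (and (eq tag (const 6)) (and (eq m (const 0)) (mem (stm a x v) l)))
  (or (and (eq tag (const 6)) (and (not (eq m (const 0)))
        (bex l (and (mem (stm e' (pair x' (pred m')) u) l')
          (mem (stm b' (pair x' (pair (pred m') u)) v') l')))))
  (or (and (eq tag (const 7)) (and (eq v m) (mem (stm arg i (const 0)) l)))
      (and (eq tag (const 7)) (bex l (and (mem (stm arg' i' (S u)) l')
          (mem (stm e' (pair x' (S m')) v') l'))))))))))))

def just (c l : PRFun n) : PRFun n := comp justF ![c, l]

/-- `compF (e, i, o)` decides whether `o` is a computation of the `e`-th function on input `i`. -/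
def compF : PRFun 3 :=
  and (not (eq (proj 2) (const 0)))
  (and (eq (left (hd (proj 2))) (pair (proj 0) (proj 1)))
    (not (bex (proj 2)
      (and (not (eq (drop (proj 0) (proj 3)) (const 0)))
        (not (just (hd (drop (proj 0) (proj 3))) (tl (drop (proj 0) (proj 3)))))))))

/-- `earlierF (o, e, i)` decides whether there is a computation of the `e`-th function on input `i`
with a code smaller than `o`. -/
def earlierF : PRFun 3 := bexF (comp compF ![proj 1, proj 2, proj 0])

/-- Kleene's function `U`: the output of a computation. -/
def outF : PRFun 1 := right (hd (proj 0))

end PRFun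

/-! ### First-order arithmetic with the additional predicates -/

/-- Terms; variables are de Bruijn indices. -/
inductive Term : Type
  | var (k : ℕ) : Term
  | app {n : ℕ} (f : PRFun n) (ts : Fin n → Term) : Term

/-- The substitution `0 ↦ t`, `k + 1 ↦ σ k`. -/
def scons (t : Term) (σ : ℕ → Term) : ℕ → Term
  | 0 => t
  | k + 1 => σ k

namespace Term

def subst (σ : ℕ → Term) : Term → Term
  | var k => σ k
  | app f ts => app f fun i => (ts i).subst σ

/-- Raise all variables by `d`. -/
def lift (d : ℕ) (t : Term) : Term := t.subst fun k => var (k + d)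

def zero : Term := app PRFun.zero ![]
def succ (t : Term) : Term := app PRFun.succ ![t]
def one : Term := succ zero
def left (t : Term) : Term := app PRFun.leftF ![t]
def right (t : Term) : Term := app PRFun.rightF ![t]
def out (t : Term) : Term := app PRFun.outF ![t]

end Term

/-- Formulas of first-order arithmetic with the predicates `V` (v-set), `M` (Meaningful), `T` (True),
`sim` (extensional equality) and `R` (`R e x y`: `e` witnesses the extensional equality of `x` and
`y`). `all` and `ex` bind the variable `0`. -/
inductive Formula : Type
  | eq (s t : Term) : Formula
  | V (t : Term) : Formula
  | M (t : Term) : Formula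
  | T (t : Term) : Formula
  | sim (s t : Term) : Formula
  | R (e s t : Term) : Formula
  | bot : Formula
  | and (A B : Formula) : Formula
  | or (A B : Formula) : Formula
  | imp (A B : Formula) : Formula
  | all (A : Formula) : Formula
  | ex (A : Formula) : Formula

namespace Formula

def subst : (ℕ → Term) → Formula → Formula
  | σ, eq s t => eq (s.subst σ) (t.subst σ)
  | σ, V t => V (t.subst σ)
  | σ, M t => M (t.subst σ)
  | σ, T t => T (t.subst σ)
  | σ, sim s t => sim (s.subst σ) (t.subst σ)
  | σ, R e s t => R (e.subst σ) (s.subst σ) (t.subst σ)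
  | _, bot => bot
  | σ, and A B => and (A.subst σ) (B.subst σ)
  | σ, or A B => or (A.subst σ) (B.subst σ)
  | σ, imp A B => imp (A.subst σ) (B.subst σ)
  | σ, all A => all (A.subst (scons (Term.var 0) fun k => (σ k).lift 1))
  | σ, ex A => ex (A.subst (scons (Term.var 0) fun k => (σ k).lift 1))

def lift (d : ℕ) (A : Formula) : Formula := A.subst fun k => Term.var (k + d)

/-- Substitute `t` for the variable `0` and lower the other variables by one. -/
def inst (A : Formula) (t : Term) : Formula := A.subst (scons t Term.var)

def neg (A : Formula) : Formula := imp A bot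
def iff (A B : Formula) : Formula := and (imp A B) (imp B A)

end Formula

/-- Intuitionistic natural deduction with equality, from a set `Ax` of axioms (whose free variables
are read as universally quantified); `Derives Ax Γ A` says that `A` is derivable from the open
assumptions `Γ`. -/
inductive Derives (Ax : Set Formula) : List Formula → Formula → Prop
  | ax {Γ : List Formula} {A : Formula} (h : A ∈ Ax) : Derives Ax Γ A
  | hyp {Γ A} (h : A ∈ Γ) : Derives Ax Γ A
  | botE {Γ A} (h : Derives Ax Γ Formula.bot) : Derives Ax Γ A
  | andI {Γ A B} (h₁ : Derives Ax Γ A) (h₂ : Derives Ax Γ B) : Derives Ax Γ (Formula.and A B)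
  | andL {Γ A B} (h : Derives Ax Γ (Formula.and A B)) : Derives Ax Γ A
  | andR {Γ A B} (h : Derives Ax Γ (Formula.and A B)) : Derives Ax Γ B
  | orL {Γ A B} (h : Derives Ax Γ A) : Derives Ax Γ (Formula.or A B)
  | orR {Γ A B} (h : Derives Ax Γ B) : Derives Ax Γ (Formula.or A B)
  | orE {Γ A B C} (h : Derives Ax Γ (Formula.or A B)) (h₁ : Derives Ax (A :: Γ) C)
      (h₂ : Derives Ax (B :: Γ) C) : Derives Ax Γ C
  | impI {Γ A B} (h : Derives Ax (A :: Γ) B) : Derives Ax Γ (Formula.imp A B)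
  | impE {Γ A B} (h₁ : Derives Ax Γ (Formula.imp A B)) (h₂ : Derives Ax Γ A) : Derives Ax Γ B
  | allI {Γ : List Formula} {A : Formula} (h : Derives Ax (Γ.map (Formula.lift 1)) A) : Derives Ax Γ (Formula.all A)
  | allE {Γ : List Formula} {A : Formula} (t : Term) (h : Derives Ax Γ (Formula.all A)) : Derives Ax Γ (A.inst t)
  | exI {Γ : List Formula} {A : Formula} (t : Term) (h : Derives Ax Γ (A.inst t)) : Derives Ax Γ (Formula.ex A)
  | exE {Γ : List Formula} {A C : Formula} (h₁ : Derives Ax Γ (Formula.ex A))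
      (h₂ : Derives Ax (A :: Γ.map (Formula.lift 1)) (C.lift 1)) : Derives Ax Γ C
  | eqI {Γ : List Formula} (t : Term) : Derives Ax Γ (Formula.eq t t)
  | eqE {Γ : List Formula} {A : Formula} {s t : Term} (h₁ : Derives Ax Γ (Formula.eq s t)) (h₂ : Derives Ax Γ (A.inst s)) :
      Derives Ax Γ (A.inst t)

section Abbreviations

open Formula Term

/-- Kleene's predicate: `o` is the (least) computation of the `e`-th function on input `i`. -/
def kleeneT (e i o : Term) : Formula :=
  and (eq (app PRFun.compF ![e, i, o]) one) (eq (app PRFun.earlierF ![o, e, i]) Term.zero)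

/-- `e i` is defined. -/
def Dfd (e i : Term) : Formula := ex (kleeneT (e.lift 1) (i.lift 1) (var 0))

/-- `e i` is defined and equal to `v`. -/
def Ap (e i v : Term) : Formula :=
  ex (and (kleeneT (e.lift 1) (i.lift 1) (var 0)) (eq (out (var 0)) (v.lift 1)))

/-- The `n`-th condition of `x` is Meaningful. -/
def CondM (x n : Term) : Formula :=
  ex (and (Ap (x.lift 1) (n.lift 1) (var 0)) (M (right (var 0))))

/-- The `n`-th condition of `x` is True, that is, `n ∈ IND(x)`. -/
def Ind (x n : Term) : Formula :=
  ex (and (Ap (x.lift 1) (n.lift 1) (var 0)) (T (right (var 0))))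

/-- `z` is the `n`-th conditional element of `x`. -/
def Elt (x n z : Term) : Formula :=
  ex (and (Ap (x.lift 1) (n.lift 1) (var 0)) (eq (left (var 0)) (z.lift 1)))

/-- `z ∈ EL(x)`: `z` is one of the conditional elements of `x` whose condition is True. -/
def EL (x z : Term) : Formula :=
  ex (and (Ind (x.lift 1) (var 0)) (Elt (x.lift 1) (var 0) (z.lift 1)))

end Abbreviations

/-! ### The assumptions -/

section Assumptions

open Formula Term

/-- Heyting arithmetic with symbols for all primitive recursive functions (the axioms beyond logic
with equality). -/
inductive HA : Set Formula
  | succNeZero (t : Term) : HA (neg (eq (succ t) Term.zero))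
  | succInj (s t : Term) : HA (imp (eq (succ s) (succ t)) (eq s t))
  | proj {n : ℕ} (i : Fin n) (ts : Fin n → Term) : HA (eq (app (PRFun.proj i) ts) (ts i))
  | comp {m n : ℕ} (f : PRFun m) (g : Fin m → PRFun n) (ts : Fin n → Term) :
      HA (eq (app (PRFun.comp f g) ts) (app f fun i => app (g i) ts))
  | precZero {n : ℕ} (f : PRFun n) (g : PRFun (n + 2)) (ts : Fin n → Term) :
      HA (eq (app (PRFun.prec f g) (Matrix.vecCons Term.zero ts)) (app f ts))
  | precSucc {n : ℕ} (f : PRFun n) (g : PRFun (n + 2)) (t : Term) (ts : Fin n → Term) :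
      HA (eq (app (PRFun.prec f g) (Matrix.vecCons (succ t) ts))
        (app g (Matrix.vecCons t
          (Matrix.vecCons (app (PRFun.prec f g) (Matrix.vecCons t ts)) ts))))
  | induction (A : Formula) :
      HA (imp (A.inst Term.zero)
        (imp (all (imp A (A.subst (scons (succ (var 0)) fun k => var (k + 1))))) (all A)))

/-- Quantifier-free formulas of primitive recursive arithmetic. -/
inductive QuantifierFree : Formula → Prop
  | eq (s t : Term) : QuantifierFree (eq s t)
  | bot : QuantifierFree bot
  | and {A B} : QuantifierFree A → QuantifierFree B → QuantifierFree (and A B)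
  | or {A B} : QuantifierFree A → QuantifierFree B → QuantifierFree (or A B)
  | imp {A B} : QuantifierFree A → QuantifierFree B → QuantifierFree (imp A B)

/-- Existential quantifiers in front of a quantifier-free formula. -/
inductive Sigma1 : Formula → Prop
  | qf {A} : QuantifierFree A → Sigma1 A
  | ex {A} : Sigma1 A → Sigma1 (ex A)

/-- Almost-negative formulas, with `V`, `M`, `T` and `R` counted among them (but not `sim`). -/
inductive AlmostNegative : Formula → Prop
  | sigma1 {A} : Sigma1 A → AlmostNegative A
  | V (t : Term) : AlmostNegative (V t)
  | M (t : Term) : AlmostNegative (M t)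
  | T (t : Term) : AlmostNegative (T t)
  | R (e s t : Term) : AlmostNegative (R e s t)
  | and {A B} : AlmostNegative A → AlmostNegative B → AlmostNegative (and A B)
  | imp {A B} : AlmostNegative A → AlmostNegative B → AlmostNegative (imp A B)
  | all {A} : AlmostNegative A → AlmostNegative (all A)

/-- The instance of Extended Church's Thesis for `A(n)` and `B(n, m)`:
`(∀ n, A(n) → ∃ m, B(n, m)) → ∃ e, ∀ n, A(n) → e n is defined ∧ B(n, e n)`.
In `A` the variable `0` is `n`; in `B` the variables `0`, `1` are `m`, `n`; the other variables are
parameters. -/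
def ect (A B : Formula) : Formula :=
  imp (all (imp A (ex B)))
    (ex (all (imp (A.subst (scons (var 0) fun k => var (k + 2)))
      (and (Dfd (var 1) (var 0))
        (ex (and (Ap (var 2) (var 1) (var 0))
          (B.subst (scons (var 0) (scons (var 1) fun k => var (k + 3))))))))))

/-- The closure condition in the inductive definition of v-sets, for the predicate `A` (variable `0`;
the others are parameters), as a formula about the variable `0`, called `x`:
`∀ n, x n is defined ∧ M(the n-th condition) ∧ (T(the n-th condition) → A(the n-th element))`. -/
def closure (A : Formula) : Formula :=
  all (and (Dfd (var 1) (var 0))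
    (and (CondM (var 1) (var 0))
      (imp (Ind (var 1) (var 0))
        (ex (and (Elt (var 2) (var 1) (var 0)) (A.subst (scons (var 0) fun k => var (k + 3))))))))

/-- The inductive definition of v-sets, introduction. -/
def vIntro : Formula := all (imp (closure (V (var 0))) (V (var 0)))

/-- The inductive definition of v-sets, induction for the predicate `A`. -/
def vInd (A : Formula) : Formula :=
  imp (all (imp (closure A) A)) (all (imp (V (var 0)) A))

/-- Every `a ∈ EL(x)` is extensionally equal to some `b ∈ EL(y)`. -/
def simHalf (x y : Term) : Formula :=
  all (imp (EL (x.lift 1) (var 0))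
    (ex (and (EL (y.lift 2) (var 0)) (sim (var 1) (var 0)))))

/-- The fix-point equation of extensional equality. -/
def simAx : Formula :=
  all (all (imp (and (V (var 1)) (V (var 0)))
    (iff (sim (var 1) (var 0)) (and (simHalf (var 1) (var 0)) (simHalf (var 0) (var 1))))))

/-- `∀ n ∈ IND(x), d n is defined ∧ (d n)_L ∈ IND(y) ∧ R((d n)_R, x_n, y_{(d n)_L})`. -/
def rHalf (d x y : Term) : Formula :=
  all (imp (Ind (x.lift 1) (var 0))
    (and (Dfd (d.lift 1) (var 0))
      (ex (and (Ap (d.lift 2) (var 1) (var 0))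
        (and (Ind (y.lift 2) (left (var 0)))
          (ex (ex (and (Elt (x.lift 4) (var 3) (var 1))
            (and (Elt (y.lift 4) (left (var 2)) (var 0))
              (R (right (var 2)) (var 1) (var 0)))))))))))

/-- The fix-point equation of the witnessing predicate `R`. -/
def rAx : Formula :=
  all (all (all (imp (and (V (var 1)) (V (var 0)))
    (iff (R (var 2) (var 1) (var 0))
      (and (rHalf (left (var 2)) (var 1) (var 0)) (rHalf (right (var 2)) (var 0) (var 1)))))))

/-- The theory: Heyting arithmetic, the inductive definition of v-sets, the fix-point equations of
extensional equality and of its witnessing predicate, Extended Church's Thesis, and the basic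
assumptions on Meaning and Truth, for an arbitrary choice of two numbers `top`, `bot` and of a
primitive recursive function `Pi` as codes for the trivially true condition, the trivially false
condition and the conjunction of conditions. -/
inductive Theory (top bot : PRFun 0) (Pi : PRFun 2) : Set Formula
  | arith {A : Formula} (h : HA A) : Theory top bot Pi A
  | vIntro : Theory top bot Pi vIntro
  | vInd (A : Formula) : Theory top bot Pi (vInd A)
  | sim : Theory top bot Pi simAx
  | R : Theory top bot Pi rAx
  | topM : Theory top bot Pi (M (app top ![]))
  | topT : Theory top bot Pi (T (app top ![]))
  | botM : Theory top bot Pi (M (app bot ![]))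
  | botT : Theory top bot Pi (neg (T (app bot ![])))
  | PiM (p q : Term) :
      Theory top bot Pi (imp (and (M p) (imp (T p) (M q))) (M (app Pi ![p, q])))
  | PiT (p q : Term) :
      Theory top bot Pi (imp (M (app Pi ![p, q])) (iff (T (app Pi ![p, q])) (and (T p) (T q))))
  | ect {A : Formula} (hA : AlmostNegative A) (B : Formula) : Theory top bot Pi (ect A B)

end Assumptions

/-! ### The language of set theory and its interpretation -/

/-- Formulas of first-order set theory with free variables among `0, …, n - 1`; the quantifiers bind
the variable `0`; `ball y A` and `bex y A` are the bounded quantifiers over the elements of `y`. -/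
inductive SetFormula : ℕ → Type
  | eq {n : ℕ} (x y : Fin n) : SetFormula n
  | bot {n : ℕ} : SetFormula n
  | and {n : ℕ} (A B : SetFormula n) : SetFormula n
  | or {n : ℕ} (A B : SetFormula n) : SetFormula n
  | imp {n : ℕ} (A B : SetFormula n) : SetFormula n
  | all {n : ℕ} (A : SetFormula (n + 1)) : SetFormula n
  | ex {n : ℕ} (A : SetFormula (n + 1)) : SetFormula n
  | ball {n : ℕ} (y : Fin n) (A : SetFormula (n + 1)) : SetFormula n
  | bex {n : ℕ} (y : Fin n) (A : SetFormula (n + 1)) : SetFormula n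

namespace SetFormula

/-- The interpretation in arithmetic, with the terms `ρ` for the free variables: equality is
extensional equality, bounded quantifiers over `y` range over `EL(y)`, and unbounded quantifiers
range over the v-sets. -/
def interp : {n : ℕ} → SetFormula n → (Fin n → Term) → Formula
  | _, eq x y, ρ => Formula.sim (ρ x) (ρ y)
  | _, bot, _ => Formula.bot
  | _, and A B, ρ => Formula.and (A.interp ρ) (B.interp ρ)
  | _, or A B, ρ => Formula.or (A.interp ρ) (B.interp ρ)
  | _, imp A B, ρ => Formula.imp (A.interp ρ) (B.interp ρ)
  | _, all A, ρ => Formula.all (Formula.imp (Formula.V (Term.var 0))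
      (A.interp (Matrix.vecCons (Term.var 0) fun i => (ρ i).lift 1)))
  | _, ex A, ρ => Formula.ex (Formula.and (Formula.V (Term.var 0))
      (A.interp (Matrix.vecCons (Term.var 0) fun i => (ρ i).lift 1)))
  | _, ball y A, ρ => Formula.all (Formula.imp (EL ((ρ y).lift 1) (Term.var 0))
      (A.interp (Matrix.vecCons (Term.var 0) fun i => (ρ i).lift 1)))
  | _, bex y A, ρ => Formula.ex (Formula.and (EL ((ρ y).lift 1) (Term.var 0))
      (A.interp (Matrix.vecCons (Term.var 0) fun i => (ρ i).lift 1)))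

variable {n : ℕ}

def iff (A B : SetFormula n) : SetFormula n := and (imp A B) (imp B A)

/-- `x ∈ y` -/
def mem (x y : Fin n) : SetFormula n := bex y (eq x.succ 0)

/-- `x = ∅` -/
def isEmpty (x : Fin n) : SetFormula n := ball x bot

/-- `y = x ∪ {x}` -/
def isSucc (y x : Fin n) : SetFormula n :=
  and (mem x y) (and (ball x (mem 0 y.succ)) (ball y (or (mem 0 x.succ) (eq 0 x.succ))))

/-- `w = ω`: the elements of `w` are exactly `∅` and the successors of elements of `w`. -/
def isOmega (w : Fin n) : SetFormula n :=
  all (iff (mem 0 w.succ) (or (isEmpty 0) (bex w.succ (isSucc 1 0))))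

/-- `z = {a, b}` -/
def isUPair (z a b : Fin n) : SetFormula n :=
  and (mem a z) (and (mem b z) (ball z (or (eq 0 a.succ) (eq 0 b.succ))))

/-- `z = {{a}, {a, b}}` (Kuratowski's ordered pair) -/
def isOPair (z a b : Fin n) : SetFormula n :=
  and (bex z (isUPair 0 a.succ a.succ))
    (and (bex z (isUPair 0 a.succ b.succ))
      (ball z (or (isUPair 0 a.succ a.succ) (isUPair 0 a.succ b.succ))))

/-- The ordered pair of `a` and `b` is an element of `k`. -/
def opairMem (a b k : Fin n) : SetFormula n := bex k (isOPair 0 a.succ b.succ)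

/-- `k` is a function with domain `w`. -/
def isFunOn (k w : Fin n) : SetFormula n :=
  and (ball k (bex w.succ (ex (isOPair 2 1 0))))
    (and (ball w (ex (opairMem 1 0 k.succ.succ)))
      (ball w (all (all (imp
        (and (opairMem 2 1 k.succ.succ.succ) (opairMem 2 0 k.succ.succ.succ)) (eq 1 0))))))

end SetFormula

/-! ### Relativised Dependent Choices -/

section RDC

open Formula Term

/-- `v` is (an index of) the sequence of the finite von Neumann ordinals:
`v 0 = ∅` and `v (n + 1) = v n ∪ {v n}`. -/
def numeralSeq (v : Term) : Formula :=
  and (ex (and (Ap (v.lift 1) Term.zero (var 0))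
      (and (V (var 0)) ((SetFormula.isEmpty (0 : Fin 1)).interp ![var 0]))))
    (all (ex (ex
      (and (Ap (v.lift 3) (var 2) (var 1))
      (and (Ap (v.lift 3) (succ (var 2)) (var 0))
      (and (V (var 1))
      (and (V (var 0)) ((SetFormula.isSucc (0 : Fin 2) 1).interp ![var 0, var 1]))))))))

/-- Relativised Dependent Choices for the class `φ` (variable `0`) and the relation `ψ` (`ψ(x, y)`
has `x` as variable `1` and `y` as variable `0`), the other variables being parameters:
if for every v-set `x` with `φ(x)` there is a v-set `y` with `φ(y)` and `ψ(x, y)`, then for every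
v-set `x` with `φ(x)` there are a v-set `k` that is a function with domain `ω`, and a sequence `j`
of v-sets, such that `j 0 = x` and, for all `n`, `φ(j n)`, the value of `k` at (the von Neumann
ordinal) `n` is `j n`, and `ψ(j n, j (n + 1))`. -/
def rdc {N : ℕ} (φ : SetFormula (N + 1)) (ψ : Formula) : Formula :=
  imp
    (all (imp (and (V (var 0)) (φ.interp (Matrix.vecCons (var 0) fun i => var (i + 1))))
      (ex (and (V (var 0))
        (and (φ.interp (Matrix.vecCons (var 0) fun i => var (i + 2))) ψ)))))
    (all (imp (and (V (var 0)) (φ.interp (Matrix.vecCons (var 0) fun i => var (i + 1))))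
      -- `v`, `w`, `k`, `j` are the variables `3`, `2`, `1`, `0`, and `x` is `4`
      (ex (ex (ex (ex
        (and (numeralSeq (var 3))
        (and (and (V (var 2)) ((SetFormula.isOmega (0 : Fin 1)).interp ![var 2]))
        (and (and (V (var 1)) ((SetFormula.isFunOn (0 : Fin 2) 1).interp ![var 1, var 2]))
        (and (Ap (var 0) Term.zero (var 4))
          -- `n`, `a = v n`, `y = j n`, `y' = j (n + 1)` are the variables `3`, `2`, `1`, `0`,
          -- and `v`, `k`, `j` are now `7`, `5`, `4`
          (all (ex (ex (ex
            (and (Ap (var 7) (var 3) (var 2))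
            (and (Ap (var 4) (var 3) (var 1))
            (and (Ap (var 4) (succ (var 3)) (var 0))
            (and (V (var 1))
            (and (φ.interp (Matrix.vecCons (var 1) fun i => var (i + 9)))
            (and ((SetFormula.opairMem (0 : Fin 3) 1 2).interp ![var 2, var 1, var 5])
              (ψ.subst (scons (var 0) (scons (var 1) fun i => var (i + 9))))))))))))))))))))))))

end RDC

end VSets

/-!
The theorem is proved semantically. Natural deduction is complete for Kripke models over a category
of worlds (`derives_of_forces`): the worlds of the canonical model are consistent, deductively
closed, prime sets of formulas with witnesses, its morphisms are the substitutions that map one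
world into another, and a set that does not derive a formula is first renamed, to free infinitely
many variables, and then extended to a world without that formula. It remains to force
Relativised Dependent Choices in every Kripke model of the theory (`KripkeModel.forces_rdc`), which
is ordinary intuitionistic reasoning about the elements of the model; the schemes of the theory are
available for the properties that formulas define.

The argument rests on Extended Church's Thesis (`exists_index_of_almostNegative`). By `∈`-induction,
two v-sets are extensionally equal if and only if some `e` witnesses it in the sense of the
predicate `R` (`exists_R_of_sim`, `sim_of_R`), and `R` is an atom of almost-negative formulas. With
`R` in place of equality, realizability of a formula of set theory is almost negative
(`almostNegative_realizes`), and Extended Church's Thesis shows that a formula is true if and only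
if it has a realizer (`sat_iff_exists_realizes`).

Hence the class `φ` may be replaced by the almost-negative class of the pairs of a realizer of
`φ(x)` and `x`. On this class Extended Church's Thesis turns the hypothesis into a recursive
function that maps such a pair to a next one. The iteration of this function is recursive: a fixed
point of the step operation is obtained by diagonalisation (`exists_iterate`), and Extended Church's
Thesis provides all the indices that the `s`-`m`-`n` theorem would, so that nothing is needed of
Kleene's predicate except that minimal computations are unique (`Ap.unique`). This gives the
sequence `j` (`exists_rdc_sequence`).

The same principle of dependent choices yields the sequence of the finite von Neumann ordinals. Its
range is `ω` (`sat_isOmega`). The function `k` is the range of the sequence of the ordered pairs of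
the `n`-th ordinal and `j n`; it is single-valued because distinct numbers have distinct ordinals
(`IsNumeralSeq.injective`), as no v-set is a member of itself (`sat_isFunOn`).
-/

namespace VSets

/-! ### Substitution -/

/-- The substitution `σ` moved under a binder. -/
def up (σ : ℕ → Term) : ℕ → Term := scons (Term.var 0) fun k => (σ k).lift 1

namespace Term

theorem subst_subst (σ τ : ℕ → Term) (t : Term) :
    (t.subst σ).subst τ = t.subst fun k => (σ k).subst τ := by
  induction t with
  | var k => rfl
  | app f ts ih => simp only [subst, ih]

theorem subst_var (t : Term) : t.subst var = t := by
  induction t with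
  | var k => rfl
  | app f ts ih => simp only [subst, ih]

theorem lift_subst_scons (t s : Term) (σ : ℕ → Term) :
    (t.lift 1).subst (scons s σ) = t.subst σ := by
  rw [lift, subst_subst]; rfl

theorem lift_subst_up (t : Term) (σ : ℕ → Term) : (t.lift 1).subst (up σ) = (t.subst σ).lift 1 := by
  rw [up, lift_subst_scons, lift, subst_subst]; rfl

/-- A term contains only finitely many variables. -/
theorem exists_bound (t : Term) :
    ∃ N, ∀ σ τ : ℕ → Term, (∀ k < N, σ k = τ k) → t.subst σ = t.subst τ := by
  induction t with
  | var k => exact ⟨k + 1, fun σ τ h => h k (Nat.lt_succ_self k)⟩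
  | app f ts ih =>
    choose N hN using ih
    refine ⟨Finset.univ.sup N, fun σ τ h => ?_⟩
    simp only [subst]
    congr 1
    funext i
    exact hN i σ τ fun k hk => h k (hk.trans_le (Finset.le_sup (Finset.mem_univ i)))

end Term

theorem up_subst_up (σ τ : ℕ → Term) :
    (fun k => (up σ k).subst (up τ)) = up fun k => (σ k).subst τ := by
  funext k
  cases k with
  | zero => rfl
  | succ k => exact Term.lift_subst_up (σ k) τ

theorem up_var : up Term.var = Term.var := by
  funext k
  cases k <;> rfl

theorem up_congr {N : ℕ} {σ τ : ℕ → Term} (h : ∀ k < N, σ k = τ k) :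
    ∀ k < N + 1, up σ k = up τ k := by
  intro k hk
  cases k with
  | zero => rfl
  | succ k => exact congrArg (Term.lift 1) (h k (Nat.lt_of_succ_lt_succ hk))

namespace Formula

theorem subst_subst (A : Formula) (σ τ : ℕ → Term) :
    (A.subst σ).subst τ = A.subst fun k => (σ k).subst τ := by
  induction A generalizing σ τ with
  | all A ih | ex A ih =>
    simp only [subst]
    congr 1
    refine (ih _ _).trans (congrArg (fun θ => A.subst θ) ?_)
    exact up_subst_up σ τ
  | _ => simp_all only [subst, Term.subst_subst]

theorem subst_var (A : Formula) : A.subst Term.var = A := by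
  induction A with
  | all A ih | ex A ih =>
    simp only [subst]
    congr 1
    exact (congrArg (fun θ => A.subst θ) up_var).trans ih
  | _ => simp_all only [subst, Term.subst_var]

theorem inst_subst (A : Formula) (t : Term) (σ : ℕ → Term) :
    (A.inst t).subst σ = (A.subst (up σ)).inst (t.subst σ) := by
  rw [inst, inst, subst_subst, subst_subst]
  congr 1
  funext k
  cases k with
  | zero => rfl
  | succ k => exact ((Term.lift_subst_scons (σ k) _ _).trans (Term.subst_var _)).symm

theorem lift_subst_up (A : Formula) (σ : ℕ → Term) :
    (A.lift 1).subst (up σ) = (A.subst σ).lift 1 := by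
  rw [lift, lift, subst_subst, subst_subst]
  rfl

theorem subst_up_inst (A : Formula) (σ : ℕ → Term) (t : Term) :
    (A.subst (up σ)).inst t = A.subst (scons t σ) := by
  rw [inst, subst_subst]
  congr 1
  funext k
  cases k with
  | zero => rfl
  | succ k => exact (Term.lift_subst_scons (σ k) _ _).trans (Term.subst_var _)

/-- A formula contains only finitely many free variables. -/
theorem exists_bound (A : Formula) :
    ∃ N, ∀ σ τ : ℕ → Term, (∀ k < N, σ k = τ k) → A.subst σ = A.subst τ := by
  induction A with
  | bot => exact ⟨0, fun _ _ _ => rfl⟩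
  | V t | M t | T t =>
    obtain ⟨N, hN⟩ := t.exists_bound
    exact ⟨N, fun σ τ h => by simp only [subst, hN σ τ h]⟩
  | eq s t | sim s t =>
    obtain ⟨N, hN⟩ := s.exists_bound
    obtain ⟨L, hL⟩ := t.exists_bound
    refine ⟨N + L, fun σ τ h => ?_⟩
    simp only [subst, hN σ τ fun k hk => h k (by omega), hL σ τ fun k hk => h k (by omega)]
  | R e s t =>
    obtain ⟨N, hN⟩ := s.exists_bound
    obtain ⟨L, hL⟩ := t.exists_bound
    obtain ⟨P, hP⟩ := e.exists_bound
    refine ⟨N + L + P, fun σ τ h => ?_⟩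
    simp only [subst, hN σ τ fun k hk => h k (by omega), hL σ τ fun k hk => h k (by omega),
      hP σ τ fun k hk => h k (by omega)]
  | and A B ihA ihB | or A B ihA ihB | imp A B ihA ihB =>
    obtain ⟨N, hN⟩ := ihA
    obtain ⟨L, hL⟩ := ihB
    refine ⟨N + L, fun σ τ h => ?_⟩
    simp only [subst, hN σ τ fun k hk => h k (by omega), hL σ τ fun k hk => h k (by omega)]
  | all A ih | ex A ih =>
    obtain ⟨N, hN⟩ := ih
    refine ⟨N, fun σ τ h => ?_⟩
    simp only [subst]
    congr 1
    exact hN _ _ fun k hk => up_congr h k (by omega)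

end Formula

/-! ### Derivability -/

namespace Derives

variable {Ax : Set Formula}

theorem weaken {Γ Γ' : List Formula} {A : Formula} (h : Derives Ax Γ A) (hΓ : Γ ⊆ Γ') :
    Derives Ax Γ' A := by
  induction h generalizing Γ' with
  | ax h => exact ax h
  | hyp h => exact hyp (hΓ h)
  | botE _ ih => exact botE (ih hΓ)
  | andI _ _ ih₁ ih₂ => exact andI (ih₁ hΓ) (ih₂ hΓ)
  | andL _ ih => exact andL (ih hΓ)
  | andR _ ih => exact andR (ih hΓ)
  | orL _ ih => exact orL (ih hΓ)
  | orR _ ih => exact orR (ih hΓ)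
  | orE _ _ _ ih ih₁ ih₂ =>
    exact orE (ih hΓ) (ih₁ (List.cons_subset_cons _ hΓ)) (ih₂ (List.cons_subset_cons _ hΓ))
  | impI _ ih => exact impI (ih (List.cons_subset_cons _ hΓ))
  | impE _ _ ih₁ ih₂ => exact impE (ih₁ hΓ) (ih₂ hΓ)
  | allI _ ih => exact allI (ih (List.map_subset _ hΓ))
  | allE t _ ih => exact allE t (ih hΓ)
  | exI t _ ih => exact exI t (ih hΓ)
  | exE _ _ ih₁ ih₂ =>
    exact exE (ih₁ hΓ) (ih₂ (List.cons_subset_cons _ (List.map_subset _ hΓ)))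
  | eqI t => exact eqI t
  | eqE _ _ ih₁ ih₂ => exact eqE (ih₁ hΓ) (ih₂ hΓ)

/-- The substitution of `ts 0, …, ts (N - 1)` for the first `N` variables. -/
def consN : ℕ → (ℕ → Term) → ℕ → Term
  | 0, _ => Term.var
  | N + 1, ts => scons (ts 0) (consN N fun k => ts (k + 1))

theorem consN_eq (N : ℕ) (ts : ℕ → Term) : ∀ k < N, consN N ts k = ts k := by
  induction N generalizing ts with
  | zero => intro k hk; omega
  | succ N ih =>
    intro k hk
    cases k with
    | zero => rfl
    | succ k => exact ih _ k (by omega)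

theorem subst_consN (N : ℕ) (ts : ℕ → Term) {A : Formula} (h : Derives Ax [] A) :
    Derives Ax [] (A.subst (consN N ts)) := by
  induction N generalizing ts A with
  | zero => rwa [consN, Formula.subst_var]
  | succ N ih =>
    have := (ih (fun k => ts (k + 1)) (allI (Γ := []) h)).allE (ts 0)
    rwa [← up, Formula.subst_up_inst] at this

/-- Theorems are closed under substitution, whatever the axioms: generalise the finitely many free
variables and specialise them. -/
theorem subst_nil {A : Formula} (h : Derives Ax [] A) (σ : ℕ → Term) :
    Derives Ax [] (A.subst σ) := by
  obtain ⟨N, hN⟩ := A.exists_bound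
  rw [← hN _ _ (consN_eq N σ)]
  exact subst_consN N σ h

theorem map_lift_subst (Γ : List Formula) (σ : ℕ → Term) :
    (Γ.map (Formula.lift 1)).map (Formula.subst (up σ)) =
      (Γ.map (Formula.subst σ)).map (Formula.lift 1) := by
  simp [Formula.lift_subst_up]

/-- Derivability is closed under substitution. The axioms need not be closed under it, but
theorems are. -/
theorem subst {Γ : List Formula} {A : Formula} (h : Derives Ax Γ A) (σ : ℕ → Term) :
    Derives Ax (Γ.map (Formula.subst σ)) (A.subst σ) := by
  induction h generalizing σ with
  | ax h => exact (subst_nil (ax h) σ).weaken (List.nil_subset _)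
  | hyp h => exact hyp (List.mem_map_of_mem h)
  | botE _ ih => exact botE (ih σ)
  | andI _ _ ih₁ ih₂ => exact andI (ih₁ σ) (ih₂ σ)
  | andL _ ih => exact andL (ih σ)
  | andR _ ih => exact andR (ih σ)
  | orL _ ih => exact orL (ih σ)
  | orR _ ih => exact orR (ih σ)
  | orE _ _ _ ih ih₁ ih₂ => exact orE (ih σ) (ih₁ σ) (ih₂ σ)
  | impI _ ih => exact impI (ih σ)
  | impE _ _ ih₁ ih₂ => exact impE (ih₁ σ) (ih₂ σ)
  | allI _ ih =>
    refine allI ?_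
    rw [← map_lift_subst]
    exact ih (up σ)
  | allE t _ ih =>
    rw [Formula.inst_subst]
    exact allE _ (ih σ)
  | exI t _ ih =>
    refine exI (t.subst σ) ?_
    rw [← up, ← Formula.inst_subst]
    exact ih σ
  | exE _ _ ih₁ ih₂ =>
    refine exE (ih₁ σ) ?_
    rw [← map_lift_subst, ← Formula.lift_subst_up]
    exact ih₂ (up σ)
  | eqI t => exact eqI _
  | @eqE Γ A s t _ _ ih₁ ih₂ =>
    rw [Formula.inst_subst]
    refine eqE (ih₁ σ) ?_
    rw [← Formula.inst_subst]
    exact ih₂ σ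

theorem cut {Γ : List Formula} {A B : Formula} (h₁ : Derives Ax Γ A) (h₂ : Derives Ax (A :: Γ) B) :
    Derives Ax Γ B :=
  impE (impI h₂) h₁

theorem eq_symm {Γ : List Formula} {s t : Term} (h : Derives Ax Γ (Formula.eq s t)) :
    Derives Ax Γ (Formula.eq t s) := by
  have key : ∀ u : Term, (Formula.eq (Term.var 0) (s.lift 1)).inst u = Formula.eq u s := fun u => by
    simp only [Formula.inst, Formula.subst, Term.lift_subst_scons, Term.subst_var]; rfl
  have := eqE (A := Formula.eq (Term.var 0) (s.lift 1)) h
  rw [key, key] at this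
  exact this (eqI s)

/-- The rule of replacement, in the form that keeps the substitution for the other variables. -/
theorem subst_eq {Γ : List Formula} {s t : Term} (A : Formula) (σ : ℕ → Term)
    (h : Derives Ax Γ (Formula.eq s t)) (hA : Derives Ax Γ (A.subst (scons s σ))) :
    Derives Ax Γ (A.subst (scons t σ)) := by
  rw [← Formula.subst_up_inst] at hA ⊢
  exact eqE h hA

end Derives

/-! ### Kripke models -/

/-- Extend an assignment by a value for the variable `0`. -/
def econs {α : Type*} (a : α) (ρ : ℕ → α) : ℕ → α
  | 0 => a
  | k + 1 => ρ k

/-- A Kripke model for the language of `Formula`, over a category of worlds. The domains vary with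
the world; along a morphism of worlds elements are transported by `tr`, and equality is equality. -/
structure KripkeModel where
  World : Type
  Hom : World → World → Type
  id (w : World) : Hom w w
  comp {u v w : World} : Hom u v → Hom v w → Hom u w
  Dom : World → Type
  tr {v w : World} : Hom v w → Dom v → Dom w
  tr_id {w : World} (d : Dom w) : tr (id w) d = d
  tr_comp {u v w : World} (f : Hom u v) (g : Hom v w) (d : Dom u) : tr (comp f g) d = tr g (tr f d)
  fn {w : World} {n : ℕ} : PRFun n → (Fin n → Dom w) → Dom w
  tr_fn {v w : World} (f : Hom v w) {n : ℕ} (p : PRFun n) (a : Fin n → Dom v) :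
    tr f (fn p a) = fn p fun i => tr f (a i)
  V {w : World} : Dom w → Prop
  M {w : World} : Dom w → Prop
  T {w : World} : Dom w → Prop
  sim {w : World} : Dom w → Dom w → Prop
  R {w : World} : Dom w → Dom w → Dom w → Prop
  tr_V {v w : World} (f : Hom v w) {a : Dom v} : V a → V (tr f a)
  tr_M {v w : World} (f : Hom v w) {a : Dom v} : M a → M (tr f a)
  tr_T {v w : World} (f : Hom v w) {a : Dom v} : T a → T (tr f a)
  tr_sim {v w : World} (f : Hom v w) {a b : Dom v} : sim a b → sim (tr f a) (tr f b)
  tr_R {v w : World} (f : Hom v w) {a b c : Dom v} : R a b c → R (tr f a) (tr f b) (tr f c)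

namespace KripkeModel

variable (K : KripkeModel)

/-- The value of a term. -/
def eval {w : K.World} (ρ : ℕ → K.Dom w) : Term → K.Dom w
  | Term.var k => ρ k
  | Term.app p ts => K.fn p fun i => eval ρ (ts i)

/-- The formula `A` is forced under the assignment `ρ`. -/
def forces : Formula → ∀ {w : K.World}, (ℕ → K.Dom w) → Prop
  | Formula.eq s t, _, ρ => K.eval ρ s = K.eval ρ t
  | Formula.V t, _, ρ => K.V (K.eval ρ t)
  | Formula.M t, _, ρ => K.M (K.eval ρ t)
  | Formula.T t, _, ρ => K.T (K.eval ρ t)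
  | Formula.sim s t, _, ρ => K.sim (K.eval ρ s) (K.eval ρ t)
  | Formula.R e s t, _, ρ => K.R (K.eval ρ e) (K.eval ρ s) (K.eval ρ t)
  | Formula.bot, _, _ => False
  | Formula.and A B, _, ρ => forces A ρ ∧ forces B ρ
  | Formula.or A B, _, ρ => forces A ρ ∨ forces B ρ
  | Formula.imp A B, w, ρ => ∀ (w' : K.World) (f : K.Hom w w'),
      forces A (fun k => K.tr f (ρ k)) → forces B fun k => K.tr f (ρ k)
  | Formula.all A, w, ρ => ∀ (w' : K.World) (f : K.Hom w w') (d : K.Dom w'),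
      forces A (econs d fun k => K.tr f (ρ k))
  | Formula.ex A, w, ρ => ∃ d : K.Dom w, forces A (econs d ρ)

end KripkeModel

/-! ### Countability of the language -/

/-- An injective numbering of the function symbols. -/
def PRFun.code : {n : ℕ} → PRFun n → ℕ
  | _, PRFun.zero => Nat.pair 0 0
  | _, PRFun.succ => Nat.pair 1 0
  | _, PRFun.proj i => Nat.pair 2 i
  | _, @PRFun.comp m _ f g =>
    Nat.pair 3 (Nat.pair m (Nat.pair f.code (Encodable.encode fun i => (g i).code)))
  | _, PRFun.prec f g => Nat.pair 4 (Nat.pair f.code g.code)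

theorem PRFun.code_injective {n : ℕ} (f g : PRFun n) (h : f.code = g.code) : f = g := by
  induction f with
  | zero => cases g <;> simp_all [code, Nat.pair_eq_pair]
  | succ => cases g <;> simp_all [code, Nat.pair_eq_pair]
  | proj i => cases g <;> simp_all [code, Nat.pair_eq_pair, Fin.ext_iff]
  | @comp m n f gs ihf ihg =>
    cases g with
    | @comp m' _ f' gs' =>
      simp only [code, Nat.pair_eq_pair, true_and] at h
      obtain ⟨rfl, h₁, h₂⟩ := h
      rw [ihf _ h₁]
      congr 1
      funext i
      exact ihg i _ (congrFun (Encodable.encode_injective h₂) i)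
    | _ => simp [code, Nat.pair_eq_pair] at h
  | prec f g ihf ihg =>
    cases g with
    | prec f' g' =>
      simp only [code, Nat.pair_eq_pair, true_and] at h
      rw [ihf _ h.1, ihg _ h.2]
    | _ => simp [code, Nat.pair_eq_pair] at h

/-- An injective numbering of the terms. -/
def Term.code : Term → ℕ
  | Term.var k => Nat.pair 0 k
  | @Term.app n f ts =>
    Nat.pair 1 (Nat.pair n (Nat.pair f.code (Encodable.encode fun i => (ts i).code)))

theorem Term.code_injective (s t : Term) (h : s.code = t.code) : s = t := by
  induction s generalizing t with
  | var k => cases t <;> simp_all [code, Nat.pair_eq_pair]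
  | @app n f ts ih =>
    cases t with
    | var => simp [code, Nat.pair_eq_pair] at h
    | @app n' f' ts' =>
      simp only [code, Nat.pair_eq_pair, true_and] at h
      obtain ⟨rfl, h₁, h₂⟩ := h
      rw [PRFun.code_injective _ _ h₁]
      congr 1
      funext i
      exact ih i _ (congrFun (Encodable.encode_injective h₂) i)

/-- An injective numbering of the formulas. -/
def Formula.code : Formula → ℕ
  | eq s t => Nat.pair 0 (Nat.pair s.code t.code)
  | V t => Nat.pair 1 t.code
  | M t => Nat.pair 2 t.code
  | T t => Nat.pair 3 t.code
  | sim s t => Nat.pair 4 (Nat.pair s.code t.code)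
  | R e s t => Nat.pair 5 (Nat.pair e.code (Nat.pair s.code t.code))
  | bot => Nat.pair 6 0
  | and A B => Nat.pair 7 (Nat.pair A.code B.code)
  | or A B => Nat.pair 8 (Nat.pair A.code B.code)
  | imp A B => Nat.pair 9 (Nat.pair A.code B.code)
  | all A => Nat.pair 10 A.code
  | ex A => Nat.pair 11 A.code

theorem Formula.code_injective (A B : Formula) (h : A.code = B.code) : A = B := by
  induction A generalizing B with
  | eq | V | M | T | sim | R | bot =>
    cases B <;> simp only [code, Nat.pair_eq_pair] at h <;> try (exact absurd h.1 (by decide))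
    all_goals (obtain ⟨-, h⟩ := h)
    all_goals (try obtain ⟨h₁, h₂⟩ := h)
    all_goals (try obtain ⟨h₂, h₃⟩ := h₂)
    all_goals simp only [eq.injEq, V.injEq, M.injEq, T.injEq, sim.injEq, R.injEq]
    all_goals (try constructor) <;> (try constructor) <;>
      exact Term.code_injective _ _ (by assumption)
  | and P Q ihP ihQ | or P Q ihP ihQ | imp P Q ihP ihQ =>
    cases B <;> simp only [code, Nat.pair_eq_pair] at h <;> try (exact absurd h.1 (by decide))
    rw [ihP _ h.2.1, ihQ _ h.2.2]
  | all A ih | ex A ih =>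
    cases B <;> simp only [code, Nat.pair_eq_pair] at h <;> try (exact absurd h.1 (by decide))
    rw [ih _ h.2]

instance : Countable Formula := ⟨⟨Formula.code, fun A B h => Formula.code_injective A B h⟩⟩

/-! ### Completeness -/

namespace Completeness

variable {Ax : Set Formula}

/-- `C` is derivable from finitely many elements of `S`. -/
def Prov (Ax S : Set Formula) (C : Formula) : Prop := ∃ Γ, (∀ B ∈ Γ, B ∈ S) ∧ Derives Ax Γ C

theorem Prov.mono {S S' : Set Formula} {C : Formula} (h : Prov Ax S C) (hS : S ⊆ S') :
    Prov Ax S' C := by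
  obtain ⟨Γ, hΓ, hd⟩ := h
  exact ⟨Γ, fun B hB => hS (hΓ B hB), hd⟩

open Classical in
theorem prov_insert {S : Set Formula} {A C : Formula} (h : Prov Ax (insert A S) C) :
    ∃ Γ, (∀ B ∈ Γ, B ∈ S) ∧ Derives Ax (A :: Γ) C := by
  obtain ⟨Γ, hΓ, hd⟩ := h
  refine ⟨Γ.filter (· ≠ A), fun B hB => ?_, hd.weaken fun B hB => ?_⟩
  · rw [List.mem_filter] at hB
    exact (hΓ B hB.1).resolve_left (by simpa using hB.2)
  · by_cases hA : B = A
    · simp [hA]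
    · exact List.mem_cons_of_mem _ (List.mem_filter.2 ⟨hB, by simpa using hA⟩)

theorem prov_cut {S : Set Formula} {A C : Formula} (h₁ : Prov Ax S A)
    (h₂ : Prov Ax (insert A S) C) : Prov Ax S C := by
  obtain ⟨Γ, hΓ, hd⟩ := prov_insert h₂
  obtain ⟨Γ', hΓ', hd'⟩ := h₁
  refine ⟨Γ' ++ Γ, fun B hB => ?_, ?_⟩
  · rcases List.mem_append.1 hB with h | h
    exacts [hΓ' B h, hΓ B h]
  · exact (hd'.weaken (List.subset_append_left _ _)).cut
      (hd.weaken (List.cons_subset_cons _ (List.subset_append_right _ _)))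

/-- The variable `c` does not occur in `B`. -/
def Fresh (c : ℕ) (B : Formula) : Prop :=
  ∀ σ τ : ℕ → Term, (∀ k, k ≠ c → σ k = τ k) → B.subst σ = B.subst τ

theorem exists_fresh (B : Formula) : ∃ N, ∀ c, N ≤ c → Fresh c B := by
  obtain ⟨N, hN⟩ := B.exists_bound
  exact ⟨N, fun c hc σ τ h => hN σ τ fun k hk => h k (by omega)⟩

theorem exists_fresh_list (Γ : List Formula) : ∃ N, ∀ c, N ≤ c → ∀ B ∈ Γ, Fresh c B := by
  induction Γ with
  | nil => exact ⟨0, by simp⟩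
  | cons A Γ ih =>
    obtain ⟨N, hN⟩ := ih
    obtain ⟨L, hL⟩ := exists_fresh A
    refine ⟨N + L, fun c hc B hB => ?_⟩
    rcases List.mem_cons.1 hB with rfl | hB
    exacts [hL c (by omega), hN c (by omega) B hB]

/-- Existential elimination with a fresh free variable as the witness. -/
theorem derives_of_witness {Γ : List Formula} {A C : Formula} {c : ℕ} (hΓ : ∀ B ∈ Γ, Fresh c B)
    (hA : Fresh c (Formula.ex A)) (hC : Fresh c C) (hex : Derives Ax Γ (Formula.ex A))
    (h : Derives Ax (A.inst (Term.var c) :: Γ) C) : Derives Ax Γ C := by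
  -- the substitution that makes `c` the variable bound by the elimination rule
  let θ : ℕ → Term := fun k => if k = c then Term.var 0 else Term.var (k + 1)
  have hθ : ∀ {B : Formula}, Fresh c B → B.subst θ = B.lift 1 := fun hB =>
    hB _ _ fun k hk => by simp [θ, hk]
  have h' := h.subst θ
  have hA' : (A.inst (Term.var c)).subst θ = A := by
    have h₁ := hθ hA
    simp only [Formula.lift, Formula.subst, Formula.ex.injEq] at h₁
    rw [Formula.inst_subst]
    simp only [up, h₁, Term.subst, θ, if_true]
    rw [Formula.inst, Formula.subst_subst]
    refine Eq.trans ?_ A.subst_var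
    congr 1
    funext k
    cases k <;> rfl
  rw [List.map_cons, hA', hθ hC, List.map_congr_left fun B hB => hθ (hΓ B hB)] at h'
  exact hex.exE h'

/-- A world of the canonical model: a consistent, deductively closed, prime set of formulas with
witnesses for its existential elements. -/
structure World (Ax : Set Formula) where
  carrier : Set Formula
  closed {Γ : List Formula} {A : Formula} :
    (∀ B ∈ Γ, B ∈ carrier) → Derives Ax Γ A → A ∈ carrier
  consistent : Formula.bot ∉ carrier
  prime {A B : Formula} : Formula.or A B ∈ carrier → A ∈ carrier ∨ B ∈ carrier
  henkin {A : Formula} : Formula.ex A ∈ carrier → ∃ t, A.inst t ∈ carrier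

/-- One step of the construction of a world: decide the formula `A`. -/
theorem exists_step {S : Set Formula} {C : Formula}
    (hS : ∀ N, ∃ c, N ≤ c ∧ ∀ B ∈ S, Fresh c B) (Γ : List Formula)
    (hΓ : ¬ Prov Ax (S ∪ {B | B ∈ Γ}) C) (A : Formula) :
    ∃ Γ' : List Formula, Γ ⊆ Γ' ∧ ¬ Prov Ax (S ∪ {B | B ∈ Γ'}) C ∧
      (Prov Ax (insert A (S ∪ {B | B ∈ Γ})) C ∨
        (A ∈ Γ' ∧ ∀ A', A = Formula.ex A' → ∃ t, A'.inst t ∈ Γ')) := by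
  by_cases h : Prov Ax (insert A (S ∪ {B | B ∈ Γ})) C
  · exact ⟨Γ, List.Subset.refl _, hΓ, Or.inl h⟩
  have hins : ∀ (A : Formula) (Γ : List Formula),
      S ∪ {B | B ∈ A :: Γ} = insert A (S ∪ {B | B ∈ Γ}) := by
    intro A Γ
    ext B
    simp only [Set.mem_union, Set.mem_ofPred_eq, List.mem_cons, Set.mem_insert_iff]
    tauto
  by_cases hA : ∃ A', A = Formula.ex A'
  · obtain ⟨A', rfl⟩ := hA
    obtain ⟨N, hN⟩ := exists_fresh_list (C :: Formula.ex A' :: Γ)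
    obtain ⟨c, hc, hcS⟩ := hS N
    have hfr := hN c hc
    refine ⟨A'.inst (Term.var c) :: Formula.ex A' :: Γ,
      fun B hB => List.mem_cons_of_mem _ (List.mem_cons_of_mem _ hB), fun hp => h ?_,
      Or.inr ⟨by simp, ?_⟩⟩
    · rw [hins] at hp
      obtain ⟨Θ, hΘ, hd⟩ := prov_insert hp
      refine ⟨Formula.ex A' :: Θ, fun B hB => ?_, ?_⟩
      · rw [← hins]
        rcases List.mem_cons.1 hB with rfl | hB
        exacts [Or.inr (by simp), hΘ B hB]
      · refine derives_of_witness (c := c) (fun B hB => ?_) (hfr _ (by simp)) (hfr _ (by simp))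
          (Derives.hyp (List.mem_cons_self ..))
          (hd.weaken (List.cons_subset_cons _ (List.subset_cons_self _ _)))
        rcases List.mem_cons.1 hB with rfl | hB
        · exact hfr _ (by simp)
        · rcases hΘ B hB with hB | hB
          exacts [hcS B hB, hfr B (List.mem_cons_of_mem _ hB)]
    · rintro A'' h
      obtain rfl := Formula.ex.inj h
      exact ⟨_, List.mem_cons_self ..⟩
  · refine ⟨A :: Γ, List.subset_cons_self _ _, by rwa [hins], Or.inr ⟨by simp, ?_⟩⟩
    exact fun A' h => absurd ⟨A', h⟩ hA

/-- A set of formulas that leaves infinitely many variables unused and does not prove `C` extends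
to a world without `C`. -/
theorem exists_world {S : Set Formula} {C : Formula}
    (hS : ∀ N, ∃ c, N ≤ c ∧ ∀ B ∈ S, Fresh c B) (hC : ¬ Prov Ax S C) :
    ∃ w : World Ax, S ⊆ w.carrier ∧ C ∉ w.carrier := by
  have : Nonempty Formula := ⟨Formula.bot⟩
  obtain ⟨enum, henum⟩ := exists_surjective_nat Formula
  choose! next hsub hnp hdec using fun Γ hΓ => exists_step (Ax := Ax) (C := C) hS Γ hΓ
  let stage : ℕ → List Formula := fun n => Nat.rec [] (fun n Γ => next Γ (enum n)) n
  have hstage : ∀ n, ¬ Prov Ax (S ∪ {B | B ∈ stage n}) C := by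
    intro n
    induction n with
    | zero => simpa [stage] using hC
    | succ n ih => exact hnp _ ih (enum n)
  have hmono : Monotone fun n => S ∪ {B | B ∈ stage n} :=
    monotone_nat_of_le_succ fun n =>
      Set.union_subset_union_right _ fun B hB => hsub _ (hstage n) (enum n) hB
  let Δ : Set Formula := ⋃ n, S ∪ {B | B ∈ stage n}
  have hle : ∀ n, S ∪ {B | B ∈ stage n} ⊆ Δ := fun n =>
    Set.subset_iUnion (fun n => S ∪ {B | B ∈ stage n}) n
  have hΔ : ¬ Prov Ax Δ C := by
    rintro ⟨Γ, hΓ, hd⟩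
    have : ∃ n, ∀ B ∈ Γ, B ∈ S ∪ {B | B ∈ stage n} := by
      clear hd
      induction Γ with
      | nil => exact ⟨0, by simp⟩
      | cons A Γ ih =>
        obtain ⟨n, hn⟩ := ih fun B hB => hΓ B (List.mem_cons_of_mem _ hB)
        obtain ⟨m, hm⟩ := Set.mem_iUnion.1 (hΓ A (List.mem_cons_self ..))
        refine ⟨max m n, fun B hB => ?_⟩
        rcases List.mem_cons.1 hB with rfl | hB
        exacts [hmono (le_max_left m n) hm, hmono (le_max_right m n) (hn B hB)]
    obtain ⟨n, hn⟩ := this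
    exact hstage n ⟨Γ, hn, hd⟩
  -- `Δ` is maximal among the sets that do not prove `C`, and has witnesses
  have hmax : ∀ A, ¬ Prov Ax (insert A Δ) C →
      A ∈ Δ ∧ ∀ A', A = Formula.ex A' → ∃ t, A'.inst t ∈ Δ := by
    intro A hA
    obtain ⟨n, rfl⟩ := henum A
    rcases hdec _ (hstage n) (enum n) with h | ⟨h₁, h₂⟩
    · exact absurd (h.mono (Set.insert_subset_insert (hle n))) hA
    · refine ⟨hle (n + 1) (Or.inr h₁), fun A' hA' => ?_⟩
      obtain ⟨t, ht⟩ := h₂ A' hA'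
      exact ⟨t, hle (n + 1) (Or.inr ht)⟩
  have hclosed : ∀ A, Prov Ax Δ A → A ∈ Δ := fun A hA =>
    (hmax A fun h => hΔ (prov_cut hA h)).1
  refine ⟨⟨Δ, fun hΓ hd => hclosed _ ⟨_, hΓ, hd⟩, fun h => hΔ ⟨[Formula.bot], by simpa using h,
    Derives.botE (Derives.hyp (by simp))⟩, ?_, ?_⟩, Set.subset_union_left.trans (hle 0),
    fun h => hΔ ⟨[C], by simpa using h, Derives.hyp (by simp)⟩⟩
  · intro A B hAB
    by_contra hn
    rw [not_or] at hn
    have h₁ : Prov Ax (insert A Δ) C := by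
      by_contra h
      exact hn.1 (hmax A h).1
    have h₂ : Prov Ax (insert B Δ) C := by
      by_contra h
      exact hn.2 (hmax B h).1
    obtain ⟨Γ, hΓ, hd⟩ := prov_insert h₁
    obtain ⟨Γ', hΓ', hd'⟩ := prov_insert h₂
    refine hΔ ⟨Formula.or A B :: (Γ ++ Γ'), fun D hD => ?_,
      Derives.orE (A := A) (B := B) (Derives.hyp (by simp)) (hd.weaken ?_) (hd'.weaken ?_)⟩
    · rcases List.mem_cons.1 hD with rfl | hD
      · exact hAB
      · exact (List.mem_append.1 hD).elim (hΓ D) (hΓ' D)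
    · intro D hD
      simp only [List.mem_cons, List.mem_append] at hD ⊢
      tauto
    · intro D hD
      simp only [List.mem_cons, List.mem_append] at hD ⊢
      tauto
  · intro A hA
    exact (hmax _ fun h => hΔ (prov_cut ⟨[_], by simpa using hA, Derives.hyp (by simp)⟩ h)).2 A rfl

namespace World

variable (w : World Ax)

/-- Worlds are closed under the replacement of all variables at once by equal terms. -/
theorem mem_of_subst_eq {σ τ : ℕ → Term} (h : ∀ k, Formula.eq (σ k) (τ k) ∈ w.carrier)
    {A : Formula} (hA : A.subst σ ∈ w.carrier) : A.subst τ ∈ w.carrier := by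
  obtain ⟨N, hN⟩ := A.exists_bound
  -- replace the terms for the variables one after the other
  have key : ∀ n, A.subst (fun k => if k < n then τ k else σ k) ∈ w.carrier := by
    intro n
    induction n with
    | zero => simpa using hA
    | succ n ih =>
      have hsplit : ∀ t, A.subst (fun k => if k = n then t else if k < n then τ k else σ k) =
          (A.subst fun k => if k = n then Term.var 0 else Term.var (k + 1)).subst
            (scons t fun k => if k < n then τ k else σ k) := by
        intro t
        rw [Formula.subst_subst]
        congr 1
        funext k
        by_cases hk : k = n <;> simp [hk, Term.subst, scons]
      have h₁ : (fun k => if k < n + 1 then τ k else σ k) =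
          fun k => if k = n then τ n else if k < n then τ k else σ k := by
        funext k
        rcases lt_trichotomy k n with hk | rfl | hk
        · simp [hk, hk.ne, Nat.lt_succ_of_lt hk]
        · simp
        · simp [hk.ne', not_lt_of_gt hk, show ¬ k < n + 1 by omega]
      have h₂ : (fun k => if k < n then τ k else σ k) =
          fun k => if k = n then σ n else if k < n then τ k else σ k := by
        funext k
        by_cases hk : k = n <;> simp [hk]
      rw [h₁, hsplit]
      rw [h₂, hsplit] at ih
      refine w.closed (Γ := [Formula.eq (σ n) (τ n), _]) ?_
        (Derives.subst_eq _ _ (Derives.hyp (List.mem_cons_self ..))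
          (Derives.hyp (List.mem_cons_of_mem _ (List.mem_cons_self ..))))
      intro B hB
      rcases List.mem_cons.1 hB with rfl | hB
      · exact h n
      · rw [List.mem_singleton.1 hB]
        exact ih
  rw [← hN _ τ fun k hk => if_pos hk]
  exact key N

/-- Provable equality in a world. -/
def setoid : Setoid Term where
  r s t := Formula.eq s t ∈ w.carrier
  iseqv :=
    { refl := fun t => w.closed (Γ := []) (by simp) (Derives.eqI t)
      symm := fun {s t} h => w.closed (Γ := [Formula.eq s t]) (by simpa using h)
        (Derives.eq_symm (Derives.hyp (by simp)))
      trans := fun {s t u} h₁ h₂ => w.closed (Γ := [Formula.eq t u, Formula.eq s t])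
        (by simpa using ⟨h₂, h₁⟩)
        (Derives.subst_eq (s := t) (t := u) (Formula.eq (Term.var 1) (Term.var 0)) (fun _ => s)
          (Derives.hyp (by simp)) (Derives.hyp (List.mem_cons_of_mem _ (List.mem_cons_self ..)))) }

theorem mk_eq {s t : Term} :
    Quotient.mk w.setoid s = Quotient.mk w.setoid t ↔ Formula.eq s t ∈ w.carrier :=
  Quotient.eq (r := w.setoid)

theorem out_eq (t : Term) : Formula.eq (Quotient.mk w.setoid t).out t ∈ w.carrier :=
  w.mk_eq.1 (Quotient.out_eq _)

/-- Whether a formula belongs to a world does not depend on the representatives chosen for the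
classes of its parameters. -/
theorem subst_out_iff (A : Formula) (σ : ℕ → Term) :
    A.subst (fun k => (Quotient.mk w.setoid (σ k)).out) ∈ w.carrier ↔ A.subst σ ∈ w.carrier :=
  ⟨w.mem_of_subst_eq fun k => w.out_eq (σ k),
    w.mem_of_subst_eq fun k => w.setoid.symm (w.out_eq (σ k))⟩

theorem closed_one {A B : Formula} (h : A ∈ w.carrier) (hd : Derives Ax [A] B) : B ∈ w.carrier :=
  w.closed (by simpa using h) hd

theorem app_eq {n : ℕ} (p : PRFun n) {s t : Fin n → Term}
    (h : ∀ i, Formula.eq (s i) (t i) ∈ w.carrier) :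
    Formula.eq (Term.app p s) (Term.app p t) ∈ w.carrier := by
  let A : Formula := Formula.eq (Term.var 0) (Term.app p fun i => Term.var (i + 1))
  have key : ∀ r : Fin n → Term,
      A.subst (scons (Term.app p s) fun k => if hk : k < n then r ⟨k, hk⟩ else Term.zero) =
        Formula.eq (Term.app p s) (Term.app p r) := by
    intro r
    simp [A, Formula.subst, Term.subst, scons]
  rw [← key]
  refine w.mem_of_subst_eq (σ := scons (Term.app p s) fun k =>
    if hk : k < n then s ⟨k, hk⟩ else Term.zero) (fun k => ?_) ?_
  · cases k with
    | zero => exact w.setoid.refl _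
    | succ k =>
      simp only [scons]
      split
      exacts [h _, w.setoid.refl _]
  · rw [key]
    exact w.setoid.refl _

end World

/-- The canonical Kripke model. Its morphisms are the substitutions under which a world is included
in another one, and its elements are the terms up to equality. -/
noncomputable def canonicalModel (Ax : Set Formula) : KripkeModel where
  World := World Ax
  Hom v w := { σ : ℕ → Term // ∀ A ∈ v.carrier, A.subst σ ∈ w.carrier }
  id w := ⟨Term.var, fun A hA => by rwa [Formula.subst_var]⟩
  comp f g := ⟨fun k => (f.1 k).subst g.1, fun A hA => by
    rw [← Formula.subst_subst]
    exact g.2 _ (f.2 _ hA)⟩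
  Dom w := Quotient w.setoid
  tr f := Quotient.map (Term.subst f.1) fun s t h => f.2 _ h
  tr_id := by
    rintro w ⟨t⟩
    exact congrArg (Quotient.mk _) t.subst_var
  tr_comp := by
    rintro u v w f g ⟨t⟩
    exact congrArg (Quotient.mk _) (t.subst_subst _ _).symm
  fn {w n} p a := Quotient.mk w.setoid (Term.app p fun i => (a i).out)
  tr_fn := by
    intro v w f n p a
    refine w.mk_eq.2 (w.app_eq p fun i => w.mk_eq.1 ?_)
    refine Eq.trans ?_ (Quotient.out_eq _).symm
    exact congrArg (Quotient.map (Term.subst f.1) fun s t h => f.2 _ h) (a i).out_eq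
  V {w} a := Formula.V a.out ∈ w.carrier
  M {w} a := Formula.M a.out ∈ w.carrier
  T {w} a := Formula.T a.out ∈ w.carrier
  sim {w} a b := Formula.sim a.out b.out ∈ w.carrier
  R {w} a b c := Formula.R a.out b.out c.out ∈ w.carrier
  tr_V := by
    rintro v w f ⟨s⟩ h
    exact (w.subst_out_iff (.V (.var 0)) fun _ => s.subst f.1).2
      (f.2 _ ((v.subst_out_iff (.V (.var 0)) fun _ => s).1 h))
  tr_M := by
    rintro v w f ⟨s⟩ h
    exact (w.subst_out_iff (.M (.var 0)) fun _ => s.subst f.1).2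
      (f.2 _ ((v.subst_out_iff (.M (.var 0)) fun _ => s).1 h))
  tr_T := by
    rintro v w f ⟨s⟩ h
    exact (w.subst_out_iff (.T (.var 0)) fun _ => s.subst f.1).2
      (f.2 _ ((v.subst_out_iff (.T (.var 0)) fun _ => s).1 h))
  tr_sim := by
    rintro v w f ⟨s⟩ ⟨t⟩ h
    exact (w.subst_out_iff (.sim (.var 0) (.var 1))
        (scons (s.subst f.1) fun _ => t.subst f.1)).2
      (f.2 _ ((v.subst_out_iff (.sim (.var 0) (.var 1)) (scons s fun _ => t)).1 h))
  tr_R := by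
    rintro v w f ⟨s⟩ ⟨t⟩ ⟨u⟩ h
    exact (w.subst_out_iff (.R (.var 0) (.var 1) (.var 2))
        (scons (s.subst f.1) (scons (t.subst f.1) fun _ => u.subst f.1))).2
      (f.2 _ ((v.subst_out_iff (.R (.var 0) (.var 1) (.var 2))
        (scons s (scons t fun _ => u))).1 h))

/-- The assignment given by a sequence of terms. -/
def assign {w : World Ax} (σ : ℕ → Term) : ℕ → (canonicalModel Ax).Dom w :=
  fun k => Quotient.mk w.setoid (σ k)

theorem econs_assign {w : World Ax} (t : Term) (σ : ℕ → Term) :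
    econs (Quotient.mk w.setoid t) (assign σ : ℕ → (canonicalModel Ax).Dom w) =
      assign (scons t σ) := by
  funext k
  cases k <;> rfl

theorem eval_assign {w : World Ax} (σ : ℕ → Term) (t : Term) :
    (canonicalModel Ax).eval (assign σ : ℕ → (canonicalModel Ax).Dom w) t =
      Quotient.mk w.setoid (t.subst σ) := by
  induction t with
  | var k => rfl
  | app p ts ih =>
    exact w.mk_eq.2 (w.app_eq p fun i => w.mk_eq.1 ((Quotient.out_eq _).trans (ih i)))

/-- The renaming that leaves the variables with even numbers unused. -/
def odd (k : ℕ) : Term := Term.var (2 * k + 1)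

/-- A left inverse of `odd`, which sends the unused variables to variable `0`. -/
def half (k : ℕ) : Term := Term.var ((k - 1) / 2)

theorem fresh_subst_odd (A : Formula) (k : ℕ) : Fresh (2 * k) (A.subst odd) := by
  intro σ τ h
  rw [Formula.subst_subst, Formula.subst_subst]
  congr 1
  funext i
  exact h _ (by omega)

theorem exists_fresh_image (S : Set Formula) (N : ℕ) :
    ∃ c, N ≤ c ∧ ∀ B ∈ Formula.subst odd '' S, Fresh c B := by
  refine ⟨2 * N, by omega, ?_⟩
  rintro _ ⟨B, -, rfl⟩
  exact fresh_subst_odd B N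

/-- A derivation from renamed assumptions, followed by the substitution `θ`, which may send the
variables that the renaming leaves unused anywhere. -/
theorem prov_of_prov_image {S : Set Formula} {C : Formula} (θ : ℕ → Term)
    (h : Prov Ax (Formula.subst odd '' S) C) :
    ∃ Γ : List Formula, (∀ B ∈ Γ, B ∈ S) ∧
      Derives Ax (Γ.map (Formula.subst fun k => θ (2 * k + 1))) (C.subst θ) := by
  obtain ⟨Γ, hΓ, hd⟩ := h
  have : ∃ Γ' : List Formula, (∀ B ∈ Γ', B ∈ S) ∧ Γ'.map (Formula.subst odd) = Γ := by
    clear hd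
    induction Γ with
    | nil => exact ⟨[], by simp, rfl⟩
    | cons A Γ ih =>
      obtain ⟨Γ', h₁, h₂⟩ := ih fun B hB => hΓ B (List.mem_cons_of_mem _ hB)
      obtain ⟨A', hA', rfl⟩ := hΓ A (List.mem_cons_self ..)
      exact ⟨A' :: Γ', by simpa [hA'] using h₁, by rw [List.map_cons, h₂]⟩
  obtain ⟨Γ', hΓ', rfl⟩ := this
  refine ⟨Γ', hΓ', ?_⟩
  have := hd.subst θ
  rw [List.map_map] at this
  convert this using 2
  funext B
  rw [Function.comp_apply, Formula.subst_subst]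
  rfl

/-- In the canonical model a formula is forced if and only if it belongs to the world. -/
theorem forces_iff_mem (A : Formula) {w : World Ax} (σ : ℕ → Term) :
    (canonicalModel Ax).forces A (w := w) (assign σ) ↔ A.subst σ ∈ w.carrier := by
  induction A generalizing w σ with
  | eq s t =>
    simp only [KripkeModel.forces, eval_assign]
    exact w.mk_eq
  | V t =>
    simp only [KripkeModel.forces, eval_assign]
    exact w.subst_out_iff (.V (.var 0)) fun _ => t.subst σ
  | M t =>
    simp only [KripkeModel.forces, eval_assign]
    exact w.subst_out_iff (.M (.var 0)) fun _ => t.subst σ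
  | T t =>
    simp only [KripkeModel.forces, eval_assign]
    exact w.subst_out_iff (.T (.var 0)) fun _ => t.subst σ
  | sim s t =>
    simp only [KripkeModel.forces, eval_assign]
    exact w.subst_out_iff (.sim (.var 0) (.var 1)) (scons (s.subst σ) fun _ => t.subst σ)
  | R e s t =>
    simp only [KripkeModel.forces, eval_assign]
    exact w.subst_out_iff (.R (.var 0) (.var 1) (.var 2))
      (scons (e.subst σ) (scons (s.subst σ) fun _ => t.subst σ))
  | bot => exact ⟨False.elim, fun h => w.consistent h⟩
  | and A B ihA ihB =>
    simp only [KripkeModel.forces, ihA, ihB]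
    constructor
    · rintro ⟨h₁, h₂⟩
      exact w.closed (Γ := [A.subst σ, B.subst σ]) (by simpa using ⟨h₁, h₂⟩)
        (Derives.andI (Derives.hyp (by simp)) (Derives.hyp (by simp)))
    · intro h
      exact ⟨w.closed_one h (Derives.andL (Derives.hyp (List.mem_cons_self ..))),
        w.closed_one h (Derives.andR (Derives.hyp (List.mem_cons_self ..)))⟩
  | or A B ihA ihB =>
    simp only [KripkeModel.forces, ihA, ihB]
    constructor
    · rintro (h | h)
      · exact w.closed (Γ := [A.subst σ]) (by simpa using h) (Derives.orL (Derives.hyp (by simp)))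
      · exact w.closed (Γ := [B.subst σ]) (by simpa using h) (Derives.orR (Derives.hyp (by simp)))
    · exact w.prime
  | imp A B ihA ihB =>
    simp only [KripkeModel.forces]
    constructor
    · intro h
      by_contra hn
      obtain ⟨w', hw', hB⟩ := exists_world (Ax := Ax)
        (S := Formula.subst odd '' (insert (A.subst σ) w.carrier)) (C := (B.subst σ).subst odd)
        (exists_fresh_image _) (by
          intro hp
          obtain ⟨Γ, hΓ, hd⟩ := prov_of_prov_image half hp
          have h₁ : (fun k => half (2 * k + 1)) = Term.var := by
            funext k
            simp [half]
          have h₂ : ((B.subst σ).subst odd).subst half = B.subst σ := by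
            rw [Formula.subst_subst]
            exact (congrArg (fun θ => (B.subst σ).subst θ) h₁).trans (Formula.subst_var _)
          rw [h₁, h₂, show Formula.subst Term.var = _root_.id from
            funext Formula.subst_var, List.map_id] at hd
          obtain ⟨Γ', hΓ', hd'⟩ := prov_insert ⟨Γ, hΓ, hd⟩
          exact hn (w.closed hΓ' (Derives.impI hd')))
      let f : (canonicalModel Ax).Hom w w' :=
        ⟨odd, fun D hD => hw' ⟨D, Or.inr hD, rfl⟩⟩
      have := (ihB (w := w') fun k => (σ k).subst odd).1 (h w' f ((ihA (w := w') _).2 (by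
        rw [← Formula.subst_subst]
        exact hw' ⟨_, Or.inl rfl, rfl⟩)))
      rw [← Formula.subst_subst] at this
      exact hB this
    · intro h w' f hA
      have hA := (ihA (w := w') fun k => (σ k).subst f.1).1 hA
      refine (ihB (w := w') fun k => (σ k).subst f.1).2 ?_
      rw [← Formula.subst_subst] at hA ⊢
      refine World.closed w' (Γ := [((A.imp B).subst σ).subst f.1, _]) ?_
        (Derives.impE (Derives.hyp (List.mem_cons_self ..))
          (Derives.hyp (List.mem_cons_of_mem _ (List.mem_cons_self ..))))
      intro D hD
      rcases List.mem_cons.1 hD with rfl | hD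
      · exact f.2 _ h
      · rw [List.mem_singleton.1 hD]
        exact hA
  | all A ih =>
    have key : ∀ (w : World Ax) (t : Term) (σ : ℕ → Term), (canonicalModel Ax).forces A (w := w)
        (econs (Quotient.mk w.setoid t) (assign σ)) ↔ A.subst (scons t σ) ∈ w.carrier := by
      intro w t σ
      exact (iff_of_eq (congrArg (fun ρ => (canonicalModel Ax).forces A (w := w) ρ)
        (econs_assign t σ))).trans (ih _)
    simp only [KripkeModel.forces]
    constructor
    · intro h
      by_contra hn
      obtain ⟨w', hw', hA⟩ := exists_world (Ax := Ax)
        (S := Formula.subst odd '' w.carrier)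
        (C := A.subst (scons (Term.var 0) fun k => (σ k).subst odd))
        (exists_fresh_image _) (by
          intro hp
          obtain ⟨Γ, hΓ, hd⟩ := prov_of_prov_image (fun k => Term.var ((k + 1) / 2)) hp
          have h₁ : (fun k => Term.var ((2 * k + 1 + 1) / 2)) = fun k => Term.var (k + 1) := by
            funext k
            congr 1
            omega
          have h₂ : (A.subst (scons (Term.var 0) fun k => (σ k).subst odd)).subst
              (fun k => Term.var ((k + 1) / 2)) = A.subst (up σ) := by
            rw [Formula.subst_subst]
            congr 1
            funext k
            cases k with
            | zero => rfl
            | succ k =>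
              simp only [scons, up, Term.subst_subst, Term.lift]
              congr 1
          rw [h₁, h₂] at hd
          exact hn (w.closed hΓ (Derives.allI hd)))
      let f : (canonicalModel Ax).Hom w w' := ⟨odd, fun D hD => hw' ⟨D, hD, rfl⟩⟩
      exact hA ((key w' (Term.var 0) _).1 (h w' f (Quotient.mk _ (Term.var 0))))
    · rintro h w' f ⟨t⟩
      refine (key w' t fun k => (σ k).subst f.1).2 ?_
      have := World.closed_one w' (f.2 _ h)
        (Derives.allE t (Derives.hyp (List.mem_cons_self ..)))
      rw [← up, ← up, Formula.subst_subst, up_subst_up, Formula.subst_up_inst] at this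
      exact this
  | ex A ih =>
    have key : ∀ t : Term, (canonicalModel Ax).forces A (w := w)
        (econs (Quotient.mk w.setoid t) (assign σ)) ↔ A.subst (scons t σ) ∈ w.carrier := by
      intro t
      exact (iff_of_eq (congrArg (fun ρ => (canonicalModel Ax).forces A (w := w) ρ)
        (econs_assign t σ))).trans (ih _)
    simp only [KripkeModel.forces]
    constructor
    · rintro ⟨⟨t⟩, h⟩
      refine w.closed_one ((key t).1 h) (Derives.exI t ?_)
      rw [← up, Formula.subst_up_inst]
      exact Derives.hyp (List.mem_cons_self ..)
    · intro h
      obtain ⟨t, ht⟩ := w.henkin h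
      rw [← up, Formula.subst_up_inst, ← key] at ht
      exact ⟨_, ht⟩

end Completeness

/-- Completeness of intuitionistic natural deduction for Kripke models. -/
theorem derives_of_forces {Ax : Set Formula} {Γ : List Formula} {A : Formula}
    (h : ∀ K : KripkeModel, (∀ B ∈ Ax, ∀ (w : K.World) (ρ : ℕ → K.Dom w), K.forces B ρ) →
      ∀ (w : K.World) (ρ : ℕ → K.Dom w), (∀ B ∈ Γ, K.forces B ρ) → K.forces A ρ) :
    Derives Ax Γ A := by
  open Completeness in
  by_contra hn
  obtain ⟨w, hw, hA⟩ := exists_world (Ax := Ax) (S := Formula.subst odd '' {B | B ∈ Γ})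
    (C := A.subst odd) (exists_fresh_image _) (by
      intro hp
      obtain ⟨Γ', hΓ', hd⟩ := prov_of_prov_image half hp
      have h₁ : (fun k => half (2 * k + 1)) = Term.var := by
        funext k
        simp [half]
      have h₂ : (A.subst odd).subst half = A := by
        rw [Formula.subst_subst]
        exact (congrArg (fun θ => A.subst θ) h₁).trans (Formula.subst_var _)
      rw [h₁, h₂, show Formula.subst Term.var = _root_.id from
        funext Formula.subst_var, List.map_id] at hd
      exact hn (hd.weaken hΓ'))
  rw [← forces_iff_mem] at hA
  refine hA (h (canonicalModel Ax) (fun B hB w' ρ => ?_) w _ fun B hB => ?_)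
  · have : ρ = assign fun k => (ρ k).out := by
      funext k
      exact (Quotient.out_eq _).symm
    rw [this]
    exact (forces_iff_mem B (w := w') _).2
      (World.closed w' (Γ := []) (by simp) (Derives.subst_nil (Derives.ax hB) _))
  · rw [forces_iff_mem]
    exact hw ⟨B, hB, rfl⟩

/-! ### Terms and assignments -/

/-- The pair of two terms. -/
def Term.pair (s t : Term) : Term := Term.app PRFun.pairF ![s, t]

/-- The sum of two terms. -/
def Term.add (s t : Term) : Term := Term.app PRFun.addF ![s, t]

@[simp] theorem econs_zero {α : Type*} (a : α) (ρ : ℕ → α) : econs a ρ 0 = a := rfl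

@[simp] theorem econs_succ {α : Type*} (a : α) (ρ : ℕ → α) (k : ℕ) : econs a ρ (k + 1) = ρ k := rfl

theorem vec_zero {α β : Type*} (g : α → β) : (fun i => g ((![] : Fin 0 → α) i)) = ![] :=
  funext fun i => i.elim0

theorem vec_one {α β : Type*} (g : α → β) (a : α) : (fun i => g (![a] i)) = ![g a] := by
  funext i
  fin_cases i
  rfl

theorem vec_two {α β : Type*} (g : α → β) (a b : α) :
    (fun i => g (![a, b] i)) = ![g a, g b] := by
  funext i
  fin_cases i <;> rfl

theorem vec_three {α β : Type*} (g : α → β) (a b c : α) :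
    (fun i => g (![a, b, c] i)) = ![g a, g b, g c] := by
  funext i
  fin_cases i <;> rfl

namespace KripkeModel

variable (K : KripkeModel) {w : K.World}

/-! ### The standard functions on the domains -/

/-- The number zero of a domain. -/
def zero : K.Dom w := K.fn PRFun.zero ![]

/-- The successor function of a domain. -/
def succ (a : K.Dom w) : K.Dom w := K.fn PRFun.succ ![a]

/-- The addition of a domain. -/
def add (a b : K.Dom w) : K.Dom w := K.fn PRFun.addF ![a, b]

/-- The Cantor pairing of a domain. -/
def pair (a b : K.Dom w) : K.Dom w := K.fn PRFun.pairF ![a, b]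

/-- The first projection `(a)_L` of the Cantor pairing. -/
def left (a : K.Dom w) : K.Dom w := K.fn PRFun.leftF ![a]

/-- The second projection `(a)_R` of the Cantor pairing. -/
def right (a : K.Dom w) : K.Dom w := K.fn PRFun.rightF ![a]

/-- The result of a computation: Kleene's function `U`. -/
def out (a : K.Dom w) : K.Dom w := K.fn PRFun.outF ![a]

variable {K}

theorem tr_fn₀ {w' : K.World} (f : K.Hom w w') (p : PRFun 0) :
    K.tr f (K.fn p ![]) = K.fn p ![] := by
  rw [K.tr_fn, vec_zero]

theorem tr_fn₁ {w' : K.World} (f : K.Hom w w') (p : PRFun 1) (a : K.Dom w) :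
    K.tr f (K.fn p ![a]) = K.fn p ![K.tr f a] := by rw [K.tr_fn, vec_one]

theorem tr_fn₃ {w' : K.World} (f : K.Hom w w') (p : PRFun 3) (a b c : K.Dom w) :
    K.tr f (K.fn p ![a, b, c]) = K.fn p ![K.tr f a, K.tr f b, K.tr f c] := by
  rw [K.tr_fn, vec_three]

section tr

variable {w' : K.World} (f : K.Hom w w') (a : K.Dom w)

@[simp] theorem tr_zero : K.tr f (K.zero : K.Dom w) = K.zero := tr_fn₀ f _
@[simp] theorem tr_succ : K.tr f (K.succ a) = K.succ (K.tr f a) := tr_fn₁ f _ a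
@[simp] theorem tr_left : K.tr f (K.left a) = K.left (K.tr f a) := tr_fn₁ f _ a
@[simp] theorem tr_right : K.tr f (K.right a) = K.right (K.tr f a) := tr_fn₁ f _ a
@[simp] theorem tr_out : K.tr f (K.out a) = K.out (K.tr f a) := tr_fn₁ f _ a

end tr

attribute [simp] KripkeModel.tr_id KripkeModel.tr_comp

@[simp] theorem tr_econs {w' : K.World} (f : K.Hom w w') (a : K.Dom w) (ρ : ℕ → K.Dom w) :
    (fun k => K.tr f (econs a ρ k)) = econs (K.tr f a) fun k => K.tr f (ρ k) := by
  funext k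
  cases k <;> rfl

section eval

variable (ρ : ℕ → K.Dom w)

@[simp] theorem eval_var (k : ℕ) : K.eval ρ (Term.var k) = ρ k := rfl

theorem eval_app₀ (p : PRFun 0) : K.eval ρ (Term.app p ![]) = K.fn p ![] := by
  rw [eval, vec_zero]

theorem eval_app₁ (p : PRFun 1) (s : Term) : K.eval ρ (Term.app p ![s]) = K.fn p ![K.eval ρ s] := by
  rw [eval, vec_one]

theorem eval_app₂ (p : PRFun 2) (s t : Term) :
    K.eval ρ (Term.app p ![s, t]) = K.fn p ![K.eval ρ s, K.eval ρ t] := by rw [eval, vec_two]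

theorem eval_app₃ (p : PRFun 3) (s t u : Term) :
    K.eval ρ (Term.app p ![s, t, u]) = K.fn p ![K.eval ρ s, K.eval ρ t, K.eval ρ u] := by
  rw [eval, vec_three]

@[simp] theorem eval_zero : K.eval ρ Term.zero = K.zero := eval_app₀ ρ _
@[simp] theorem eval_succ (s : Term) : K.eval ρ s.succ = K.succ (K.eval ρ s) := eval_app₁ ρ _ s
@[simp] theorem eval_add (s t : Term) : K.eval ρ (s.add t) = K.add (K.eval ρ s) (K.eval ρ t) :=
  eval_app₂ ρ _ s t
@[simp] theorem eval_pair (s t : Term) : K.eval ρ (s.pair t) = K.pair (K.eval ρ s) (K.eval ρ t) :=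
  eval_app₂ ρ _ s t
@[simp] theorem eval_left (s : Term) : K.eval ρ s.left = K.left (K.eval ρ s) := eval_app₁ ρ _ s
@[simp] theorem eval_right (s : Term) : K.eval ρ s.right = K.right (K.eval ρ s) := eval_app₁ ρ _ s
@[simp] theorem eval_out (s : Term) : K.eval ρ s.out = K.out (K.eval ρ s) := eval_app₁ ρ _ s

theorem eval_subst (σ : ℕ → Term) (t : Term) :
    K.eval ρ (t.subst σ) = K.eval (fun k => K.eval ρ (σ k)) t := by
  induction t with
  | var k => rfl
  | app p ts ih => simp only [Term.subst, eval, ih]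

@[simp] theorem eval_lift (d : ℕ) (t : Term) :
    K.eval ρ (t.lift d) = K.eval (fun k => ρ (k + d)) t :=
  eval_subst ρ _ t

theorem tr_eval {w' : K.World} (f : K.Hom w w') (t : Term) :
    K.tr f (K.eval ρ t) = K.eval (fun k => K.tr f (ρ k)) t := by
  induction t with
  | var k => rfl
  | app p ts ih => simp only [eval, K.tr_fn, ih]

@[simp] theorem eval_scons (t : Term) (σ : ℕ → Term) :
    (fun k => K.eval ρ (scons t σ k)) = econs (K.eval ρ t) fun k => K.eval ρ (σ k) := by
  funext k
  cases k <;> rfl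

end eval

/-! ### Forcing of the connectives -/

theorem forces_subst (A : Formula) (σ : ℕ → Term) (ρ : ℕ → K.Dom w) :
    K.forces (A.subst σ) ρ ↔ K.forces A fun k => K.eval ρ (σ k) := by
  induction A generalizing w σ with
  | imp A B ihA ihB => simp only [Formula.subst, forces, ihA, ihB, tr_eval]
  | all A ih => simp [Formula.subst, forces, ih, tr_eval]
  | ex A ih => simp [Formula.subst, forces, ih]
  | _ => simp_all only [Formula.subst, forces, eval_subst]

/-- Forcing persists along morphisms of worlds. -/
theorem forces_mono {A : Formula} {ρ : ℕ → K.Dom w} (h : K.forces A ρ) {w' : K.World}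
    (f : K.Hom w w') : K.forces A fun k => K.tr f (ρ k) := by
  induction A generalizing w w' with
  | eq s t => simpa only [forces, tr_eval] using congrArg (K.tr f) h
  | V t => simpa only [forces, tr_eval] using K.tr_V f h
  | M t => simpa only [forces, tr_eval] using K.tr_M f h
  | T t => simpa only [forces, tr_eval] using K.tr_T f h
  | sim s t => simpa only [forces, tr_eval] using K.tr_sim f h
  | R e s t => simpa only [forces, tr_eval] using K.tr_R f h
  | bot => exact h
  | and A B ihA ihB => exact ⟨ihA h.1 f, ihB h.2 f⟩
  | or A B ihA ihB => exact h.imp (fun h => ihA h f) fun h => ihB h f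
  | imp A B ihA ihB =>
    intro w'' g hA
    simp only [← K.tr_comp] at hA ⊢
    exact h _ _ hA
  | all A ih =>
    intro w'' g d
    simp only [← K.tr_comp]
    exact h _ _ d
  | ex A ih =>
    obtain ⟨d, hd⟩ := h
    refine ⟨K.tr f d, ?_⟩
    rw [← tr_econs]
    exact ih hd f

section connectives

variable (A B : Formula) (ρ : ℕ → K.Dom w) (s t u : Term)

@[simp] theorem forces_eq : K.forces (.eq s t) ρ ↔ K.eval ρ s = K.eval ρ t := Iff.rfl
@[simp] theorem forces_V : K.forces (.V t) ρ ↔ K.V (K.eval ρ t) := Iff.rfl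
@[simp] theorem forces_M : K.forces (.M t) ρ ↔ K.M (K.eval ρ t) := Iff.rfl
@[simp] theorem forces_T : K.forces (.T t) ρ ↔ K.T (K.eval ρ t) := Iff.rfl
@[simp] theorem forces_sim : K.forces (.sim s t) ρ ↔ K.sim (K.eval ρ s) (K.eval ρ t) := Iff.rfl
@[simp] theorem forces_R :
    K.forces (.R s t u) ρ ↔ K.R (K.eval ρ s) (K.eval ρ t) (K.eval ρ u) := Iff.rfl
@[simp] theorem forces_and : K.forces (.and A B) ρ ↔ K.forces A ρ ∧ K.forces B ρ := Iff.rfl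
@[simp] theorem forces_or : K.forces (.or A B) ρ ↔ K.forces A ρ ∨ K.forces B ρ := Iff.rfl
@[simp] theorem forces_ex : K.forces (.ex A) ρ ↔ ∃ d : K.Dom w, K.forces A (econs d ρ) := Iff.rfl

theorem forces_imp : K.forces (.imp A B) ρ ↔ ∀ (w' : K.World) (f : K.Hom w w'),
    K.forces A (fun k => K.tr f (ρ k)) → K.forces B fun k => K.tr f (ρ k) := Iff.rfl

theorem forces_all : K.forces (.all A) ρ ↔ ∀ (w' : K.World) (f : K.Hom w w') (d : K.Dom w'),
    K.forces A (econs d fun k => K.tr f (ρ k)) := Iff.rfl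

variable {A B ρ} in
theorem forces_mp (h : K.forces (.imp A B) ρ) (hA : K.forces A ρ) : K.forces B ρ := by
  simpa using h w (K.id w) (by simpa using hA)

variable {A ρ} in
theorem forces_inst (h : K.forces (.all A) ρ) (d : K.Dom w) : K.forces A (econs d ρ) := by
  simpa using h w (K.id w) d

/-- For a quantified implication a single change of world suffices. -/
theorem forces_all_imp : K.forces (.all (.imp A B)) ρ ↔
    ∀ (w' : K.World) (f : K.Hom w w') (d : K.Dom w'),
      K.forces A (econs d fun k => K.tr f (ρ k)) → K.forces B (econs d fun k => K.tr f (ρ k)) := by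
  refine ⟨fun h w' f d hA => forces_mp (h w' f d) hA, fun h w' f d w'' g hA => ?_⟩
  rw [tr_econs] at hA ⊢
  simp only [← K.tr_comp] at hA ⊢
  exact h _ _ _ hA

/-- As `forces_all_imp`, for two quantifiers. -/
theorem forces_all_all_imp : K.forces (.all (.all (.imp A B))) ρ ↔
    ∀ (w' : K.World) (f : K.Hom w w') (d e : K.Dom w'),
      K.forces A (econs e (econs d fun k => K.tr f (ρ k))) →
        K.forces B (econs e (econs d fun k => K.tr f (ρ k))) := by
  rw [forces_all]
  simp only [forces_all_imp]
  refine ⟨fun h w' f d e hA => ?_, fun h w' f d w'' g e hA => ?_⟩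
  · simpa using h w' f d w' (K.id _) e (by simpa using hA)
  · rw [tr_econs] at hA ⊢
    simp only [← K.tr_comp] at hA ⊢
    exact h _ _ _ _ hA

variable {A B ρ} in
theorem forces_iff (h : K.forces (.iff A B) ρ) :
    K.forces A ρ ↔ K.forces B ρ :=
  ⟨forces_mp h.1, forces_mp h.2⟩

end connectives

/-! ### Recursive functions and v-sets in a model -/

variable (K) in
/-- `o` is the least computation of the `e`-th function on input `i`. -/
def Comp (e i o : K.Dom w) : Prop :=
  K.fn PRFun.compF ![e, i, o] = K.succ K.zero ∧ K.fn PRFun.earlierF ![o, e, i] = K.zero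

variable (K) in
/-- The `e`-th function has the value `v` at `i`. -/
def Ap (e i v : K.Dom w) : Prop := ∃ o, K.Comp e i o ∧ K.out o = v

variable (K) in
/-- `n` is an index of a conditional element of `x` whose condition is true. -/
def Ind (x n : K.Dom w) : Prop := ∃ p, K.Ap x n p ∧ K.T (K.right p)

variable (K) in
/-- `z` is one of the elements of `x`. -/
def EL (x z : K.Dom w) : Prop := ∃ n p, K.Ap x n p ∧ K.T (K.right p) ∧ K.left p = z

section mono

variable {w' : K.World} (f : K.Hom w w')

theorem Comp.mono {e i o : K.Dom w} (h : K.Comp e i o) :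
    K.Comp (K.tr f e) (K.tr f i) (K.tr f o) := by
  have h₁ := congrArg (K.tr f) h.1
  have h₂ := congrArg (K.tr f) h.2
  simp only [tr_fn₃, tr_succ, tr_zero] at h₁ h₂
  exact ⟨h₁, h₂⟩

theorem Ap.mono {e i v : K.Dom w} (h : K.Ap e i v) : K.Ap (K.tr f e) (K.tr f i) (K.tr f v) := by
  obtain ⟨o, ho, rfl⟩ := h
  exact ⟨_, ho.mono f, (tr_out f o).symm⟩

theorem EL.mono {x z : K.Dom w} (h : K.EL x z) : K.EL (K.tr f x) (K.tr f z) := by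
  obtain ⟨n, p, hp, hT, rfl⟩ := h
  exact ⟨_, _, hp.mono f, by simpa using K.tr_T f hT, by simp⟩

end mono

section abbreviations

variable (ρ : ℕ → K.Dom w) (e i o v : Term)

@[simp] theorem forces_kleeneT :
    K.forces (kleeneT e i o) ρ ↔ K.Comp (K.eval ρ e) (K.eval ρ i) (K.eval ρ o) := by
  simp [kleeneT, Comp, Term.one, eval_app₃]

@[simp] theorem forces_Ap :
    K.forces (VSets.Ap e i v) ρ ↔ K.Ap (K.eval ρ e) (K.eval ρ i) (K.eval ρ v) := by
  simp [VSets.Ap, Ap]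

@[simp] theorem forces_Dfd :
    K.forces (Dfd e i) ρ ↔ ∃ v, K.Ap (K.eval ρ e) (K.eval ρ i) v := by
  simp [Dfd, Ap]

@[simp] theorem forces_CondM : K.forces (CondM e i) ρ ↔
    ∃ p, K.Ap (K.eval ρ e) (K.eval ρ i) p ∧ K.M (K.right p) := by
  simp [CondM]

@[simp] theorem forces_Ind : K.forces (VSets.Ind e i) ρ ↔ K.Ind (K.eval ρ e) (K.eval ρ i) := by
  simp [VSets.Ind, Ind]

@[simp] theorem forces_Elt : K.forces (Elt e i v) ρ ↔
    ∃ p, K.Ap (K.eval ρ e) (K.eval ρ i) p ∧ K.left p = K.eval ρ v := by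
  simp [Elt]

end abbreviations

end KripkeModel

/-! ### Arithmetic in a model -/

namespace Term

/-- The product of two terms. -/
def mul (s t : Term) : Term := app PRFun.mulF ![s, t]

/-- The predecessor of a term. -/
def pred (s : Term) : Term := app PRFun.predF ![s]

/-- The cut-off difference `s - t`; the function symbol takes the subtrahend first, because it is
defined by recursion on it. -/
def sub (s t : Term) : Term := app PRFun.subF ![t, s]

/-- The triangular number of a term. -/
def tri (s : Term) : Term := app PRFun.triF ![s]

/-- The number of the diagonal on which the pair coded by a term lies. -/
def diag (s : Term) : Term := app PRFun.diagF ![s]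

end Term

namespace KripkeModel

variable (K : KripkeModel) {w : K.World}

/-- The multiplication of a domain. -/
def mul (a b : K.Dom w) : K.Dom w := K.fn PRFun.mulF ![a, b]

/-- The predecessor function of a domain, with the value zero at zero. -/
def pred (a : K.Dom w) : K.Dom w := K.fn PRFun.predF ![a]

/-- The cut-off difference `a - b`. -/
def sub (a b : K.Dom w) : K.Dom w := K.fn PRFun.subF ![b, a]

/-- The triangular number `0 + 1 + ⋯ + a`. -/
def tri (a : K.Dom w) : K.Dom w := K.fn PRFun.triF ![a]

/-- The largest `d` with `tri d ≤ a`, so that `diag (pair a b) = a + b`. -/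
def diag (a : K.Dom w) : K.Dom w := K.fn PRFun.diagF ![a]

variable {K}

@[simp] theorem eval_mul (ρ : ℕ → K.Dom w) (s t : Term) :
    K.eval ρ (s.mul t) = K.mul (K.eval ρ s) (K.eval ρ t) := eval_app₂ ρ _ s t
@[simp] theorem eval_pred (ρ : ℕ → K.Dom w) (s : Term) : K.eval ρ s.pred = K.pred (K.eval ρ s) :=
  eval_app₁ ρ _ s
@[simp] theorem eval_sub (ρ : ℕ → K.Dom w) (s t : Term) :
    K.eval ρ (s.sub t) = K.sub (K.eval ρ s) (K.eval ρ t) := eval_app₂ ρ _ t s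
@[simp] theorem eval_tri (ρ : ℕ → K.Dom w) (s : Term) : K.eval ρ s.tri = K.tri (K.eval ρ s) :=
  eval_app₁ ρ _ s
@[simp] theorem eval_diag (ρ : ℕ → K.Dom w) (s : Term) : K.eval ρ s.diag = K.diag (K.eval ρ s) :=
  eval_app₁ ρ _ s
/-- An assignment that starts with the given values, and is zero at the other variables. -/
def vecAssign {n : ℕ} (a : Fin n → K.Dom w) (k : ℕ) : K.Dom w :=
  if h : k < n then a ⟨k, h⟩ else K.zero

@[simp] theorem vecAssign_fin {n : ℕ} (a : Fin n → K.Dom w) (i : Fin n) : vecAssign a i = a i := by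
  simp [vecAssign]

theorem eval_vecCons {n : ℕ} (ρ : ℕ → K.Dom w) (t : Term) (ts : Fin n → Term) :
    (fun i => K.eval ρ ((Matrix.vecCons t ts : Fin (n + 1) → Term) i)) =
      Matrix.vecCons (K.eval ρ t) fun i => K.eval ρ (ts i) := by
  funext i
  refine Fin.cases ?_ (fun i => ?_) i <;> rfl

/-- A Kripke model of the theory, for some choice of the codes for the conditions. -/
class IsModel (K : KripkeModel) : Prop where
  exists_models : ∃ (top bot : PRFun 0) (Pi : PRFun 2),
    ∀ B ∈ Theory top bot Pi, ∀ (w : K.World) (ρ : ℕ → K.Dom w), K.forces B ρ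

variable [K.IsModel]

theorem forces_arith {A : Formula} (h : HA A) (ρ : ℕ → K.Dom w) : K.forces A ρ := by
  obtain ⟨top, bot, Pi, hK⟩ := IsModel.exists_models (K := K)
  exact hK A (.arith h) w ρ

/-- Induction for the property of `d` defined by `A` and the parameters `ρ`. -/
theorem induction (A : Formula) (ρ : ℕ → K.Dom w) (zero : K.forces A (econs K.zero ρ))
    (succ : ∀ (w' : K.World) (f : K.Hom w w') (d : K.Dom w'),
      K.forces A (econs d fun k => K.tr f (ρ k)) →
        K.forces A (econs (K.succ d) fun k => K.tr f (ρ k)))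
    (d : K.Dom w) : K.forces A (econs d ρ) := by
  have h := forces_mp (forces_arith (HA.induction A) ρ) (by
    rw [Formula.inst, forces_subst, eval_scons]
    simpa using zero)
  refine forces_inst (forces_mp h ((forces_all_imp _ _ _).2 fun w' f d hd => ?_)) d
  rw [forces_subst, eval_scons]
  simpa using succ w' f d hd

theorem succ_ne_zero (a : K.Dom w) : K.succ a ≠ K.zero := by
  intro h
  exact forces_mp (forces_arith (HA.succNeZero (.var 0)) (econs a fun _ => a)) (by simpa using h)

theorem succ_inj {a b : K.Dom w} (h : K.succ a = K.succ b) : a = b := by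
  simpa using forces_mp (forces_arith (HA.succInj (.var 0) (.var 1)) (econs a fun _ => b))
    (by simpa using h)

@[simp] theorem fn_proj {n : ℕ} (i : Fin n) (a : Fin n → K.Dom w) :
    K.fn (PRFun.proj i) a = a i := by
  have := forces_arith (HA.proj i fun i => .var i) (vecAssign a)
  simpa [eval, vecAssign_fin] using this

theorem fn_comp {m n : ℕ} (f : PRFun m) (g : Fin m → PRFun n) (a : Fin n → K.Dom w) :
    K.fn (PRFun.comp f g) a = K.fn f fun i => K.fn (g i) a := by
  have := forces_arith (HA.comp f g fun i => .var i) (vecAssign a)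
  simpa [eval, vecAssign_fin] using this

theorem fn_prec_zero {n : ℕ} (f : PRFun n) (g : PRFun (n + 2)) (a : Fin n → K.Dom w) :
    K.fn (PRFun.prec f g) (Matrix.vecCons K.zero a) = K.fn f a := by
  have := forces_arith (HA.precZero f g fun i => .var i) (vecAssign a)
  simpa only [forces_eq, eval, eval_vecCons, eval_zero, vecAssign_fin] using this

theorem fn_prec_succ {n : ℕ} (f : PRFun n) (g : PRFun (n + 2)) (d : K.Dom w)
    (a : Fin n → K.Dom w) :
    K.fn (PRFun.prec f g) (Matrix.vecCons (K.succ d) a) =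
      K.fn g
        (Matrix.vecCons d (Matrix.vecCons (K.fn (PRFun.prec f g) (Matrix.vecCons d a)) a)) := by
  have := forces_arith (HA.precSucc f g (.var 0) fun i => .var (i + 1)) (econs d (vecAssign a))
  simpa only [forces_eq, eval, eval_vecCons, eval_succ, econs_zero, econs_succ, vecAssign_fin]
    using this

theorem fn_comp₀ {n : ℕ} (f : PRFun 0) (a : Fin n → K.Dom w) :
    K.fn (PRFun.comp f ![]) a = K.fn f ![] := by
  rw [fn_comp, vec_zero fun p => K.fn p a]

theorem fn_comp₁ {n : ℕ} (f : PRFun 1) (g : PRFun n) (a : Fin n → K.Dom w) :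
    K.fn (PRFun.comp f ![g]) a = K.fn f ![K.fn g a] := by
  rw [fn_comp, vec_one fun p => K.fn p a]

theorem fn_comp₂ {n : ℕ} (f : PRFun 2) (g h : PRFun n) (a : Fin n → K.Dom w) :
    K.fn (PRFun.comp f ![g, h]) a = K.fn f ![K.fn g a, K.fn h a] := by
  rw [fn_comp, vec_two fun p => K.fn p a]

theorem fn_comp₃ {n : ℕ} (f : PRFun 3) (g h k : PRFun n) (a : Fin n → K.Dom w) :
    K.fn (PRFun.comp f ![g, h, k]) a = K.fn f ![K.fn g a, K.fn h a, K.fn k a] := by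
  rw [fn_comp, vec_three fun p => K.fn p a]

section ops

variable (K) in
/-- The characteristic function of equality. -/
def chi (a b : K.Dom w) : K.Dom w := K.sub (K.succ K.zero) (K.add (K.sub a b) (K.sub b a))

variable {n : ℕ} (p q : PRFun n) (v : Fin n → K.Dom w) (a b : K.Dom w)

theorem fn_const_zero : K.fn (PRFun.const 0) v = K.zero := fn_comp₀ _ v
theorem fn_S : K.fn p.S v = K.succ (K.fn p v) := fn_comp₁ _ _ v
theorem fn_const_one : K.fn (PRFun.const 1) v = K.succ K.zero :=
  (fn_S _ v).trans (congrArg K.succ (fn_const_zero v))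
theorem fn_add : K.fn (p.add q) v = K.add (K.fn p v) (K.fn q v) := fn_comp₂ _ _ _ v
theorem fn_mul : K.fn (p.mul q) v = K.mul (K.fn p v) (K.fn q v) := fn_comp₂ _ _ _ v
theorem fn_pred : K.fn p.pred v = K.pred (K.fn p v) := fn_comp₁ _ _ v
theorem fn_sub : K.fn (p.sub q) v = K.sub (K.fn p v) (K.fn q v) := fn_comp₂ _ _ _ v
theorem fn_tri : K.fn p.tri v = K.tri (K.fn p v) := fn_comp₁ _ _ v
theorem fn_diag : K.fn p.diag v = K.diag (K.fn p v) := fn_comp₁ _ _ v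
theorem fn_not : K.fn p.not v = K.sub (K.succ K.zero) (K.fn p v) := by
  rw [PRFun.not, fn_sub, fn_const_one]
theorem fn_eq : K.fn (p.eq q) v = K.chi (K.fn p v) (K.fn q v) := by
  rw [PRFun.eq, fn_not, fn_add, fn_sub, fn_sub, chi]

@[simp] theorem zero_add : K.add K.zero a = a := (fn_prec_zero _ _ ![a]).trans (fn_proj _ _)
@[simp] theorem succ_add : K.add (K.succ a) b = K.succ (K.add a b) :=
  (fn_prec_succ _ _ a ![b]).trans ((fn_S _ _).trans (congrArg K.succ (fn_proj _ _)))
@[simp] theorem zero_mul : K.mul K.zero a = K.zero :=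
  (fn_prec_zero _ _ ![a]).trans (fn_const_zero _)
theorem succ_mul : K.mul (K.succ a) b = K.add (K.mul a b) b :=
  (fn_prec_succ _ _ a ![b]).trans ((fn_add _ _ _).trans
    (congrArg₂ K.add (fn_proj _ _) (fn_proj _ _)))
@[simp] theorem pred_zero : K.pred (K.zero : K.Dom w) = K.zero := fn_prec_zero _ _ ![]
@[simp] theorem pred_succ : K.pred (K.succ a) = a := (fn_prec_succ _ _ a ![]).trans (fn_proj _ _)
@[simp] theorem sub_zero : K.sub a K.zero = a := (fn_prec_zero _ _ ![a]).trans (fn_proj _ _)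
theorem sub_succ : K.sub a (K.succ b) = K.pred (K.sub a b) :=
  (fn_prec_succ _ _ b ![a]).trans ((fn_pred _ _).trans (congrArg K.pred (fn_proj _ _)))
@[simp] theorem tri_zero : K.tri (K.zero : K.Dom w) = K.zero := fn_prec_zero _ _ ![]
theorem tri_succ : K.tri (K.succ a) = K.add (K.tri a) (K.succ a) :=
  (fn_prec_succ _ _ a ![]).trans ((fn_add _ _ _).trans
    (congrArg₂ K.add (fn_proj _ _) ((fn_S _ _).trans (congrArg K.succ (fn_proj _ _)))))
@[simp] theorem diag_zero : K.diag (K.zero : K.Dom w) = K.zero := fn_prec_zero _ _ ![]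
theorem diag_succ :
    K.diag (K.succ a) = K.add (K.diag a) (K.chi (K.succ a) (K.tri (K.succ (K.diag a)))) := by
  refine (fn_prec_succ _ _ a ![]).trans ?_
  rw [fn_add, fn_eq, fn_tri, fn_S, fn_S, fn_proj, fn_proj]
  rfl
theorem pair_def : K.pair a b = K.add (K.tri (K.add a b)) b := by
  rw [pair, PRFun.pairF, PRFun.pair, fn_add, fn_tri, fn_add, fn_proj, fn_proj]
  rfl
theorem right_def : K.right a = K.sub a (K.tri (K.diag a)) := by
  rw [right, PRFun.rightF, PRFun.right, fn_sub, fn_tri, fn_diag, fn_proj]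
  rfl
theorem left_def : K.left a = K.sub (K.diag a) (K.right a) := by
  rw [right_def, left, PRFun.leftF, PRFun.left, PRFun.right, fn_sub, fn_sub, fn_tri, fn_diag,
    fn_proj]
  rfl

end ops

section arithmetic

variable (a b c : K.Dom w)

@[simp] theorem add_zero : K.add a K.zero = a := by
  have := induction (.eq (Term.add (.var 0) .zero) (.var 0)) (fun _ => a) (by simp)
    (by intro w' f d; simp +contextual) a
  simpa using this

@[simp] theorem add_succ : K.add a (K.succ b) = K.succ (K.add a b) := by
  have := induction
    (.eq (Term.add (.var 0) (Term.succ (.var 1))) (Term.succ (Term.add (.var 0) (.var 1))))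
    (fun _ => b) (by simp) (by intro w' f d; simp +contextual) a
  simpa using this

theorem add_comm : K.add a b = K.add b a := by
  have := induction (.eq (Term.add (.var 0) (.var 1)) (Term.add (.var 1) (.var 0)))
    (fun _ => b) (by simp) (by intro w' f d; simp +contextual) a
  simpa using this

theorem add_assoc : K.add (K.add a b) c = K.add a (K.add b c) := by
  have := induction (.eq (Term.add (Term.add (.var 0) (.var 1)) (.var 2))
    (Term.add (.var 0) (Term.add (.var 1) (.var 2))))
    (econs b fun _ => c) (by simp) (by intro w' f d; simp +contextual) a
  simpa using this

@[simp] theorem mul_zero : K.mul a K.zero = K.zero := by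
  have := induction (.eq (Term.mul (.var 0) .zero) .zero) (fun _ => a) (by simp)
    (by intro w' f d; simp +contextual [succ_mul]) a
  simpa using this

@[simp] theorem succ_sub_succ : K.sub (K.succ a) (K.succ b) = K.sub a b := by
  have := induction (.eq (Term.sub (Term.succ (.var 1)) (Term.succ (.var 0)))
    (Term.sub (.var 1) (.var 0))) (fun _ => a) (by simp [sub_succ])
    (by
      intro w' f d h
      simp only [forces_eq, eval_sub, eval_var, econs_zero, eval_succ, econs_succ] at h ⊢
      rw [sub_succ, h, ← sub_succ]) b
  simpa using this

@[simp] theorem zero_sub : K.sub K.zero a = K.zero := by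
  have := induction (.eq (Term.sub .zero (.var 0)) .zero) (fun _ => a) (by simp)
    (by intro w' f d; simp +contextual [sub_succ]) a
  simpa using this

@[simp] theorem add_sub_cancel : K.sub (K.add b a) b = a := by
  have := induction (.eq (Term.sub (Term.add (.var 0) (.var 1)) (.var 0)) (.var 1))
    (fun _ => a) (by simp) (by intro w' f d; simp +contextual) b
  simpa using this

@[simp] theorem sub_self : K.sub a a = K.zero := by
  simpa using add_sub_cancel K.zero a

@[simp] theorem sub_add_self : K.sub a (K.add a b) = K.zero := by
  have := induction (.eq (Term.sub (.var 0) (Term.add (.var 0) (.var 1))) .zero)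
    (fun _ => b) (by simp) (by intro w' f d; simp +contextual) a
  simpa using this

theorem ne_add_succ : a ≠ K.add a (K.succ b) := by
  intro h
  have := congrArg (fun x => K.sub x a) h
  simp only [sub_self, add_sub_cancel] at this
  exact succ_ne_zero _ this.symm

theorem eq_zero_or_succ : a = K.zero ∨ ∃ b, a = K.succ b := by
  have := induction (.or (.eq (.var 0) .zero) (.ex (.eq (.var 1) (Term.succ (.var 0)))))
    (fun _ => a) (by simp) (by intro w' f d _; simp) a
  simpa using this

theorem lt_trichotomy :
    a = b ∨ (∃ d, b = K.add a (K.succ d)) ∨ ∃ d, a = K.add b (K.succ d) := by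
  have := induction (.or (.eq (.var 0) (.var 1))
    (.or (.ex (.eq (.var 2) (Term.add (.var 1) (Term.succ (.var 0)))))
      (.ex (.eq (.var 1) (Term.add (.var 2) (Term.succ (.var 0)))))))
    (fun _ => b) ?_ ?_ a
  · simpa using this
  · rcases eq_zero_or_succ b with rfl | ⟨b, rfl⟩
    · simp
    · exact Or.inr (Or.inl ⟨b, by simp⟩)
  · intro w' f d h
    simp only [forces_or, forces_eq, forces_ex, eval_var, eval_add, eval_succ, econs_zero,
      econs_succ] at h ⊢
    rcases h with h | ⟨x, h⟩ | ⟨x, h⟩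
    · exact Or.inr (Or.inr ⟨K.zero, by simp [h]⟩)
    · rcases eq_zero_or_succ x with rfl | ⟨x, rfl⟩
      · exact Or.inl (by simp [h])
      · exact Or.inr (Or.inl ⟨x, by simp [h]⟩)
    · exact Or.inr (Or.inr ⟨K.succ x, by simp [h]⟩)

/-! ### The pairing function -/

theorem chi_self : K.chi a a = K.succ K.zero := by simp [chi]

theorem chi_add_succ : K.chi a (K.add a (K.succ b)) = K.zero := by
  rw [chi, sub_add_self, add_sub_cancel, zero_add, succ_sub_succ, zero_sub]

/-- The function `diag` is constant between two triangular numbers. -/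
theorem diag_tri_add_or (ha : K.diag (K.tri a) = a) :
    K.diag (K.add (K.tri a) b) = a ∨ ∃ d, b = K.add a (K.succ d) := by
  have := induction (.or
    (.eq (Term.diag (Term.add (Term.tri (.var 1)) (.var 0))) (.var 1))
    (.ex (.eq (.var 1) (Term.add (.var 2) (Term.succ (.var 0)))))) (fun _ => a) ?_ ?_ b
  · simpa using this
  · exact Or.inl (by simpa using ha)
  · intro w' f d h
    simp only [forces_or, forces_eq, forces_ex, eval_tri, eval_diag, eval_var, eval_add, eval_succ,
      econs_zero, econs_succ] at h ⊢
    generalize K.tr f a = a at h ⊢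
    rcases h with h | ⟨x, h⟩
    · rcases lt_trichotomy d a with rfl | ⟨x, hx⟩ | ⟨x, rfl⟩
      · exact Or.inr ⟨K.zero, by simp⟩
      · refine Or.inl ?_
        have : K.tri (K.succ a) = K.add (K.succ (K.add (K.tri a) d)) (K.succ x) := by
          rw [tri_succ]
          conv_lhs => rw [hx]
          conv_rhs => rw [hx]
          simp [add_assoc]
        rw [add_succ, diag_succ, h, this, chi_add_succ, add_zero]
      · exact Or.inr ⟨K.succ x, by simp⟩
    · exact Or.inr ⟨K.succ x, by simp [h]⟩

theorem diag_tri : K.diag (K.tri a) = a := by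
  have := induction (.eq (Term.diag (Term.tri (.var 0))) (.var 0)) (fun _ => a) (by simp) ?_ a
  · simpa using this
  · intro w' f d h
    simp only [forces_eq, eval_tri, eval_diag, eval_var, econs_zero] at h ⊢
    have h' := (diag_tri_add_or d d h).resolve_right fun ⟨x, hx⟩ => ne_add_succ _ _ hx
    rw [tri_succ, add_succ, diag_succ, h', tri_succ, add_succ, chi_self, add_succ, add_zero]

theorem diag_pair : K.diag (K.pair a b) = K.add a b := by
  rw [pair_def]
  refine (diag_tri_add_or _ b (diag_tri _)).resolve_right fun ⟨x, hx⟩ => ?_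
  rw [add_comm a b, add_assoc, add_succ] at hx
  exact ne_add_succ _ _ hx

@[simp] theorem right_pair : K.right (K.pair a b) = b := by
  rw [right_def, diag_pair, pair_def, add_sub_cancel]

@[simp] theorem left_pair : K.left (K.pair a b) = a := by
  rw [left_def, right_pair, diag_pair, add_comm, add_sub_cancel]

/-! ### Uniqueness of computations -/

theorem fn_bexF_succ {n : ℕ} (P : PRFun (n + 1)) (k : K.Dom w) (v : Fin n → K.Dom w) :
    K.fn (PRFun.bexF P) (Matrix.vecCons (K.succ k) v) =
      K.sub (K.succ K.zero)
        (K.mul (K.sub (K.succ K.zero) (K.fn (PRFun.bexF P) (Matrix.vecCons k v)))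
          (K.sub (K.succ K.zero) (K.fn P (Matrix.vecCons k v)))) := by
  refine (fn_prec_succ _ _ k v).trans ?_
  rw [PRFun.or, PRFun.and, fn_not, fn_mul, fn_not, fn_not, fn_proj, fn_comp]
  congr 4
  funext j
  refine Fin.cases ?_ (fun j => ?_) j <;> exact fn_proj _ _

theorem earlier_succ (o e i : K.Dom w) : K.fn PRFun.earlierF ![K.succ o, e, i] =
    K.sub (K.succ K.zero) (K.mul (K.sub (K.succ K.zero) (K.fn PRFun.earlierF ![o, e, i]))
      (K.sub (K.succ K.zero) (K.fn PRFun.compF ![e, i, o]))) := by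
  refine (fn_bexF_succ _ o ![e, i]).trans ?_
  rw [fn_comp₃, fn_proj, fn_proj, fn_proj]
  rfl

theorem earlier_of_comp {e i o : K.Dom w} (h : K.fn PRFun.compF ![e, i, o] = K.succ K.zero)
    (d : K.Dom w) : K.fn PRFun.earlierF ![K.succ (K.add d o), e, i] = K.succ K.zero := by
  have := induction (.eq (.app PRFun.earlierF
    ![Term.succ (Term.add (.var 0) (.var 3)), .var 1, .var 2]) (Term.succ .zero))
    (econs e (econs i fun _ => o)) ?_ ?_ d
  · simpa [eval_app₃] using this
  · simp [eval_app₃, earlier_succ, h]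
  · intro w' f d hd
    simp only [forces_eq, eval_app₃, eval_succ, eval_add, eval_var, econs_zero, eval_zero,
      succ_add] at hd ⊢
    rw [earlier_succ]
    simp only [tr_econs, econs_succ] at hd ⊢
    rw [hd]
    simp

end arithmetic

/-- Computations are unique because they are minimal. -/
theorem Comp.unique {e i o o' : K.Dom w} (h : K.Comp e i o) (h' : K.Comp e i o') : o = o' := by
  have key : ∀ {o o' d : K.Dom w}, K.Comp e i o → K.Comp e i o' →
      o' ≠ K.add o (K.succ d) := by
    rintro o _ d h h' rfl
    have := earlier_of_comp h.1 d
    rw [add_comm, ← add_succ] at this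
    exact succ_ne_zero _ (this.symm.trans h'.2)
  rcases lt_trichotomy o o' with h₁ | ⟨d, h₁⟩ | ⟨d, h₁⟩
  exacts [h₁, absurd h₁ (key h h'), absurd h₁ (key h' h)]

theorem Ap.unique {e i v v' : K.Dom w} (h : K.Ap e i v) (h' : K.Ap e i v') : v = v' := by
  obtain ⟨o, ho, rfl⟩ := h
  obtain ⟨o', ho', rfl⟩ := h'
  rw [ho.unique ho']

end KripkeModel

namespace KripkeModel

variable {K : KripkeModel} {w : K.World}

/-! ### Functions that witness extensional equality -/

variable (K) in
/-- `d` maps the indices of elements of `x` to indices of elements of `y` together with witnesses of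
their equality. -/
def RHalf (d x y : K.Dom w) : Prop :=
  ∀ (w' : K.World) (f : K.Hom w w') (n : K.Dom w'), K.Ind (K.tr f x) n →
    ∃ v, K.Ap (K.tr f d) n v ∧ K.Ind (K.tr f y) (K.left v) ∧
      ∃ p q, K.Ap (K.tr f x) n p ∧ K.Ap (K.tr f y) (K.left v) q ∧
        K.R (K.right v) (K.left p) (K.left q)

theorem forces_rHalf (ρ : ℕ → K.Dom w) (d x y : Term) :
    K.forces (rHalf d x y) ρ ↔ K.RHalf (K.eval ρ d) (K.eval ρ x) (K.eval ρ y) := by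
  simp only [rHalf, forces_all_imp, forces_Ind, forces_and, forces_Dfd, forces_ex, forces_Ap,
    forces_Elt, forces_R, eval_lift, eval_var, eval_left, eval_right, econs_zero, econs_succ, RHalf,
    tr_eval]
  refine forall_congr' fun w' => forall_congr' fun f => forall_congr' fun n =>
    imp_congr Iff.rfl ?_
  constructor
  · rintro ⟨-, v, hv, hy, a, b, ⟨p, hp, rfl⟩, ⟨q, hq, rfl⟩, hR⟩
    exact ⟨v, hv, hy, p, q, hp, hq, hR⟩
  · rintro ⟨v, hv, hy, p, q, hp, hq, hR⟩
    exact ⟨⟨v, hv⟩, v, hv, hy, _, _, ⟨p, hp, rfl⟩, ⟨q, hq, rfl⟩, hR⟩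

theorem RHalf.mono {d x y : K.Dom w} (h : K.RHalf d x y) {w' : K.World} (f : K.Hom w w') :
    K.RHalf (K.tr f d) (K.tr f x) (K.tr f y) := by
  intro w'' g n hn
  simp only [← K.tr_comp] at hn ⊢
  exact h w'' _ n hn

variable [K.IsModel]

/-! ### Extended Church's Thesis in a model -/

/-- Extended Church's Thesis `ECT`: a choice function on an almost-negative domain may be taken
recursive. -/
theorem exists_index_of_almostNegative {A : Formula} (hA : AlmostNegative A) (B : Formula)
    (ρ : ℕ → K.Dom w)
    (h : ∀ (w' : K.World) (f : K.Hom w w') (n : K.Dom w'),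
      K.forces A (econs n fun k => K.tr f (ρ k)) →
        ∃ m, K.forces B (econs m (econs n fun k => K.tr f (ρ k)))) :
    ∃ e : K.Dom w, ∀ (w' : K.World) (f : K.Hom w w') (n : K.Dom w'),
      K.forces A (econs n fun k => K.tr f (ρ k)) →
        ∃ v, K.Ap (K.tr f e) n v ∧ K.forces B (econs v (econs n fun k => K.tr f (ρ k))) := by
  obtain ⟨top, bot, Pi, hK⟩ := IsModel.exists_models (K := K)
  obtain ⟨e, he⟩ := forces_mp (hK _ (.ect hA B) w ρ) ((forces_all_imp _ _ _).2 h)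
  refine ⟨e, fun w' f n hn => ?_⟩
  have := (forces_all_imp _ _ _).1 he w' f n (by
    rw [forces_subst, eval_scons]
    simpa using hn)
  obtain ⟨v, hv, hB⟩ := this.2
  rw [forces_subst, eval_scons, eval_scons] at hB
  exact ⟨v, by simpa using hv, by simpa using hB⟩

/-- Church's Thesis: a total relation contains the graph of a recursive function. -/
theorem exists_index (B : Formula) (ρ : ℕ → K.Dom w)
    (h : ∀ (w' : K.World) (f : K.Hom w w') (n : K.Dom w'),
      ∃ m, K.forces B (econs m (econs n fun k => K.tr f (ρ k)))) :
    ∃ e : K.Dom w, ∀ (w' : K.World) (f : K.Hom w w') (n : K.Dom w'),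
      ∃ v, K.Ap (K.tr f e) n v ∧ K.forces B (econs v (econs n fun k => K.tr f (ρ k))) := by
  obtain ⟨e, he⟩ := exists_index_of_almostNegative (A := .eq (.var 0) (.var 0))
    (.sigma1 (.qf (.eq _ _))) B ρ fun w' f n _ => h w' f n
  exact ⟨e, fun w' f n => he w' f n rfl⟩

/-! ### The v-sets in a model -/

@[simp] theorem forces_EL (ρ : ℕ → K.Dom w) (x z : Term) :
    K.forces (VSets.EL x z) ρ ↔ K.EL (K.eval ρ x) (K.eval ρ z) := by
  simp only [VSets.EL, forces_ex, forces_and, forces_Ind, forces_Elt, eval_lift, econs_succ,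
    eval_var, econs_zero]
  constructor
  · rintro ⟨n, ⟨p, hp, hT⟩, q, hq, hz⟩
    exact ⟨n, p, hp, hT, (congrArg K.left (hp.unique hq)).trans hz⟩
  · rintro ⟨n, p, hp, hT, hz⟩
    exact ⟨n, ⟨p, hp, hT⟩, p, hp, hz⟩

/-- In the formula `closure A` the conditions on the elements of `x` are read off from the value
`p` of `x` at each index. -/
theorem forces_closure (A : Formula) (x : K.Dom w) (ρ : ℕ → K.Dom w) :
    K.forces (closure A) (econs x ρ) ↔
      ∀ (w' : K.World) (f : K.Hom w w') (n : K.Dom w'), ∃ p, K.Ap (K.tr f x) n p ∧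
        K.M (K.right p) ∧ ∀ (w'' : K.World) (g : K.Hom w' w''), K.T (K.tr g (K.right p)) →
          K.forces A (econs (K.tr g (K.left p)) fun k => K.tr g (K.tr f (ρ k))) := by
  rw [closure, forces_all]
  refine forall_congr' fun w' => forall_congr' fun f => forall_congr' fun n => ?_
  simp only [forces_and, forces_Dfd, forces_CondM, forces_imp, forces_Ind, forces_ex, forces_Elt,
    forces_subst, eval_scons, eval_var, tr_econs, econs_zero, econs_succ]
  constructor
  · rintro ⟨-, ⟨p, hp, hM⟩, h⟩
    refine ⟨p, hp, hM, fun w'' g hT => ?_⟩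
    obtain ⟨z, ⟨q, hq, rfl⟩, hA⟩ := h w'' g ⟨_, hp.mono g, by simpa using hT⟩
    rwa [hq.unique (hp.mono g), ← tr_left] at hA
  · rintro ⟨p, hp, hM, h⟩
    refine ⟨⟨p, hp⟩, ⟨p, hp, hM⟩, ?_⟩
    rintro w'' g ⟨q, hq, hT⟩
    rw [hq.unique (hp.mono g), ← tr_right] at hT
    exact ⟨_, ⟨_, hp.mono g, (tr_left g p).symm⟩, h w'' g hT⟩

theorem V_intro {x : K.Dom w}
    (h : ∀ (w' : K.World) (f : K.Hom w w') (n : K.Dom w'), ∃ p, K.Ap (K.tr f x) n p ∧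
      K.M (K.right p) ∧ ∀ (w'' : K.World) (g : K.Hom w' w''), K.T (K.tr g (K.right p)) →
        K.V (K.tr g (K.left p))) : K.V x := by
  obtain ⟨top, bot, Pi, hK⟩ := IsModel.exists_models (K := K)
  refine forces_mp (forces_inst (hK _ .vIntro w fun _ => x) x) ((forces_closure _ _ _).2 h)

theorem V_induction_closure (A : Formula) (ρ : ℕ → K.Dom w)
    (h : ∀ (w' : K.World) (f : K.Hom w w') (x : K.Dom w'),
      K.forces (closure A) (econs x fun k => K.tr f (ρ k)) →
        K.forces A (econs x fun k => K.tr f (ρ k)))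
    {x : K.Dom w} (hx : K.V x) : K.forces A (econs x ρ) := by
  obtain ⟨top, bot, Pi, hK⟩ := IsModel.exists_models (K := K)
  exact forces_mp (forces_inst (forces_mp (hK _ (.vInd A) w ρ) ((forces_all_imp _ _ _).2 h)) x) hx

/-- A v-set is total as a recursive function, its conditions are meaningful, and its elements are
v-sets. This inverts the introduction rule. -/
theorem V.exists_ap {x : K.Dom w} (hx : K.V x) (n : K.Dom w) :
    ∃ p, K.Ap x n p ∧ K.M (K.right p) ∧ (K.T (K.right p) → K.V (K.left p)) := by
  have := V_induction_closure (closure (.V (.var 0))) (fun _ => x) (fun w' f y hy => ?_) hx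
  · rw [forces_closure] at this
    obtain ⟨p, hp, hM, hT⟩ := this w (K.id w) n
    exact ⟨p, by simpa using hp, hM, fun h => by simpa using hT w (K.id w) (by simpa using h)⟩
  · rw [forces_closure] at hy ⊢
    refine fun w'' g n => ?_
    obtain ⟨p, hp, hM, h⟩ := hy w'' g n
    refine ⟨p, hp, hM, fun w₃ k hT => V_intro fun w₄ l m => ?_⟩
    have := h w₃ k hT
    rw [forces_closure] at this
    simpa using this w₄ l m

theorem EL.V {x a : K.Dom w} (hx : K.V x) (h : K.EL x a) : K.V a := by
  obtain ⟨n, p, hp, hT, rfl⟩ := h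
  obtain ⟨q, hq, -, hV⟩ := KripkeModel.V.exists_ap hx n
  rw [hq.unique hp] at hV
  exact hV hT

/-- `∈`-induction on v-sets. -/
theorem V_induction (A : Formula) (ρ : ℕ → K.Dom w)
    (h : ∀ (w' : K.World) (f : K.Hom w w') (x : K.Dom w'), K.V x →
      (∀ (w'' : K.World) (g : K.Hom w' w'') (a : K.Dom w''), K.EL (K.tr g x) a →
        K.forces A (econs a fun k => K.tr g (K.tr f (ρ k)))) →
      K.forces A (econs x fun k => K.tr f (ρ k)))
    {x : K.Dom w} (hx : K.V x) : K.forces A (econs x ρ) := by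
  refine (V_induction_closure (.and (.V (.var 0)) A) ρ (fun w' f y hy => ?_) hx).2
  rw [forces_closure] at hy
  have hV : K.V y := V_intro fun w'' g n => by
    obtain ⟨p, hp, hM, hT⟩ := hy w'' g n
    exact ⟨p, hp, hM, fun w₃ k h => (hT w₃ k h).1⟩
  refine ⟨hV, h w' f y hV ?_⟩
  rintro w'' g a ⟨n, p, hp, hT, rfl⟩
  obtain ⟨q, hq, -, hA⟩ := hy w'' g n
  rw [hp.unique hq] at hT ⊢
  simpa using (hA w'' (K.id _) (by simpa using hT)).2

/-! ### Extensional equality -/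

theorem forces_simHalf (ρ : ℕ → K.Dom w) (x y : Term) : K.forces (simHalf x y) ρ ↔
    ∀ (w' : K.World) (f : K.Hom w w') (a : K.Dom w'), K.EL (K.tr f (K.eval ρ x)) a →
      ∃ b, K.EL (K.tr f (K.eval ρ y)) b ∧ K.sim a b := by
  simp [simHalf, forces_all_imp, tr_eval]

theorem sim_iff {x y : K.Dom w} (hx : K.V x) (hy : K.V y) : K.sim x y ↔
    (∀ (w' : K.World) (f : K.Hom w w') (a : K.Dom w'), K.EL (K.tr f x) a →
      ∃ b, K.EL (K.tr f y) b ∧ K.sim a b) ∧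
    ∀ (w' : K.World) (f : K.Hom w w') (b : K.Dom w'), K.EL (K.tr f y) b →
      ∃ a, K.EL (K.tr f x) a ∧ K.sim b a := by
  obtain ⟨top, bot, Pi, hK⟩ := IsModel.exists_models (K := K)
  have h := forces_iff
    ((forces_all_all_imp _ _ _).1 (hK _ .sim w fun _ => x) w (K.id w) x y ⟨hx, hy⟩)
  rw [forces_and, forces_simHalf, forces_simHalf] at h
  exact h

theorem sim_refl {x : K.Dom w} (hx : K.V x) : K.sim x x :=
  V_induction (.sim (.var 0) (.var 0)) (fun _ => x) (fun _ _ _ hy ih =>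
    (sim_iff hy hy).2 ⟨fun w'' g a ha => ⟨a, ha, ih w'' g a ha⟩,
      fun w'' g a ha => ⟨a, ha, ih w'' g a ha⟩⟩) hx

theorem sim_symm {x y : K.Dom w} (hx : K.V x) (hy : K.V y) (h : K.sim x y) : K.sim y x := by
  rw [sim_iff hx hy] at h
  exact (sim_iff hy hx).2 h.symm

theorem sim_trans {x y z : K.Dom w} (hx : K.V x) (hy : K.V y) (hz : K.V z) (hxy : K.sim x y)
    (hyz : K.sim y z) : K.sim x z := by
  have := V_induction (.all (.all (.imp
    (.and (.and (.V (.var 1)) (.V (.var 0)))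
      (.and (.sim (.var 2) (.var 1)) (.sim (.var 1) (.var 0))))
    (.sim (.var 2) (.var 0))))) (fun _ => x) (fun w' f x hx ih => ?_) hx
  · simpa using (forces_all_all_imp _ _ _).1 this w (K.id w) y z
      ⟨⟨hy, hz⟩, by simpa using hxy, hyz⟩
  · clear hy hz hxy hyz y z
    rw [forces_all_all_imp]
    rintro w'' g y z ⟨⟨hy, hz⟩, hxy, hyz⟩
    simp only [forces_V, forces_sim, eval_var, econs_zero, econs_succ] at hy hz hxy hyz ⊢
    have hx := K.tr_V g hx
    rw [sim_iff hx hy] at hxy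
    rw [sim_iff hy hz] at hyz
    have ih' : ∀ (w₃ : K.World) (k : K.Hom w'' w₃) (a b c : K.Dom w₃),
        K.EL (K.tr k (K.tr g x)) a → K.V b → K.V c → K.sim a b → K.sim b c → K.sim a c := by
      intro w₃ k a b c ha hb hc hab hbc
      simpa using (forces_all_all_imp _ _ _).1 (ih w₃ (K.comp g k) a (by simpa using ha)) w₃
        (K.id w₃) b c ⟨⟨hb, hc⟩, by simpa using hab, hbc⟩
    refine (sim_iff hx hz).2 ⟨fun w₃ k a ha => ?_, fun w₃ k c hc => ?_⟩
    · obtain ⟨b, hb, hab⟩ := hxy.1 w₃ k a ha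
      obtain ⟨c, hc, hbc⟩ := hyz.1 w₃ k b hb
      exact ⟨c, hc, ih' w₃ k a b c ha (hb.V (K.tr_V k hy)) (hc.V (K.tr_V k hz)) hab hbc⟩
    · obtain ⟨b, hb, hcb⟩ := hyz.2 w₃ k c hc
      obtain ⟨a, ha, hba⟩ := hxy.2 w₃ k b hb
      have hVa := ha.V (K.tr_V k hx)
      have hVb := hb.V (K.tr_V k hy)
      have hVc := hc.V (K.tr_V k hz)
      exact ⟨a, ha, sim_symm hVa hVc (ih' w₃ k a b c ha hVb hVc (sim_symm hVb hVa hba)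
        (sim_symm hVc hVb hcb))⟩

variable (K) in
/-- Membership: `a` is extensionally equal to one of the elements of `x`. -/
def Mem (a x : K.Dom w) : Prop := ∃ b, K.EL x b ∧ K.sim a b

theorem EL.mem {x a : K.Dom w} (hx : K.V x) (h : K.EL x a) : K.Mem a x := ⟨a, h, sim_refl (h.V hx)⟩

theorem Mem.congr_right {a x y : K.Dom w} (ha : K.V a) (hx : K.V x) (hy : K.V y) (h : K.Mem a x)
    (hxy : K.sim x y) : K.Mem a y := by
  obtain ⟨b, hb, hab⟩ := h
  obtain ⟨c, hc, hbc⟩ := ((sim_iff hx hy).1 hxy).1 w (K.id w) b (by simpa using hb)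
  rw [K.tr_id] at hc
  exact ⟨c, hc, sim_trans ha (hb.V hx) (hc.V hy) hab hbc⟩

theorem Mem.congr_left {a b x : K.Dom w} (ha : K.V a) (hb : K.V b) (hx : K.V x) (h : K.Mem a x)
    (hab : K.sim a b) : K.Mem b x := by
  obtain ⟨c, hc, hac⟩ := h
  exact ⟨c, hc, sim_trans hb ha (hc.V hx) (sim_symm ha hb hab) hac⟩

/-- No v-set is a member of itself, by `∈`-induction. -/
theorem not_mem_self {x : K.Dom w} (hx : K.V x) : ¬ K.Mem x x := by
  have := V_induction (.imp (.ex (.and (VSets.EL (.var 1) (.var 0)) (.sim (.var 1) (.var 0)))) .bot)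
    (fun _ => x) (fun w' f x hx ih => ?_) hx
  · rintro ⟨b, hb, hxb⟩
    exact forces_mp this ⟨b, by simpa using hb, by simpa using hxb⟩
  · rintro w'' g ⟨b, hb, hxb⟩
    simp only [forces_EL, forces_sim, tr_econs, eval_var, econs_zero, econs_succ] at hb hxb
    have hx := K.tr_V g hx
    obtain ⟨c, hc, hbc⟩ : K.Mem b b := (hb.mem hx).congr_right (hb.V hx) hx (hb.V hx) hxb
    change False
    exact forces_mp (ih w'' g b hb) ⟨c, by simpa using hc, by simpa using hbc⟩

/-! ### Truth of extensional equality and existence of witnesses -/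

theorem R_iff {e x y : K.Dom w} (hx : K.V x) (hy : K.V y) :
    K.R e x y ↔ K.RHalf (K.left e) x y ∧ K.RHalf (K.right e) y x := by
  obtain ⟨top, bot, Pi, hK⟩ := IsModel.exists_models (K := K)
  have h := forces_iff
    ((forces_all_all_imp _ _ _).1 (forces_inst (hK _ .R w fun _ => x) e) w (K.id w) x y ⟨hx, hy⟩)
  rw [forces_and, forces_rHalf, forces_rHalf] at h
  simpa using h

theorem R_symm {e x y : K.Dom w} (hx : K.V x) (hy : K.V y) (h : K.R e x y) :
    K.R (K.pair (K.right e) (K.left e)) y x := by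
  rw [R_iff hx hy] at h
  rw [R_iff hy hx, left_pair, right_pair]
  exact h.symm

/-- "`e n` is defined and `A` holds of its value (the variable `0` of `A`)", with the existence of
the value separated from its property, so that the formula is almost negative if `A` is. -/
def appAN (e n : Term) (A : Formula) : Formula :=
  .and (Dfd e n) (.all (.imp (VSets.Ap (e.lift 1) (n.lift 1) (.var 0)) A))

/-- `n` is an index of an element of `x`, as an almost-negative formula. -/
def indAN (x n : Term) : Formula := appAN x n (.T (.right (.var 0)))

theorem almostNegative_appAN (e n : Term) {A : Formula} (hA : AlmostNegative A) :
    AlmostNegative (appAN e n A) :=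
  .and (.sigma1 (.ex (.qf (.and (.eq _ _) (.eq _ _)))))
    (.all (.imp (.sigma1 (.ex (.qf (.and (.and (.eq _ _) (.eq _ _)) (.eq _ _))))) hA))

theorem almostNegative_indAN (x n : Term) : AlmostNegative (indAN x n) :=
  almostNegative_appAN _ _ (.T _)

@[simp] theorem forces_appAN (ρ : ℕ → K.Dom w) (e n : Term) (A : Formula) :
    K.forces (appAN e n A) ρ ↔ ∃ p, K.Ap (K.eval ρ e) (K.eval ρ n) p ∧ K.forces A (econs p ρ) := by
  simp only [appAN, forces_and, forces_Dfd, forces_all_imp, forces_Ap, eval_lift, eval_var,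
    econs_zero, econs_succ]
  constructor
  · rintro ⟨⟨p, hp⟩, h⟩
    exact ⟨p, hp, by simpa using h w (K.id w) p (by simpa using hp)⟩
  · rintro ⟨p, hp, hA⟩
    refine ⟨⟨p, hp⟩, fun w' f q hq => ?_⟩
    rw [← tr_eval, ← tr_eval] at hq
    rw [hq.unique (hp.mono f), ← tr_econs]
    exact forces_mono hA f

@[simp] theorem forces_indAN (ρ : ℕ → K.Dom w) (x n : Term) :
    K.forces (indAN x n) ρ ↔ K.Ind (K.eval ρ x) (K.eval ρ n) := by
  simp [indAN, Ind]

/-- Extended Church's Thesis turns the choice of equal elements into a function on indices. -/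
theorem exists_rHalf {x y : K.Dom w}
    (h : ∀ (w' : K.World) (f : K.Hom w w') (a : K.Dom w'), K.EL (K.tr f x) a →
      ∃ b, K.EL (K.tr f y) b ∧ ∃ e, K.R e a b) : ∃ d, K.RHalf d x y := by
  have := exists_index_of_almostNegative (A := indAN (.var 1) (.var 0))
    (almostNegative_indAN _ _)
    (.and (VSets.Ind (.var 3) (.left (.var 0))) (.ex (.ex
      (.and (VSets.Ap (.var 4) (.var 3) (.var 1))
        (.and (VSets.Ap (.var 5) (.left (.var 2)) (.var 0))
          (.R (.right (.var 2)) (.left (.var 1)) (.left (.var 0))))))))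
    (econs x fun _ => y) (fun w' f n hn => ?_)
  · obtain ⟨d, hd⟩ := this
    refine ⟨d, fun w' f n hn => ?_⟩
    obtain ⟨v, hv, hB⟩ := hd w' f n (by simpa using hn)
    refine ⟨v, hv, ?_⟩
    simpa using hB
  · obtain ⟨p, hp, hT⟩ : K.Ind (K.tr f x) n := by simpa using hn
    obtain ⟨b, ⟨m, q, hq, hT', rfl⟩, e, he⟩ := h w' f (K.left p) ⟨n, p, hp, hT, rfl⟩
    refine ⟨K.pair m e, ?_⟩
    simp only [forces_and, forces_ex, forces_Ind, forces_Ap, forces_R, eval_var, eval_left,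
      eval_right, tr_econs, econs_zero, econs_succ, left_pair, right_pair]
    exact ⟨⟨q, hq, hT'⟩, p, q, hp, hq, he⟩

theorem RHalf.exists_R {d x y a : K.Dom w} (h : K.RHalf d x y) (ha : K.EL x a) :
    ∃ b, K.EL y b ∧ ∃ e, K.R e a b := by
  obtain ⟨n, p, hp, hT, rfl⟩ := ha
  obtain ⟨v, hv, ⟨q', hq', hT'⟩, p', q, hp', hq, hR⟩ := h w (K.id w) n ⟨p, by simpa using hp, hT⟩
  rw [K.tr_id] at hp' hq hq'
  rw [hq'.unique hq] at hT'
  rw [hp'.unique hp] at hR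
  exact ⟨_, ⟨_, q, hq, hT', rfl⟩, _, hR⟩

/-- Extensionally equal v-sets have a witness of their equality, by `∈`-induction. -/
theorem exists_R_of_sim {x y : K.Dom w} (hx : K.V x) (hy : K.V y) (h : K.sim x y) :
    ∃ e, K.R e x y := by
  have := V_induction (.all (.imp (.and (.V (.var 0)) (.sim (.var 1) (.var 0)))
    (.ex (.R (.var 0) (.var 2) (.var 1))))) (fun _ => x) (fun w' f x hx ih => ?_) hx
  · simpa using (forces_all_imp _ _ _).1 this w (K.id w) y ⟨hy, by simpa using h⟩
  · clear hy h y
    rw [forces_all_imp]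
    rintro w'' g y ⟨hy, h⟩
    simp only [forces_V, forces_sim, eval_var, econs_zero, econs_succ] at hy h
    have hx := K.tr_V g hx
    have ih' : ∀ (w₃ : K.World) (k : K.Hom w'' w₃) (a b : K.Dom w₃),
        K.EL (K.tr k (K.tr g x)) a → K.V b → K.sim a b → ∃ e, K.R e a b := by
      intro w₃ k a b ha hb hab
      simpa using (forces_all_imp _ _ _).1 (ih w₃ (K.comp g k) a (by simpa using ha)) w₃ (K.id w₃) b
        ⟨hb, by simpa using hab⟩
    rw [sim_iff hx hy] at h
    obtain ⟨d, hd⟩ : ∃ d, K.RHalf d (K.tr g x) y := exists_rHalf fun w₃ k a ha => by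
      obtain ⟨b, hb, hab⟩ := h.1 w₃ k a ha
      exact ⟨b, hb, ih' w₃ k a b ha (hb.V (K.tr_V k hy)) hab⟩
    obtain ⟨d', hd'⟩ : ∃ d, K.RHalf d y (K.tr g x) := exists_rHalf fun w₃ k b hb => by
      obtain ⟨a, ha, hba⟩ := h.2 w₃ k b hb
      have hVa := ha.V (K.tr_V k hx)
      have hVb := hb.V (K.tr_V k hy)
      obtain ⟨e, he⟩ := ih' w₃ k a b ha hVb (sim_symm hVb hVa hba)
      exact ⟨a, ha, _, R_symm hVa hVb he⟩
    refine ⟨K.pair d d', ?_⟩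
    simp only [forces_R, eval_var, econs_zero, econs_succ]
    rw [R_iff hx hy, left_pair, right_pair]
    exact ⟨hd, hd'⟩

/-- Witnessed equality is extensional equality, by `∈`-induction. -/
theorem sim_of_R {e x y : K.Dom w} (hx : K.V x) (hy : K.V y) (h : K.R e x y) : K.sim x y := by
  have := V_induction (.all (.all (.imp (.and (.V (.var 1)) (.R (.var 0) (.var 2) (.var 1)))
    (.sim (.var 2) (.var 1))))) (fun _ => x) (fun w' f x hx ih => ?_) hx
  · simpa using (forces_all_all_imp _ _ _).1 this w (K.id w) y e ⟨hy, by simpa using h⟩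
  · clear hy h y e
    rw [forces_all_all_imp]
    rintro w'' g y e ⟨hy, h⟩
    simp only [forces_V, forces_R, forces_sim, eval_var, econs_zero, econs_succ] at hy h ⊢
    have hx := K.tr_V g hx
    have ih' : ∀ (w₃ : K.World) (k : K.Hom w'' w₃) (a b e : K.Dom w₃),
        K.EL (K.tr k (K.tr g x)) a → K.V b → K.R e a b → K.sim a b := by
      intro w₃ k a b e ha hb hab
      simpa using (forces_all_all_imp _ _ _).1 (ih w₃ (K.comp g k) a (by simpa using ha)) w₃
        (K.id w₃) b e ⟨hb, by simpa using hab⟩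
    rw [R_iff hx hy] at h
    refine (sim_iff hx hy).2 ⟨fun w₃ k a ha => ?_, fun w₃ k b hb => ?_⟩
    · obtain ⟨b, hb, e', he'⟩ := (h.1.mono k).exists_R ha
      exact ⟨b, hb, ih' w₃ k a b e' ha (hb.V (K.tr_V k hy)) he'⟩
    · obtain ⟨a, ha, e', he'⟩ := (h.2.mono k).exists_R hb
      have hVa := ha.V (K.tr_V k hx)
      have hVb := hb.V (K.tr_V k hy)
      exact ⟨a, ha, sim_symm hVa hVb (ih' w₃ k a b _ ha hVb (R_symm hVb hVa he'))⟩

end KripkeModel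

namespace KripkeModel

/-! ### Formulas of set theory in a model -/

variable {K : KripkeModel} {w : K.World}

variable (K) in
/-- The truth of a formula of set theory at a world, under an assignment for its variables. -/
def sat : {n : ℕ} → SetFormula n → ∀ {w : K.World}, (Fin n → K.Dom w) → Prop
  | _, .eq x y, _, r => K.sim (r x) (r y)
  | _, .bot, _, _ => False
  | _, .and A B, _, r => sat A r ∧ sat B r
  | _, .or A B, _, r => sat A r ∨ sat B r
  | _, .imp A B, w, r => ∀ (w' : K.World) (f : K.Hom w w'),
      sat A (fun i => K.tr f (r i)) → sat B fun i => K.tr f (r i)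
  | _, .all A, w, r => ∀ (w' : K.World) (f : K.Hom w w') (d : K.Dom w'), K.V d →
      sat A (Matrix.vecCons d fun i => K.tr f (r i))
  | _, .ex A, w, r => ∃ d : K.Dom w, K.V d ∧ sat A (Matrix.vecCons d r)
  | _, .ball y A, w, r => ∀ (w' : K.World) (f : K.Hom w w') (d : K.Dom w'),
      K.EL (K.tr f (r y)) d → sat A (Matrix.vecCons d fun i => K.tr f (r i))
  | _, .bex y A, w, r => ∃ d : K.Dom w, K.EL (r y) d ∧ sat A (Matrix.vecCons d r)

theorem eval_vecCons_var {n : ℕ} (η : ℕ → K.Dom w) (d : K.Dom w) (ρ : Fin n → Term) :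
    (fun i => K.eval (econs d η) ((Matrix.vecCons (.var 0) fun i => (ρ i).lift 1 :
      Fin (n + 1) → Term) i)) = Matrix.vecCons d fun i => K.eval η (ρ i) := by
  rw [eval_vecCons]
  simp

theorem tr_vecCons {w' : K.World} (f : K.Hom w w') {n : ℕ} (d : K.Dom w) (r : Fin n → K.Dom w) :
    (fun i => K.tr f (Matrix.vecCons d r i)) = Matrix.vecCons (K.tr f d) fun i => K.tr f (r i) := by
  funext i
  refine Fin.cases ?_ (fun i => ?_) i <;> rfl

theorem V_vecCons {n : ℕ} {d : K.Dom w} {r : Fin n → K.Dom w} (hd : K.V d) (hr : ∀ i, K.V (r i)) :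
    ∀ i, K.V (Matrix.vecCons d r i) :=
  Fin.cases hd hr

variable [K.IsModel]

/-- A set-theoretic formula holds in the model if and only if its interpretation is forced. -/
theorem forces_interp {n : ℕ} (φ : SetFormula n) (ρ : Fin n → Term) (η : ℕ → K.Dom w) :
    K.forces (φ.interp ρ) η ↔ K.sat φ fun i => K.eval η (ρ i) := by
  induction φ generalizing w with
  | eq x y => exact Iff.rfl
  | bot => exact Iff.rfl
  | and A B ihA ihB | or A B ihA ihB =>
    simp only [SetFormula.interp, forces_and, forces_or, sat, ihA, ihB]
  | imp A B ihA ihB => simp only [SetFormula.interp, forces_imp, sat, ihA, ihB, tr_eval]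
  | all A ih =>
    simp only [SetFormula.interp, forces_all_imp, sat, ih, tr_eval, eval_vecCons_var]
    rfl
  | ex A ih =>
    simp only [SetFormula.interp, forces_ex, forces_and, sat, ih, eval_vecCons_var]
    rfl
  | ball y A ih =>
    simp only [SetFormula.interp, forces_all_imp, sat, ih, tr_eval, eval_vecCons_var, forces_EL,
      eval_lift, econs_succ, eval_var, econs_zero]
  | bex y A ih =>
    simp only [SetFormula.interp, forces_ex, forces_and, sat, ih, eval_vecCons_var, forces_EL,
      eval_lift, econs_succ, eval_var, econs_zero]

/-! ### Realizability -/

/-- The almost-negative formula "`e` realizes `φ(ρ)`". Extensional equality is replaced by its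
witnessed form `R`; realizers of unbounded quantifiers receive or contain the v-sets themselves, and
those of bounded quantifiers the indices of the elements. The first component of a realizer of a
disjunction is zero if the second one realizes the left disjunct, and a successor if it realizes the
right one. -/
def realizes : {n : ℕ} → SetFormula n → Term → (Fin n → Term) → Formula
  | _, .eq x y, e, ρ => .R e (ρ x) (ρ y)
  | _, .bot, _, _ => .bot
  | _, .and A B, e, ρ => .and (realizes A e.left ρ) (realizes B e.right ρ)
  | _, .or A B, e, ρ => .and (.imp (.eq e.left .zero) (realizes A e.right ρ))
      (.all (.imp (.eq (e.lift 1).left (.succ (.var 0)))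
        (realizes B (e.lift 1).right fun i => (ρ i).lift 1)))
  | _, .imp A B, e, ρ => .all (.imp (realizes A (.var 0) fun i => (ρ i).lift 1)
      (appAN (e.lift 1) (.var 0) (realizes B (.var 0) fun i => (ρ i).lift 2)))
  | _, .all A, e, ρ => .all (.imp (.V (.var 0)) (appAN (e.lift 1) (.var 0)
      (realizes A (.var 0) (Matrix.vecCons (.var 1) fun i => (ρ i).lift 2))))
  | _, .ex A, e, ρ => .and (.V e.left) (realizes A e.right (Matrix.vecCons e.left ρ))
  | _, .ball y A, e, ρ => .all (.imp (indAN ((ρ y).lift 1) (.var 0)) (appAN (e.lift 1) (.var 0)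
      (appAN ((ρ y).lift 2) (.var 1)
        (realizes A (.var 1) (Matrix.vecCons (.left (.var 0)) fun i => (ρ i).lift 3)))))
  | _, .bex y A, e, ρ => appAN (ρ y) e.left (.and (.T (.right (.var 0)))
      (realizes A (e.lift 1).right (Matrix.vecCons (.left (.var 0)) fun i => (ρ i).lift 1)))

theorem almostNegative_realizes {n : ℕ} (φ : SetFormula n) (e : Term) (ρ : Fin n → Term) :
    AlmostNegative (realizes φ e ρ) := by
  induction φ generalizing e with
  | eq x y => exact .R _ _ _
  | bot => exact .sigma1 (.qf .bot)
  | and A B ihA ihB => exact .and (ihA _ _) (ihB _ _)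
  | or A B ihA ihB =>
    exact .and (.imp (.sigma1 (.qf (.eq _ _))) (ihA _ _))
      (.all (.imp (.sigma1 (.qf (.eq _ _))) (ihB _ _)))
  | imp A B ihA ihB => exact .all (.imp (ihA _ _) (almostNegative_appAN _ _ (ihB _ _)))
  | all A ih => exact .all (.imp (.V _) (almostNegative_appAN _ _ (ih _ _)))
  | ex A ih => exact .and (.V _) (ih _ _)
  | ball y A ih =>
    exact .all (.imp (almostNegative_indAN _ _)
      (almostNegative_appAN _ _ (almostNegative_appAN _ _ (ih _ _))))
  | bex y A ih => exact almostNegative_appAN _ _ (.and (.T _) (ih _ _))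

variable (K) in
/-- Realizability in the model: what it means for the formula `realizes` to be forced. -/
def Realizes : {n : ℕ} → SetFormula n → ∀ {w : K.World}, K.Dom w → (Fin n → K.Dom w) → Prop
  | _, .eq x y, _, e, r => K.R e (r x) (r y)
  | _, .bot, _, _, _ => False
  | _, .and A B, _, e, r => Realizes A (K.left e) r ∧ Realizes B (K.right e) r
  | _, .or A B, _, e, r => (K.left e = K.zero ∧ Realizes A (K.right e) r) ∨
      ∃ m, K.left e = K.succ m ∧ Realizes B (K.right e) r
  | _, .imp A B, w, e, r => ∀ (w' : K.World) (f : K.Hom w w') (a : K.Dom w'),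
      Realizes A a (fun i => K.tr f (r i)) →
        ∃ b, K.Ap (K.tr f e) a b ∧ Realizes B b fun i => K.tr f (r i)
  | _, .all A, w, e, r => ∀ (w' : K.World) (f : K.Hom w w') (x : K.Dom w'), K.V x →
      ∃ b, K.Ap (K.tr f e) x b ∧ Realizes A b (Matrix.vecCons x fun i => K.tr f (r i))
  | _, .ex A, _, e, r => K.V (K.left e) ∧ Realizes A (K.right e) (Matrix.vecCons (K.left e) r)
  | _, .ball y A, w, e, r => ∀ (w' : K.World) (f : K.Hom w w') (n : K.Dom w'),
      K.Ind (K.tr f (r y)) n → ∃ b, K.Ap (K.tr f e) n b ∧ ∃ p, K.Ap (K.tr f (r y)) n p ∧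
        Realizes A b (Matrix.vecCons (K.left p) fun i => K.tr f (r i))
  | _, .bex y A, _, e, r => ∃ p, K.Ap (r y) (K.left e) p ∧ K.T (K.right p) ∧
      Realizes A (K.right e) (Matrix.vecCons (K.left p) r)

theorem forces_realizes {n : ℕ} (φ : SetFormula n) (e : Term) (ρ : Fin n → Term)
    (η : ℕ → K.Dom w) :
    K.forces (realizes φ e ρ) η ↔ K.Realizes φ (K.eval η e) fun i => K.eval η (ρ i) := by
  induction φ generalizing w e with
  | eq x y => exact Iff.rfl
  | bot => exact Iff.rfl
  | and A B ihA ihB => simp only [realizes, forces_and, Realizes, ihA, ihB, eval_left, eval_right]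
  | or A B ihA ihB =>
    simp only [realizes, forces_and, forces_imp, forces_all_imp, Realizes]
    have hA := ihA e.right ρ η
    have hB := ihB e.right ρ η
    rw [eval_right] at hA hB
    rw [← hA, ← hB]
    simp only [forces_eq, eval_left, eval_zero, eval_succ, eval_lift, eval_var, econs_zero,
      econs_succ, ihB, eval_right]
    constructor
    · rintro ⟨h₁, h₂⟩
      rcases eq_zero_or_succ (K.left (K.eval η e)) with h | ⟨m, h⟩
      · exact Or.inl ⟨h, by simpa using h₁ w (K.id w) (by simpa using h)⟩
      · exact Or.inr ⟨m, h, by simpa using h₂ w (K.id w) m (by simpa using h)⟩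
    · rintro (⟨h, hA⟩ | ⟨m, h, hB⟩)
      · refine ⟨fun w' f _ => forces_mono hA f, fun w' f d hd => ?_⟩
        rw [← tr_eval, ← tr_left, h, tr_zero] at hd
        exact absurd hd.symm (succ_ne_zero _)
      · refine ⟨fun w' f hd => ?_, fun w' f d _ => ?_⟩
        · rw [← tr_eval, ← tr_left, h, tr_succ] at hd
          exact absurd hd (succ_ne_zero _)
        · have := forces_mono (ihB e.right ρ η |>.2 (by simpa using hB)) f
          rw [ihB] at this
          simpa using this
  | imp A B ihA ihB =>
    simp [realizes, forces_all_imp, Realizes, ihA, ihB, tr_eval]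
  | all A ih =>
    simp [realizes, forces_all_imp, Realizes, ih, tr_eval, eval_vecCons]
  | ex A ih => simp [realizes, Realizes, ih, eval_vecCons]
  | ball y A ih =>
    simp [realizes, forces_all_imp, Realizes, ih, tr_eval, eval_vecCons]
  | bex y A ih => simp [realizes, Realizes, ih, eval_vecCons]

/-- By Extended Church's Thesis, truth is the existence of a realizer. The thesis is used for the
implication and the universal quantifiers, whose domains are almost negative because realizability
is. -/
theorem sat_iff_exists_realizes {n : ℕ} (φ : SetFormula n) {r : Fin n → K.Dom w}
    (hr : ∀ i, K.V (r i)) : K.sat φ r ↔ ∃ e, K.Realizes φ e r := by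
  induction φ generalizing w with
  | eq x y => exact ⟨exists_R_of_sim (hr x) (hr y), fun ⟨e, he⟩ => sim_of_R (hr x) (hr y) he⟩
  | bot => exact ⟨False.elim, fun ⟨_, h⟩ => h⟩
  | and A B ihA ihB =>
    simp only [sat, Realizes, ihA hr, ihB hr]
    constructor
    · rintro ⟨⟨a, ha⟩, b, hb⟩
      exact ⟨K.pair a b, by simpa using ha, by simpa using hb⟩
    · rintro ⟨e, h₁, h₂⟩
      exact ⟨⟨_, h₁⟩, _, h₂⟩
  | or A B ihA ihB =>
    simp only [sat, Realizes, ihA hr, ihB hr]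
    constructor
    · rintro (⟨a, ha⟩ | ⟨b, hb⟩)
      · exact ⟨K.pair K.zero a, Or.inl ⟨by simp, by simpa using ha⟩⟩
      · exact ⟨K.pair (K.succ K.zero) b, Or.inr ⟨K.zero, by simp, by simpa using hb⟩⟩
    · rintro ⟨e, ⟨-, h⟩ | ⟨m, -, h⟩⟩
      exacts [Or.inl ⟨_, h⟩, Or.inr ⟨_, h⟩]
  | imp A B ihA ihB =>
    constructor
    · intro h
      have := exists_index_of_almostNegative
        (almostNegative_realizes A (.var 0) fun i => .var (i + 1))
        (realizes B (.var 0) fun i => .var (i + 2)) (vecAssign r)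
        (by
          intro w' f a ha
          have hr' : ∀ i, K.V (K.tr f (r i)) := fun i => K.tr_V f (hr i)
          simp only [forces_realizes, eval_var, econs_zero, econs_succ, vecAssign_fin] at ha ⊢
          exact (ihB hr').1 (h w' f ((ihA hr').2 ⟨a, ha⟩)))
      simpa [forces_realizes, Realizes] using this
    · rintro ⟨e, he⟩ w' f hA
      have hr' : ∀ i, K.V (K.tr f (r i)) := fun i => K.tr_V f (hr i)
      obtain ⟨a, ha⟩ := (ihA hr').1 hA
      obtain ⟨b, -, hb⟩ := he w' f a ha
      exact (ihB hr').2 ⟨b, hb⟩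
  | all A ih =>
    constructor
    · intro h
      have := exists_index_of_almostNegative (AlmostNegative.V (.var 0))
        (realizes A (.var 0) (Matrix.vecCons (.var 1) fun i => .var (i + 2))) (vecAssign r)
        (by
          intro w' f x hx
          have hr' : ∀ i, K.V (K.tr f (r i)) := fun i => K.tr_V f (hr i)
          simp only [forces_realizes, eval_vecCons, eval_var, econs_zero, econs_succ, vecAssign_fin]
          exact (ih (V_vecCons hx hr')).1 (h w' f x hx))
      simpa [forces_realizes, eval_vecCons, Realizes] using this
    · rintro ⟨e, he⟩ w' f x hx
      obtain ⟨b, -, hb⟩ := he w' f x hx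
      exact (ih (V_vecCons hx fun i => K.tr_V f (hr i))).2 ⟨b, hb⟩
  | ex A ih =>
    constructor
    · rintro ⟨x, hx, h⟩
      obtain ⟨e, he⟩ := (ih (V_vecCons hx hr)).1 h
      exact ⟨K.pair x e, by simpa using hx, by simpa using he⟩
    · rintro ⟨e, hx, h⟩
      exact ⟨_, hx, (ih (V_vecCons hx hr)).2 ⟨_, h⟩⟩
  | ball y A ih =>
    constructor
    · intro h
      have := exists_index_of_almostNegative (almostNegative_indAN (.var (y + 1)) (.var 0))
        (.ex (.and (VSets.Ap (.var (y + 3)) (.var 2) (.var 0))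
          (realizes A (.var 1) (Matrix.vecCons (.left (.var 0)) fun i => .var (i + 3)))))
        (vecAssign r)
        (by
          intro w' f n hn
          have hr' : ∀ i, K.V (K.tr f (r i)) := fun i => K.tr_V f (hr i)
          simp only [forces_realizes, forces_indAN, forces_ex, forces_and, forces_Ap, eval_vecCons,
            eval_var, eval_left, econs_zero, econs_succ, vecAssign_fin] at hn ⊢
          obtain ⟨p, hp, hT⟩ := hn
          have hEL : K.EL (K.tr f (r y)) (K.left p) := ⟨n, p, hp, hT, rfl⟩
          obtain ⟨b, hb⟩ := (ih (V_vecCons (hEL.V (hr' y)) hr')).1 (h w' f _ hEL)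
          exact ⟨b, p, hp, hb⟩)
      simpa [forces_realizes, eval_vecCons, Realizes] using this
    · rintro ⟨e, he⟩ w' f x hx
      have hVx := hx.V (K.tr_V f (hr y))
      obtain ⟨n, p, hp, hT, rfl⟩ := hx
      obtain ⟨b, -, q, hq, hb⟩ := he w' f n ⟨p, hp, hT⟩
      rw [hq.unique hp] at hb
      exact (ih (V_vecCons hVx fun i => K.tr_V f (hr i))).2 ⟨b, hb⟩
  | bex y A ih =>
    constructor
    · rintro ⟨x, hx, h⟩
      obtain ⟨e, he⟩ := (ih (V_vecCons (hx.V (hr y)) hr)).1 h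
      obtain ⟨n, p, hp, hT, rfl⟩ := hx
      exact ⟨K.pair n e, p, by simpa using hp, hT, by simpa using he⟩
    · rintro ⟨e, p, hp, hT, h⟩
      have hEL : K.EL (r y) (K.left p) := ⟨_, p, hp, hT, rfl⟩
      exact ⟨_, hEL, (ih (V_vecCons (hEL.V (hr y)) hr)).2 ⟨_, h⟩⟩

end KripkeModel

namespace KripkeModel

variable {K : KripkeModel} {w : K.World} [K.IsModel]

/-! ### Recursion and dependent choices for almost-negative predicates -/

/-- The index `s` of the diagonal section `i ↦ x ⟨x, i⟩`, as a recursive function of `x`: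
Church's Thesis for `i` gives a section for each `x`, and for `x` the function `S`. -/
theorem exists_diagonal : ∃ S : K.Dom w, ∀ (w' : K.World) (f : K.Hom w w') (x : K.Dom w'),
    ∃ s, K.Ap (K.tr f S) x s ∧ ∀ (w'' : K.World) (g : K.Hom w' w'') (i m : K.Dom w''),
      K.Ap (K.tr g x) (K.pair (K.tr g x) i) m → K.Ap (K.tr g s) i m := by
  have := exists_index (.all (.imp (Dfd (.var 2) (Term.pair (.var 2) (.var 0)))
    (.ex (.and (VSets.Ap (.var 2) (.var 1) (.var 0))
      (VSets.Ap (.var 3) (Term.pair (.var 3) (.var 1)) (.var 0))))))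
    (fun _ => (K.zero : K.Dom w)) (fun w' f x => by
      have := exists_index_of_almostNegative (K := K) (w := w')
        (A := Dfd (.var 1) (Term.pair (.var 1) (.var 0)))
        (.sigma1 (.ex (.qf (.and (.eq _ _) (.eq _ _)))))
        (VSets.Ap (.var 2) (Term.pair (.var 2) (.var 1)) (.var 0)) (fun _ => x)
        (fun w'' g i h => by simpa using h)
      simpa [forces_all_imp] using this)
  obtain ⟨S, hS⟩ := this
  refine ⟨S, fun w' f x => ?_⟩
  obtain ⟨s, hs, h⟩ := hS w' f x
  refine ⟨s, hs, fun w'' g i m hm => ?_⟩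
  rw [forces_all_imp] at h
  simp only [forces_Dfd, forces_ex, forces_and, forces_Ap, eval_pair, eval_var, econs_zero,
    econs_succ, tr_econs] at h
  obtain ⟨v, hv, hv'⟩ := h w'' g i ⟨m, hm⟩
  rwa [hm.unique hv']

/-- Iteration of a recursive function, by the recursion theorem: the diagonal section of `h` at `h`
is a fixed point. -/
theorem exists_iterate (g a : K.Dom w) : ∃ J : K.Dom w, K.Ap J K.zero a ∧
    ∀ (w' : K.World) (f : K.Hom w w') (n u m : K.Dom w'), K.Ap (K.tr f J) n u →
      K.Ap (K.tr f g) u m → K.Ap (K.tr f J) (K.succ n) m := by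
  obtain ⟨S, hS⟩ := exists_diagonal (K := K) (w := w)
  -- the domain of `⟨x, 0⟩ ↦ a`, `⟨x, n + 1⟩ ↦ g ((S x) n)` in prenex form
  have := exists_index_of_almostNegative (K := K) (w := w)
    (A := .ex (.ex (.ex (.and (kleeneT (.var 4) (.left (.var 3)) (.var 2))
      (.or (.eq (.right (.var 3)) .zero)
        (.and (kleeneT (.out (.var 2)) (.pred (.right (.var 3))) (.var 1))
          (kleeneT (.var 5) (.out (.var 1)) (.var 0))))))))
    (.sigma1 (.ex (.ex (.ex (.qf (.and (.and (.eq _ _) (.eq _ _)) (.or (.eq _ _)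
      (.and (.and (.eq _ _) (.eq _ _)) (.and (.eq _ _) (.eq _ _))))))))))
    (.ex (.and (VSets.Ap (.var 3) (.left (.var 2)) (.var 0))
      (.or (.and (.eq (.right (.var 2)) .zero) (.eq (.var 1) (.var 5)))
        (.ex (.ex (.and (.eq (.right (.var 4)) (.succ (.var 1)))
          (.and (VSets.Ap (.var 2) (.var 1) (.var 0)) (VSets.Ap (.var 6) (.var 0) (.var 3)))))))))
    (econs S (econs g fun _ => a)) (fun w' f p h => by
      simp only [forces_ex, forces_and, forces_or, forces_kleeneT, forces_eq, forces_Ap, eval_var,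
        eval_left, eval_right, eval_zero, eval_out, eval_pred, eval_succ, econs_zero, econs_succ,
        tr_econs] at h ⊢
      obtain ⟨oS, o₁, o₂, hoS, h⟩ := h
      rcases eq_zero_or_succ (K.right p) with hp | ⟨n, hp⟩
      · exact ⟨K.tr f a, _, ⟨oS, hoS, rfl⟩, Or.inl ⟨hp, rfl⟩⟩
      · rw [hp, pred_succ] at h
        obtain ⟨h₁, h₂⟩ := h.resolve_left (succ_ne_zero n)
        exact ⟨K.out o₂, _, ⟨oS, hoS, rfl⟩, Or.inr ⟨n, K.out o₁, hp, ⟨o₁, h₁, rfl⟩, o₂, h₂, rfl⟩⟩)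
  obtain ⟨h, hh⟩ := this
  simp only [forces_ex, forces_and, forces_or, forces_kleeneT, forces_eq, forces_Ap, eval_var,
    eval_left, eval_right, eval_zero, eval_out, eval_pred, eval_succ, econs_zero, econs_succ,
    tr_econs] at hh
  obtain ⟨J, hJ, hfix⟩ := hS w (K.id w) h
  rw [K.tr_id] at hJ
  refine ⟨J, ?_, fun w' f n u m hu hm => ?_⟩
  · obtain ⟨oS, hoS, -⟩ := hJ
    obtain ⟨v, hv, s, -, hs⟩ := hh w (K.id w) (K.pair h K.zero)
      ⟨oS, oS, oS, by simpa using hoS, Or.inl (right_pair _ _)⟩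
    rw [right_pair] at hs
    rcases hs with ⟨-, rfl⟩ | ⟨i, -, h0, -⟩
    · simpa using hfix w (K.id w) K.zero _ (by simpa using hv)
    · exact absurd h0.symm (succ_ne_zero i)
  · have hJ' := hJ.mono f
    obtain ⟨oS, hoS, hJo⟩ := hJ'
    obtain ⟨o₁, ho₁, rfl⟩ := hu
    obtain ⟨o₂, ho₂, rfl⟩ := hm
    obtain ⟨v, hv, s, hs, hv'⟩ := hh w' f (K.pair (K.tr f h) (K.succ n))
      ⟨oS, o₁, o₂, by simpa using hoS, Or.inr ⟨by simpa [hJo] using ho₁, ho₂⟩⟩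
    rw [left_pair] at hs
    rw [right_pair] at hv'
    rw [hs.unique (hJ.mono f)] at hv'
    rcases hv' with ⟨h0, -⟩ | ⟨i, u, hi, hu, hm⟩
    · exact absurd h0 (succ_ne_zero n)
    · rw [← succ_inj hi] at hu
      rw [hu.unique ⟨o₁, ho₁, rfl⟩] at hm
      rw [← hm.unique ⟨o₂, ho₂, rfl⟩]
      exact hfix w' f _ _ hv

/-- Dependent choices for an almost-negative predicate. -/
theorem exists_choice_sequence {A : Formula} (hA : AlmostNegative A) (B : Formula) (ρ : ℕ → K.Dom w)
    {a : K.Dom w} (ha : K.forces A (econs a ρ))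
    (h : ∀ (w' : K.World) (f : K.Hom w w') (n : K.Dom w'),
      K.forces A (econs n fun k => K.tr f (ρ k)) →
        ∃ m, K.forces A (econs m fun k => K.tr f (ρ k)) ∧
          K.forces B (econs m (econs n fun k => K.tr f (ρ k)))) :
    ∃ J : K.Dom w, K.Ap J K.zero a ∧ ∀ (w' : K.World) (f : K.Hom w w') (n : K.Dom w'),
      ∃ u u', K.Ap (K.tr f J) n u ∧ K.Ap (K.tr f J) (K.succ n) u' ∧
        K.forces A (econs u fun k => K.tr f (ρ k)) ∧ K.forces A (econs u' fun k => K.tr f (ρ k)) ∧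
          K.forces B (econs u' (econs u fun k => K.tr f (ρ k))) := by
  obtain ⟨g, hg⟩ := exists_index_of_almostNegative hA
    (.and (A.subst (scons (.var 0) fun k => .var (k + 2))) B) ρ (by
      simpa [forces_subst] using h)
  simp only [forces_and, forces_subst, eval_scons, eval_var, econs_zero, econs_succ] at hg
  obtain ⟨J, hJ₀, hJ⟩ := exists_iterate g a
  refine ⟨J, hJ₀, fun w' f n => ?_⟩
  have key := induction (.ex (.and (VSets.Ap (.var 2) (.var 1) (.var 0))
    (A.subst (scons (.var 0) fun k => .var (k + 3)))))
    (econs (K.tr f J) fun k => K.tr f (ρ k)) ?_ ?_ n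
  · simp only [forces_ex, forces_and, forces_Ap, forces_subst, eval_scons, eval_var, econs_zero,
      econs_succ] at key
    obtain ⟨u, hu, hAu⟩ := key
    obtain ⟨v, hv, hAv, hB⟩ := hg w' f u hAu
    exact ⟨u, v, hu, hJ w' f n u v hu hv, hAu, hAv, hB⟩
  · simp only [forces_ex, forces_and, forces_Ap, forces_subst, eval_scons, eval_var, econs_zero,
      econs_succ]
    refine ⟨K.tr f a, by simpa using hJ₀.mono f, ?_⟩
    rw [← tr_econs]
    exact forces_mono ha f
  · intro w'' k d hd
    simp only [forces_ex, forces_and, forces_Ap, forces_subst, eval_scons, eval_var, econs_zero,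
      econs_succ, tr_econs, ← K.tr_comp] at hd ⊢
    obtain ⟨u, hu, hAu⟩ := hd
    obtain ⟨v, hv, hAv, -⟩ := hg w'' _ u hAu
    exact ⟨v, hJ w'' _ d u v hu hv, hAv⟩

end KripkeModel

namespace KripkeModel

/-! ### Sets, ordered pairs and von Neumann ordinals in a model -/

variable {K : KripkeModel} {w : K.World}

variable (K) in
/-- `x` is empty. -/
def IsEmpty (x : K.Dom w) : Prop :=
  ∀ (w' : K.World) (f : K.Hom w w') (u : K.Dom w'), ¬ K.EL (K.tr f x) u

variable (K) in
/-- `y = x ∪ {x}` -/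
def IsSucc (y x : K.Dom w) : Prop :=
  K.Mem x y ∧ (∀ (w' : K.World) (f : K.Hom w w') (u : K.Dom w'), K.EL (K.tr f x) u →
    K.Mem u (K.tr f y)) ∧
  ∀ (w' : K.World) (f : K.Hom w w') (u : K.Dom w'), K.EL (K.tr f y) u →
    K.Mem u (K.tr f x) ∨ K.sim u (K.tr f x)

variable (K) in
/-- `z = {a, b}` -/
def IsUPair (z a b : K.Dom w) : Prop :=
  K.Mem a z ∧ K.Mem b z ∧ ∀ (w' : K.World) (f : K.Hom w w') (u : K.Dom w'), K.EL (K.tr f z) u →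
    K.sim u (K.tr f a) ∨ K.sim u (K.tr f b)

variable (K) in
/-- `z = {{a}, {a, b}}` -/
def IsOPair (z a b : K.Dom w) : Prop :=
  (∃ u, K.EL z u ∧ K.IsUPair u a a) ∧ (∃ u, K.EL z u ∧ K.IsUPair u a b) ∧
  ∀ (w' : K.World) (f : K.Hom w w') (u : K.Dom w'), K.EL (K.tr f z) u →
    K.IsUPair u (K.tr f a) (K.tr f a) ∨ K.IsUPair u (K.tr f a) (K.tr f b)

variable (K) in
/-- The ordered pair of `a` and `b` is an element of `k`. -/
def OPairMem (a b k : K.Dom w) : Prop := ∃ p, K.EL k p ∧ K.IsOPair p a b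

section sat

variable {n : ℕ} (r : Fin n → K.Dom w) (x y z a b : Fin n)

theorem sat_mem : K.sat (.mem x y) r ↔ K.Mem (r x) (r y) := by
  simp [SetFormula.mem, sat, Mem]

theorem sat_isEmpty : K.sat (.isEmpty x) r ↔ K.IsEmpty (r x) := by
  simp [SetFormula.isEmpty, sat, IsEmpty]

theorem sat_isSucc : K.sat (.isSucc y x) r ↔ K.IsSucc (r y) (r x) := by
  simp [SetFormula.isSucc, sat, IsSucc, sat_mem]

theorem sat_isUPair : K.sat (.isUPair z a b) r ↔ K.IsUPair (r z) (r a) (r b) := by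
  simp [SetFormula.isUPair, sat, IsUPair, sat_mem]

theorem sat_isOPair : K.sat (.isOPair z a b) r ↔ K.IsOPair (r z) (r a) (r b) := by
  simp [SetFormula.isOPair, sat, IsOPair, sat_isUPair]

theorem sat_opairMem : K.sat (.opairMem a b x) r ↔ K.OPairMem (r a) (r b) (r x) := by
  simp [SetFormula.opairMem, sat, OPairMem, sat_isOPair]

end sat

section mono

variable {w' : K.World} (f : K.Hom w w') {x y z a b : K.Dom w}

theorem Mem.mono (h : K.Mem a x) : K.Mem (K.tr f a) (K.tr f x) := by
  obtain ⟨b, hb, hab⟩ := h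
  exact ⟨_, hb.mono f, K.tr_sim f hab⟩

theorem IsEmpty.mono (h : K.IsEmpty x) : K.IsEmpty (K.tr f x) := by
  intro w'' g u
  rw [← K.tr_comp]
  exact h _ _ u

theorem IsSucc.mono (h : K.IsSucc y x) : K.IsSucc (K.tr f y) (K.tr f x) := by
  refine ⟨h.1.mono f, fun w'' g u => ?_, fun w'' g u => ?_⟩
  · simp only [← K.tr_comp]
    exact h.2.1 _ _ u
  · simp only [← K.tr_comp]
    exact h.2.2 _ _ u

theorem IsUPair.mono (h : K.IsUPair z a b) : K.IsUPair (K.tr f z) (K.tr f a) (K.tr f b) := by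
  refine ⟨h.1.mono f, h.2.1.mono f, fun w'' g u => ?_⟩
  simp only [← K.tr_comp]
  exact h.2.2 _ _ u

end mono

theorem IsUPair.sim_or {z a b u : K.Dom w} (h : K.IsUPair z a b) (hu : K.EL z u) :
    K.sim u a ∨ K.sim u b := by
  simpa using h.2.2 w (K.id w) u (by simpa using hu)

theorem IsOPair.isUPair_or {z a b u : K.Dom w} (h : K.IsOPair z a b) (hu : K.EL z u) :
    K.IsUPair u a a ∨ K.IsUPair u a b := by
  simpa using h.2.2 w (K.id w) u (by simpa using hu)

theorem IsSucc.mem_or {y x u : K.Dom w} (h : K.IsSucc y x) (hu : K.EL y u) :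
    K.Mem u x ∨ K.sim u x := by
  simpa using h.2.2 w (K.id w) u (by simpa using hu)

theorem IsSucc.mem_of_EL {y x u : K.Dom w} (h : K.IsSucc y x) (hu : K.EL x u) : K.Mem u y := by
  simpa using h.2.1 w (K.id w) u (by simpa using hu)

variable [K.IsModel]

theorem IsUPair.sim_or_of_mem {z a b u : K.Dom w} (hz : K.V z) (ha : K.V a) (hb : K.V b)
    (hu : K.V u) (h : K.IsUPair z a b) (huz : K.Mem u z) : K.sim u a ∨ K.sim u b := by
  obtain ⟨v, hv, huv⟩ := huz
  have hVv := hv.V hz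
  exact (h.sim_or hv).imp (sim_trans hu hVv ha huv) (sim_trans hu hVv hb huv)

/-- The first half of the characteristic property of Kuratowski's ordered pairs. -/
theorem IsOPair.sim_left {p a b c d : K.Dom w} (hp : K.V p) (ha : K.V a) (hc : K.V c)
    (h : K.IsOPair p a b) (h' : K.IsOPair p c d) : K.sim a c := by
  obtain ⟨s, hs, hsa⟩ := h.1
  have hVs := hs.V hp
  have hcs : K.Mem c s := by
    rcases h'.isUPair_or hs with h₁ | h₁
    exacts [h₁.1, h₁.1]
  rcases hsa.sim_or_of_mem hVs ha ha hc hcs with h₁ | h₁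
  all_goals exact sim_symm hc ha h₁

/-- The second half of the characteristic property of Kuratowski's ordered pairs. -/
theorem IsOPair.sim_right {p a b c d : K.Dom w} (hp : K.V p) (ha : K.V a) (hb : K.V b)
    (hc : K.V c) (hd : K.V d) (h : K.IsOPair p a b) (h' : K.IsOPair p c d) : K.sim b d := by
  have hac := h.sim_left hp ha hc h'
  have hca := sim_symm ha hc hac
  -- `b` is one of `c`, `d`, and `d` is one of `a`, `b`
  have hbcd : K.sim b c ∨ K.sim b d := by
    obtain ⟨t, ht, hab⟩ := h.2.1
    rcases h'.isUPair_or ht with h₁ | h₁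
    · exact Or.inl (by simpa using h₁.sim_or_of_mem (ht.V hp) hc hc hb hab.2.1)
    · exact h₁.sim_or_of_mem (ht.V hp) hc hd hb hab.2.1
  have hdab : K.sim d a ∨ K.sim d b := by
    obtain ⟨t, ht, hcd⟩ := h'.2.1
    rcases h.isUPair_or ht with h₁ | h₁
    · exact Or.inl (by simpa using h₁.sim_or_of_mem (ht.V hp) ha ha hd hcd.2.1)
    · exact h₁.sim_or_of_mem (ht.V hp) ha hb hd hcd.2.1
  rcases hbcd with h₁ | h₁
  · rcases hdab with h₂ | h₂
    · exact sim_trans hb ha hd (sim_trans hb hc ha h₁ hca) (sim_symm hd ha h₂)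
    · exact sim_symm hd hb h₂
  · exact h₁

theorem IsEmpty.congr {x y : K.Dom w} (hx : K.V x) (hy : K.V y) (h : K.IsEmpty x)
    (hxy : K.sim x y) : K.IsEmpty y := by
  intro w' f u hu
  obtain ⟨v, hv, -⟩ := ((sim_iff hx hy).1 hxy).2 w' f u hu
  exact h w' f v hv

theorem IsEmpty.sim {x y : K.Dom w} (hx : K.V x) (hy : K.V y) (h : K.IsEmpty x)
    (h' : K.IsEmpty y) : K.sim x y :=
  (sim_iff hx hy).2 ⟨fun w' f a ha => absurd ha (h w' f a), fun w' f a ha => absurd ha (h' w' f a)⟩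

theorem IsSucc.congr {x y z : K.Dom w} (hx : K.V x) (hy : K.V y) (hz : K.V z) (h : K.IsSucc y x)
    (hyz : K.sim y z) : K.IsSucc z x := by
  refine ⟨h.1.congr_right hx hy hz hyz, fun w' f u hu => ?_, fun w' f u hu => ?_⟩
  · exact ((h.mono f).mem_of_EL hu).congr_right (hu.V (K.tr_V f hx)) (K.tr_V f hy) (K.tr_V f hz)
      (K.tr_sim f hyz)
  · have hx := K.tr_V f hx
    have hy := K.tr_V f hy
    have hz := K.tr_V f hz
    have hVu := hu.V hz
    obtain ⟨v, hv, huv⟩ := (hu.mem hz).congr_right hVu hz hy (sim_symm hy hz (K.tr_sim f hyz))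
    have hVv := hv.V hy
    exact ((h.mono f).mem_or hv).imp
      (fun h => h.congr_left hVv hVu hx (sim_symm hVu hVv huv)) (sim_trans hVu hVv hx huv)

theorem IsSucc.mem_of_mem {y x u : K.Dom w} (hx : K.V x) (hy : K.V y) (hu : K.V u)
    (h : K.IsSucc y x) (hux : K.Mem u x) : K.Mem u y := by
  obtain ⟨v, hv, huv⟩ := hux
  have hVv := hv.V hx
  exact (h.mem_of_EL hv).congr_left hVv hu hy (sim_symm hu hVv huv)

/-- Successors are unique up to extensional equality. -/
theorem IsSucc.sim {x y z : K.Dom w} (hx : K.V x) (hy : K.V y) (hz : K.V z) (h : K.IsSucc y x)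
    (h' : K.IsSucc z x) : K.sim y z := by
  have key : ∀ {y z : K.Dom w}, K.V y → K.V z → K.IsSucc y x → K.IsSucc z x →
      ∀ (w' : K.World) (f : K.Hom w w') (a : K.Dom w'), K.EL (K.tr f y) a →
        ∃ b, K.EL (K.tr f z) b ∧ K.sim a b := by
    intro y z hy hz h h' w' f a ha
    have hx := K.tr_V f hx
    have hz := K.tr_V f hz
    have hVa := ha.V (K.tr_V f hy)
    rcases (h.mono f).mem_or ha with h₁ | h₁
    · exact (h'.mono f).mem_of_mem hx hz hVa h₁
    · exact (h'.mono f).1.congr_left hx hVa hz (sim_symm hVa hx h₁)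
  exact (sim_iff hy hz).2 ⟨key hy hz h h', key hz hy h' h⟩

/-! ### Existence of sets -/

theorem exists_true : ∃ t : K.Dom w, K.M t ∧ K.T t := by
  obtain ⟨top, bot, Pi, hK⟩ := IsModel.exists_models (K := K)
  have h₁ := hK _ .topM w fun _ => K.zero
  have h₂ := hK _ .topT w fun _ => K.zero
  exact ⟨_, h₁, h₂⟩

theorem exists_false : ∃ b : K.Dom w, K.M b ∧
    ∀ (w' : K.World) (f : K.Hom w w'), ¬ K.T (K.tr f b) := by
  obtain ⟨top, bot, Pi, hK⟩ := IsModel.exists_models (K := K)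
  have h₁ := hK _ .botM w fun _ => K.zero
  have h₂ := hK _ .botT w fun _ => K.zero
  refine ⟨_, h₁, fun w' f h => h₂ w' f ?_⟩
  rw [tr_eval] at h
  exact h

theorem exists_isEmpty : ∃ z : K.Dom w, K.V z ∧ K.IsEmpty z := by
  obtain ⟨b, hM, hT⟩ := exists_false (K := K) (w := w)
  obtain ⟨z, hz⟩ := exists_index (.eq (.right (.var 0)) (.var 2)) (fun _ => b)
    (fun w' f n => ⟨K.pair K.zero (K.tr f b), by simp⟩)
  simp only [forces_eq, eval_right, eval_var, econs_zero, econs_succ] at hz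
  refine ⟨z, V_intro fun w' f n => ?_, fun w' f u hu => ?_⟩
  · obtain ⟨p, hp, hpb⟩ := hz w' f n
    refine ⟨p, hp, by simpa [hpb] using K.tr_M f hM, fun w'' g h => ?_⟩
    rw [hpb, ← K.tr_comp] at h
    exact absurd h (hT _ _)
  · obtain ⟨n, p, hp, h, -⟩ := hu
    obtain ⟨q, hq, hqb⟩ := hz w' f n
    rw [hp.unique hq, hqb] at h
    exact hT _ _ h

/-- The range of a recursive sequence of v-sets. -/
theorem exists_range {e : K.Dom w} (he : ∀ (w' : K.World) (f : K.Hom w w') (n : K.Dom w'),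
    ∃ v, K.Ap (K.tr f e) n v ∧ K.V v) :
    ∃ z : K.Dom w, K.V z ∧ ∀ (w' : K.World) (f : K.Hom w w') (a : K.Dom w'),
      K.EL (K.tr f z) a ↔ ∃ n, K.Ap (K.tr f e) n a := by
  obtain ⟨t, hM, hT⟩ := exists_true (K := K) (w := w)
  obtain ⟨z, hz⟩ := exists_index
    (.and (VSets.Ap (.var 2) (.var 1) (.left (.var 0))) (.eq (.right (.var 0)) (.var 3)))
    (econs e fun _ => t) (fun w' f n => by
      obtain ⟨v, hv, -⟩ := he w' f n
      exact ⟨K.pair v (K.tr f t), by simpa using hv⟩)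
  simp only [forces_and, forces_eq, forces_Ap, eval_left, eval_right, eval_var, econs_zero,
    econs_succ, tr_econs] at hz
  refine ⟨z, V_intro fun w' f n => ?_, fun w' f a => ?_⟩
  · obtain ⟨p, hp, hpe, hpt⟩ := hz w' f n
    refine ⟨p, hp, by simpa [hpt] using K.tr_M f hM, fun w'' g _ => K.tr_V g ?_⟩
    obtain ⟨v, hv, hV⟩ := he w' f n
    rwa [hpe.unique hv]
  · constructor
    · rintro ⟨n, p, hp, -, rfl⟩
      obtain ⟨q, hq, hqe, -⟩ := hz w' f n
      rw [hp.unique hq]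
      exact ⟨n, hqe⟩
    · rintro ⟨n, hn⟩
      obtain ⟨p, hp, hpe, hpt⟩ := hz w' f n
      exact ⟨n, p, hp, by simpa [hpt] using K.tr_T f hT, hpe.unique hn⟩

theorem exists_pair {a b : K.Dom w} (ha : K.V a) (hb : K.V b) :
    ∃ z : K.Dom w, K.V z ∧ K.EL z a ∧ K.EL z b ∧
      ∀ (w' : K.World) (f : K.Hom w w') (u : K.Dom w'), K.EL (K.tr f z) u →
        u = K.tr f a ∨ u = K.tr f b := by
  obtain ⟨e, he⟩ := exists_index (.or (.and (.eq (.var 1) .zero) (.eq (.var 0) (.var 2)))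
    (.and (.ex (.eq (.var 2) (.succ (.var 0)))) (.eq (.var 0) (.var 3))))
    (econs a fun _ => b) (fun w' f n => by
      simp only [forces_or, forces_and, forces_eq, forces_ex, eval_var, eval_zero, eval_succ,
        econs_zero, econs_succ, tr_econs]
      rcases eq_zero_or_succ n with rfl | ⟨m, rfl⟩
      · exact ⟨K.tr f a, Or.inl ⟨rfl, rfl⟩⟩
      · exact ⟨K.tr f b, Or.inr ⟨⟨m, rfl⟩, rfl⟩⟩)
  simp only [forces_or, forces_and, forces_eq, forces_ex, eval_var, eval_zero, eval_succ,
    econs_zero, econs_succ, tr_econs] at he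
  obtain ⟨z, hz, hEL⟩ := exists_range (e := e) (fun w' f n => by
    obtain ⟨v, hv, ⟨-, rfl⟩ | ⟨-, rfl⟩⟩ := he w' f n
    exacts [⟨_, hv, K.tr_V f ha⟩, ⟨_, hv, K.tr_V f hb⟩])
  have hEL' : ∀ u, K.EL z u ↔ ∃ n, K.Ap e n u := fun u => by simpa using hEL w (K.id w) u
  refine ⟨z, hz, (hEL' a).2 ⟨K.zero, ?_⟩, (hEL' b).2 ⟨K.succ K.zero, ?_⟩, fun w' f u hu => ?_⟩
  · obtain ⟨v, hv, ⟨-, h⟩ | ⟨⟨m, h⟩, -⟩⟩ := he w (K.id w) K.zero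
    · rw [K.tr_id] at hv h
      rwa [← h]
    · exact absurd h.symm (succ_ne_zero m)
  · obtain ⟨v, hv, ⟨h, -⟩ | ⟨-, h⟩⟩ := he w (K.id w) (K.succ K.zero)
    · exact absurd h (succ_ne_zero _)
    · rw [K.tr_id] at hv h
      rwa [← h]
  · obtain ⟨n, hn⟩ := (hEL w' f u).1 hu
    obtain ⟨v, hv, h⟩ := he w' f n
    rw [hn.unique hv]
    exact h.imp And.right And.right

theorem exists_isUPair {a b : K.Dom w} (ha : K.V a) (hb : K.V b) :
    ∃ z : K.Dom w, K.V z ∧ K.IsUPair z a b := by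
  obtain ⟨z, hz, haz, hbz, h⟩ := exists_pair ha hb
  refine ⟨z, hz, haz.mem hz, hbz.mem hz, fun w' f u hu => ?_⟩
  rcases h w' f u hu with rfl | rfl
  exacts [Or.inl (sim_refl (K.tr_V f ha)), Or.inr (sim_refl (K.tr_V f hb))]

theorem exists_isOPair {a b : K.Dom w} (ha : K.V a) (hb : K.V b) :
    ∃ z : K.Dom w, K.V z ∧ K.IsOPair z a b := by
  obtain ⟨s, hs, hsa⟩ := exists_isUPair ha ha
  obtain ⟨t, ht, htb⟩ := exists_isUPair ha hb
  obtain ⟨z, hz, hsz, htz, h⟩ := exists_pair hs ht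
  refine ⟨z, hz, ⟨s, hsz, hsa⟩, ⟨t, htz, htb⟩, fun w' f u hu => ?_⟩
  rcases h w' f u hu with rfl | rfl
  exacts [Or.inl (hsa.mono f), Or.inr (htb.mono f)]

theorem exists_isSucc {x : K.Dom w} (hx : K.V x) : ∃ y : K.Dom w, K.V y ∧ K.IsSucc y x := by
  obtain ⟨t, hM, hT⟩ := exists_true (K := K) (w := w)
  -- the element with index `0` is `x`, the others are those of `x`, with their conditions
  obtain ⟨y, hy⟩ := exists_index (.or
    (.and (.eq (.var 1) .zero) (.eq (.var 0) (Term.pair (.var 2) (.var 3))))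
    (.ex (.and (.eq (.var 2) (.succ (.var 0))) (VSets.Ap (.var 3) (.var 0) (.var 1)))))
    (econs x fun _ => t) (fun w' f n => by
      simp only [forces_or, forces_and, forces_eq, forces_ex, forces_Ap, eval_var, eval_zero,
        eval_succ, eval_pair, econs_zero, econs_succ, tr_econs]
      rcases eq_zero_or_succ n with rfl | ⟨m, rfl⟩
      · exact ⟨_, Or.inl ⟨rfl, rfl⟩⟩
      · obtain ⟨p, hp, -⟩ := (K.tr_V f hx : K.V (K.tr f x)).exists_ap m
        exact ⟨p, Or.inr ⟨m, rfl, hp⟩⟩)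
  simp only [forces_or, forces_and, forces_eq, forces_ex, forces_Ap, eval_var, eval_zero,
    eval_succ, eval_pair, econs_zero, econs_succ, tr_econs] at hy
  have hV : K.V y := V_intro fun w' f n => by
    obtain ⟨p, hp, ⟨-, rfl⟩ | ⟨m, -, hm⟩⟩ := hy w' f n
    · exact ⟨_, hp, by simpa using K.tr_M f hM, fun w'' g _ => by
        simpa using K.tr_V g (K.tr_V f hx)⟩
    · obtain ⟨q, hq, hMq, -⟩ := (K.tr_V f hx : K.V (K.tr f x)).exists_ap m
      rw [hq.unique hm] at hMq
      refine ⟨p, hp, hMq, fun w'' g h => ?_⟩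
      obtain ⟨q', hq', -, hV⟩ := (K.tr_V g (K.tr_V f hx)).exists_ap (K.tr g m)
      rw [hq'.unique (hm.mono g)] at hV
      simpa using hV (by simpa using h)
  have hxy : K.EL y x := by
    obtain ⟨p, hp, ⟨-, rfl⟩ | ⟨m, h, -⟩⟩ := hy w (K.id w) K.zero
    · simp only [K.tr_id] at hp
      exact ⟨_, _, hp, by simpa using hT, by simp⟩
    · exact absurd h.symm (succ_ne_zero m)
  refine ⟨y, hV, hxy.mem hV, fun w' f u hu => ?_, fun w' f u hu => ?_⟩
  · refine EL.mem (K.tr_V f hV) ?_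
    obtain ⟨n, p, hp, hTp, rfl⟩ := hu
    obtain ⟨q, hq, ⟨h, -⟩ | ⟨m, h, hm⟩⟩ := hy w' f (K.succ n)
    · exact absurd h (succ_ne_zero n)
    · rw [← succ_inj h] at hm
      rw [hm.unique hp] at hq
      exact ⟨_, p, hq, hTp, rfl⟩
  · obtain ⟨n, p, hp, hTp, rfl⟩ := hu
    obtain ⟨q, hq, ⟨-, rfl⟩ | ⟨m, -, hm⟩⟩ := hy w' f n
    · rw [hp.unique hq]
      simpa using Or.inr (sim_refl (K.tr_V f hx))
    · rw [hp.unique hq] at hTp ⊢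
      exact Or.inl (EL.mem (K.tr_V f hx) ⟨m, q, hm, hTp, rfl⟩)

end KripkeModel

namespace KripkeModel

variable {K : KripkeModel} {w : K.World}

/-! ### The sequence of the numerals and the set `ω` -/

/-- `v` is an index of the sequence of the finite von Neumann ordinals. -/
structure IsNumeralSeq (v : K.Dom w) : Prop where
  zero : ∃ z, K.Ap v K.zero z ∧ K.V z ∧ K.IsEmpty z
  succ : ∀ (w' : K.World) (f : K.Hom w w') (n : K.Dom w'), ∃ a b, K.Ap (K.tr f v) n a ∧
    K.Ap (K.tr f v) (K.succ n) b ∧ K.V a ∧ K.V b ∧ K.IsSucc b a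

theorem IsNumeralSeq.mono {v : K.Dom w} (h : K.IsNumeralSeq v) {w' : K.World} (f : K.Hom w w') :
    K.IsNumeralSeq (K.tr f v) where
  zero := by
    obtain ⟨z, hz, hV, hE⟩ := h.zero
    exact ⟨_, by simpa using hz.mono f, K.tr_V f hV, hE.mono f⟩
  succ w'' g n := by
    rw [← K.tr_comp]
    exact h.succ _ _ n

theorem IsNumeralSeq.exists_ap {v : K.Dom w} (hv : K.IsNumeralSeq v) (n : K.Dom w) :
    ∃ a, K.Ap v n a ∧ K.V a := by
  obtain ⟨a, b, ha, -, hV, -, -⟩ := hv.succ w (K.id w) n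
  exact ⟨a, by simpa using ha, hV⟩

/-- `k` is the set of the ordered pairs of the `n`-th numeral and the `n`-th element of `j`. -/
structure IsGraph (v j k : K.Dom w) : Prop where
  exists_of_EL : ∀ (w' : K.World) (f : K.Hom w w') (p : K.Dom w'), K.EL (K.tr f k) p →
    ∃ n a b, K.Ap (K.tr f v) n a ∧ K.Ap (K.tr f j) n b ∧ K.V b ∧ K.IsOPair p a b
  exists_EL : ∀ (w' : K.World) (f : K.Hom w w') (n : K.Dom w'),
    ∃ p a b, K.EL (K.tr f k) p ∧ K.Ap (K.tr f v) n a ∧ K.Ap (K.tr f j) n b ∧ K.V b ∧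
      K.IsOPair p a b

theorem IsGraph.mono {v j k : K.Dom w} (h : IsGraph v j k) {w' : K.World} (f : K.Hom w w') :
    IsGraph (K.tr f v) (K.tr f j) (K.tr f k) where
  exists_of_EL w'' g p := by
    simp only [← K.tr_comp]
    exact h.exists_of_EL _ _ p
  exists_EL w'' g n := by
    simp only [← K.tr_comp]
    exact h.exists_EL _ _ n

variable [K.IsModel]

/-- The sequence of the numerals is a sequence of dependent choices, whose relation is
`y = x ∪ {x}`. -/
theorem exists_numeralSeq : ∃ v : K.Dom w, K.IsNumeralSeq v := by
  obtain ⟨z, hz, hE⟩ := exists_isEmpty (K := K) (w := w)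
  obtain ⟨v, h₀, h⟩ := exists_choice_sequence (AlmostNegative.V (.var 0))
    ((SetFormula.isSucc (0 : Fin 2) 1).interp ![.var 0, .var 1]) (fun _ => z) (a := z) hz
    (fun w' f n hn => by
      obtain ⟨m, hm, hs⟩ := exists_isSucc hn
      exact ⟨m, hm, by simpa [forces_interp, sat_isSucc] using hs⟩)
  refine ⟨v, ⟨z, h₀, hz, hE⟩, fun w' f n => ?_⟩
  obtain ⟨a, b, ha, hb, hVa, hVb, hs⟩ := h w' f n
  exact ⟨a, b, ha, hb, hVa, hVb, by simpa [forces_interp, sat_isSucc] using hs⟩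

namespace IsNumeralSeq

variable {v : K.Dom w}

theorem V (hv : K.IsNumeralSeq v) {n a : K.Dom w} (h : K.Ap v n a) : K.V a := by
  obtain ⟨b, hb, hV⟩ := hv.exists_ap n
  rwa [h.unique hb]

theorem isEmpty (hv : K.IsNumeralSeq v) {a : K.Dom w} (h : K.Ap v K.zero a) : K.IsEmpty a := by
  obtain ⟨z, hz, -, hE⟩ := hv.zero
  rwa [h.unique hz]

theorem isSucc (hv : K.IsNumeralSeq v) {n a b : K.Dom w} (ha : K.Ap v n a)
    (hb : K.Ap v (K.succ n) b) : K.IsSucc b a := by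
  obtain ⟨a', b', ha', hb', -, -, h⟩ := hv.succ w (K.id w) n
  rw [K.tr_id] at ha' hb'
  rwa [ha.unique ha', hb.unique hb']

/-- A numeral is a member of all later ones. -/
theorem mem_of_lt (hv : K.IsNumeralSeq v) {n a : K.Dom w} (ha : K.Ap v n a)
    (d : K.Dom w) : ∃ b, K.Ap v (K.succ (K.add n d)) b ∧ K.Mem a b := by
  have := induction (.ex (.and (VSets.Ap (.var 2) (.succ (Term.add (.var 3) (.var 1))) (.var 0))
    (.ex (.and (VSets.EL (.var 1) (.var 0)) (.sim (.var 5) (.var 0))))))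
    (econs v (econs n fun _ => a)) ?_ ?_ d
  · simpa [Mem] using this
  · obtain ⟨b, hb, -⟩ := hv.exists_ap (K.succ n)
    have := (hv.isSucc ha hb).1
    simpa using ⟨b, hb, this⟩
  · intro w' f d h
    have hv' := hv.mono f
    have hVa := hv'.V (ha.mono f)
    simp only [forces_ex, forces_and, forces_Ap, forces_EL, forces_sim, eval_var, eval_succ,
      eval_add, econs_zero, econs_succ, tr_econs] at h ⊢
    obtain ⟨b, hb, hab⟩ := h
    obtain ⟨c, hc, hVc⟩ := hv'.exists_ap (K.succ (K.succ (K.add (K.tr f n) d)))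
    exact ⟨c, by simpa using hc, (hv'.isSucc hb hc).mem_of_mem (hv'.V hb) hVc hVa hab⟩

/-- The sequence of the numerals is injective. -/
theorem injective (hv : K.IsNumeralSeq v) {n m a b : K.Dom w} (ha : K.Ap v n a)
    (hb : K.Ap v m b) (h : K.sim a b) : n = m := by
  have key : ∀ {n m a b d : K.Dom w}, K.Ap v n a → K.Ap v m b → K.sim a b →
      m ≠ K.add n (K.succ d) := by
    rintro n _ a b d ha hb h rfl
    obtain ⟨c, hc, hac⟩ := hv.mem_of_lt ha d
    rw [← add_succ] at hc
    rw [hc.unique hb] at hac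
    exact not_mem_self (hv.V hb) (hac.congr_left (hv.V ha) (hv.V hb) (hv.V hb) h)
  rcases lt_trichotomy n m with h₁ | ⟨d, h₁⟩ | ⟨d, h₁⟩
  · exact h₁
  · exact absurd h₁ (key ha hb h)
  · exact absurd h₁ (key hb ha (sim_symm (hv.V ha) (hv.V hb) h))

end IsNumeralSeq

/-- `o` is the range of the sequence of the numerals. -/
def IsNumeralRange (v o : K.Dom w) : Prop :=
  ∀ (w' : K.World) (f : K.Hom w w') (a : K.Dom w'),
    K.EL (K.tr f o) a ↔ ∃ n, K.Ap (K.tr f v) n a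

theorem sat_isOmega {v o : K.Dom w} (hv : K.IsNumeralSeq v) (h : IsNumeralRange v o) :
    K.sat (.isOmega (0 : Fin 1)) ![o] := by
  intro w' f z hz
  simp only [SetFormula.iff, sat, sat_mem, sat_isEmpty, sat_isSucc, tr_vecCons,
    Matrix.cons_val_zero, Matrix.cons_val_succ]
  constructor
  · intro w'' g hzo
    replace hz := K.tr_V g hz
    simp only [← K.tr_comp] at hzo ⊢
    obtain ⟨b, hb, hzb⟩ := hzo
    obtain ⟨n, hn⟩ := (h _ _ b).1 hb
    have hv' := hv.mono (K.comp f g)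
    have hVb := hv'.V hn
    have hbz := sim_symm hz hVb hzb
    rcases eq_zero_or_succ n with rfl | ⟨n, rfl⟩
    · exact Or.inl ((hv'.isEmpty hn).congr hVb hz hbz)
    · obtain ⟨a, ha, hVa⟩ := hv'.exists_ap n
      exact Or.inr ⟨a, (h _ _ a).2 ⟨n, ha⟩, (hv'.isSucc ha hn).congr hVa hVb hz hbz⟩
  · intro w'' g hzo
    replace hz := K.tr_V g hz
    simp only [← K.tr_comp] at hzo ⊢
    have hv' := hv.mono (K.comp f g)
    rcases hzo with hE | ⟨u, hu, hs⟩
    · obtain ⟨a, ha, hVa⟩ := hv'.exists_ap K.zero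
      exact ⟨a, (h _ _ a).2 ⟨_, ha⟩, hE.sim hz hVa (hv'.isEmpty ha)⟩
    · obtain ⟨n, hn⟩ := (h _ _ u).1 hu
      obtain ⟨b, hb, hVb⟩ := hv'.exists_ap (K.succ n)
      exact ⟨b, (h _ _ b).2 ⟨_, hb⟩, hs.sim (hv'.V hn) hz hVb (hv'.isSucc hn hb)⟩

/-! ### The graph of a sequence -/

/-- The graph of a recursive sequence of v-sets is a v-set: Church's Thesis chooses the ordered
pairs. -/
theorem exists_isGraph {v j : K.Dom w} (hv : K.IsNumeralSeq v)
    (hj : ∀ (w' : K.World) (f : K.Hom w w') (n : K.Dom w'), ∃ b, K.Ap (K.tr f j) n b ∧ K.V b) :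
    ∃ k, K.V k ∧ IsGraph v j k := by
  obtain ⟨e, he⟩ := exists_index (.and (.V (.var 0)) (.ex (.ex
    (.and (VSets.Ap (.var 4) (.var 3) (.var 1)) (.and (VSets.Ap (.var 5) (.var 3) (.var 0))
      ((SetFormula.isOPair (0 : Fin 3) 1 2).interp ![.var 2, .var 1, .var 0]))))))
    (econs v fun _ => j) (fun w' f n => by
      obtain ⟨a, ha, hVa⟩ := (hv.mono f).exists_ap n
      obtain ⟨b, hb, hVb⟩ := hj w' f n
      obtain ⟨p, hp, h⟩ := exists_isOPair hVa hVb
      exact ⟨p, hp, a, b, by simpa using ha, by simpa using hb,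
        by simpa [forces_interp, sat_isOPair] using h⟩)
  simp only [forces_and, forces_V, forces_ex, forces_Ap, forces_interp, sat_isOPair, eval_var,
    econs_zero, econs_succ, tr_econs, Matrix.cons_val_zero, Matrix.cons_val_one,
    Matrix.cons_val] at he
  obtain ⟨k, hk, hEL⟩ := exists_range (e := e) (fun w' f n => by
    obtain ⟨p, hp, hV, -⟩ := he w' f n
    exact ⟨p, hp, hV⟩)
  have hVb : ∀ {w' : K.World} {f : K.Hom w w'} {n b : K.Dom w'}, K.Ap (K.tr f j) n b → K.V b := by
    intro w' f n b hb
    obtain ⟨b', hb', hV⟩ := hj w' f n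
    rwa [hb.unique hb']
  refine ⟨k, hk, fun w' f p hp => ?_, fun w' f n => ?_⟩
  · obtain ⟨n, hn⟩ := (hEL w' f p).1 hp
    obtain ⟨q, hq, hV, a, b, ha, hb, h⟩ := he w' f n
    rw [← hn.unique hq] at h
    exact ⟨n, a, b, ha, hb, hVb hb, h⟩
  · obtain ⟨q, hq, hV, a, b, ha, hb, h⟩ := he w' f n
    exact ⟨q, a, b, (hEL w' f q).2 ⟨n, hq⟩, ha, hb, hVb hb, h⟩

/-- The values of a graph are unique, because the sequence of the numerals is injective. -/
theorem IsGraph.unique {v j k : K.Dom w} (h : IsGraph v j k) (hv : K.IsNumeralSeq v) (hk : K.V k)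
    {a b c : K.Dom w} (ha : K.V a) (hb : K.V b) (hc : K.V c) (hab : K.OPairMem a b k)
    (hac : K.OPairMem a c k) : K.sim b c := by
  have key : ∀ {b : K.Dom w}, K.V b → K.OPairMem a b k →
      ∃ n a' b', K.Ap v n a' ∧ K.Ap j n b' ∧ K.V b' ∧ K.sim a a' ∧ K.sim b b' := by
    rintro b hb ⟨p, hp, hpab⟩
    obtain ⟨n, a', b', ha', hb', hVb', hpab'⟩ := h.exists_of_EL w (K.id w) p (by simpa using hp)
    rw [K.tr_id] at ha' hb'
    have hVp := hp.V hk
    have hVa' := hv.V ha'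
    exact ⟨n, a', b', ha', hb', hVb', hpab.sim_left hVp ha hVa' hpab',
      hpab.sim_right hVp ha hb hVa' hVb' hpab'⟩
  obtain ⟨n, a', b', ha', hb', hVb', haa', hbb'⟩ := key hb hab
  obtain ⟨m, a'', c', ha'', hc', hVc', haa'', hcc'⟩ := key hc hac
  have hnm : n = m := hv.injective ha' ha''
    (sim_trans (hv.V ha') ha (hv.V ha'') (sim_symm ha (hv.V ha') haa') haa'')
  subst hnm
  rw [hc'.unique hb'] at hcc'
  exact sim_trans hb hVb' hc hbb' (sim_symm hc hVb' hcc')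

theorem sat_isFunOn {v o j k : K.Dom w} (hv : K.IsNumeralSeq v) (hVo : K.V o)
    (ho : IsNumeralRange v o) (hVk : K.V k) (hk : IsGraph v j k) :
    K.sat (.isFunOn (0 : Fin 2) 1) ![k, o] := by
  refine ⟨fun w' f p hp => ?_, fun w' f a ha => ?_, fun w' f a ha w₁ g b hb w₂ g' c hc w₃ g'' => ?_⟩
  · obtain ⟨n, a, b, ha, -, hVb, h⟩ := hk.exists_of_EL w' f p hp
    exact ⟨a, (ho w' f a).2 ⟨n, ha⟩, b, hVb, (sat_isOPair _ _ _ _).2 h⟩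
  · obtain ⟨n, hn⟩ := (ho w' f a).1 ha
    obtain ⟨p, a', b, hp, ha', -, hVb, h⟩ := hk.exists_EL w' f n
    rw [← hn.unique ha'] at h
    exact ⟨b, hVb, (sat_opairMem _ _ _ _).2 ⟨p, hp, h⟩⟩
  · rintro ⟨hab, hac⟩
    rw [sat_opairMem] at hab hac
    have hVa : K.V (K.tr g'' (K.tr g' (K.tr g a))) :=
      K.tr_V g'' (K.tr_V g' (K.tr_V g (ha.V (K.tr_V f hVo))))
    exact ((((hk.mono f).mono g).mono g').mono g'').unique ((((hv.mono f).mono g).mono g').mono g'')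
      (K.tr_V g'' (K.tr_V g' (K.tr_V g (K.tr_V f hVk)))) hVa (K.tr_V g'' (K.tr_V g' hb))
      (K.tr_V g'' hc) hab hac

/-! ### Relativised Dependent Choices in a model -/

/-- Relativised Dependent Choices without the set-theoretic function. The class `φ` is replaced by
the almost-negative class of the pairs of a realizer of `φ(x)` and `x`. -/
theorem exists_rdc_sequence {N : ℕ} (φ : SetFormula (N + 1)) (ψ : Formula) (ρ : ℕ → K.Dom w)
    (hρ : ∀ i : Fin N, K.V (ρ i))
    (H : ∀ (w' : K.World) (f : K.Hom w w') (x : K.Dom w'), K.V x →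
      K.sat φ (Matrix.vecCons x fun i => K.tr f (ρ i)) →
        ∃ y, K.V y ∧ K.sat φ (Matrix.vecCons y fun i => K.tr f (ρ i)) ∧
          K.forces ψ (econs y (econs x fun k => K.tr f (ρ k))))
    {x : K.Dom w} (hx : K.V x) (hφ : K.sat φ (Matrix.vecCons x fun i => ρ i)) :
    ∃ j, K.Ap j K.zero x ∧ ∀ (w' : K.World) (f : K.Hom w w') (n : K.Dom w'),
      ∃ y y', K.Ap (K.tr f j) n y ∧ K.Ap (K.tr f j) (K.succ n) y' ∧ K.V y ∧
        K.sat φ (Matrix.vecCons y fun i => K.tr f (ρ i)) ∧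
          K.forces ψ (econs y' (econs y fun k => K.tr f (ρ k))) := by
  obtain ⟨e, he⟩ := (sat_iff_exists_realizes φ (V_vecCons hx hρ)).1 hφ
  have hDC := exists_choice_sequence
    (A := .and (.V (.right (.var 0))) (realizes φ (.left (.var 0))
      (Matrix.vecCons (.right (.var 0)) fun i => .var (i + 1))))
    (.and (.V _) (almostNegative_realizes _ _ _))
    -- the variables `0` and `1` are the next pair and the given one
    (ψ.subst (scons (.right (.var 0)) (scons (.right (.var 1)) fun k => .var (k + 2)))) ρ
    (a := K.pair e x) (by simpa [forces_realizes, eval_vecCons] using ⟨hx, he⟩)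
    (fun w' f n hn => by
      have hρ' : ∀ i : Fin N, K.V (K.tr f (ρ i)) := fun i => K.tr_V f (hρ i)
      simp only [forces_and, forces_V, forces_realizes, forces_subst, eval_scons, eval_vecCons,
        eval_left, eval_right, eval_var, econs_zero, econs_succ] at hn ⊢
      obtain ⟨y, hy, hφy, hψ⟩ := H w' f _ hn.1
        ((sat_iff_exists_realizes φ (V_vecCons hn.1 hρ')).2 ⟨_, hn.2⟩)
      obtain ⟨e', he'⟩ := (sat_iff_exists_realizes φ (V_vecCons hy hρ')).1 hφy
      exact ⟨K.pair e' y, by simpa using ⟨hy, he'⟩, by simpa using hψ⟩)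
  obtain ⟨J, hJ₀, hJ⟩ := hDC
  simp only [forces_and, forces_V, forces_realizes, forces_subst, eval_scons, eval_vecCons,
    eval_left, eval_right, eval_var, econs_zero, econs_succ] at hJ
  -- `j n` is the second component of `J n`
  obtain ⟨j, hj⟩ := exists_index (.ex (.and (VSets.Ap (.var 3) (.var 2) (.var 0))
    (.eq (.var 1) (.right (.var 0))))) (fun _ => J) (fun w' f n => by
      obtain ⟨u, u', hu, -⟩ := hJ w' f n
      exact ⟨K.right u, u, by simpa using hu, by simp⟩)
  simp only [forces_ex, forces_and, forces_Ap, forces_eq, eval_var, eval_right, econs_zero,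
    econs_succ] at hj
  have hj' : ∀ {w' : K.World} (f : K.Hom w w') {n u : K.Dom w'}, K.Ap (K.tr f J) n u →
      K.Ap (K.tr f j) n (K.right u) := by
    intro w' f n u hu
    obtain ⟨v, hv, u', hu', rfl⟩ := hj w' f n
    rwa [hu.unique hu']
  have hj₀ := hj' (K.id w) (n := K.zero) (u := K.pair e x) (by simpa using hJ₀)
  rw [right_pair, K.tr_id] at hj₀
  refine ⟨j, hj₀, fun w' f n => ?_⟩
  obtain ⟨u, u', hu, hu', ⟨hV, hR⟩, -, hψ⟩ := hJ w' f n
  exact ⟨_, _, hj' f hu, hj' f hu', hV,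
    (sat_iff_exists_realizes φ (V_vecCons hV fun i => K.tr_V f (hρ i))).2 ⟨_, hR⟩, hψ⟩

theorem forces_numeralSeq (ρ : ℕ → K.Dom w) (v : Term) (hv : K.IsNumeralSeq (K.eval ρ v)) :
    K.forces (numeralSeq v) ρ := by
  obtain ⟨z, hz, hV, hE⟩ := hv.zero
  refine ⟨⟨z, ?_⟩, fun w' f n => ?_⟩
  · simpa [forces_interp, sat_isEmpty] using ⟨hz, hV, hE⟩
  · obtain ⟨a, b, ha, hb, hVa, hVb, hs⟩ := hv.succ w' f n
    rw [tr_eval] at ha hb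
    refine ⟨a, b, ?_⟩
    simpa [forces_interp, sat_isSucc] using ⟨ha, hb, hVa, hVb, hs⟩

/-- Relativised Dependent Choices is forced. -/
theorem forces_rdc {N : ℕ} (φ : SetFormula (N + 1)) (ψ : Formula) (ρ : ℕ → K.Dom w)
    (hρ : ∀ i : Fin N, K.V (ρ i)) : K.forces (rdc φ ψ) ρ := by
  rw [rdc, forces_imp]
  intro w₁ f₁ H
  rw [forces_all_imp]
  intro w₂ f₂ x hx
  replace H := forces_mono H f₂
  have hρ' : ∀ i : Fin N, K.V (K.tr f₂ (K.tr f₁ (ρ i))) := fun i => K.tr_V _ (K.tr_V _ (hρ i))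
  rw [forces_all_imp] at H
  simp only [forces_and, forces_V, forces_ex, forces_interp, eval_vecCons, eval_var, econs_zero,
    econs_succ] at H hx
  obtain ⟨j, hj₀, hj⟩ := exists_rdc_sequence φ ψ (fun k => K.tr f₂ (K.tr f₁ (ρ k))) hρ'
    (fun w' f x hx hφ => H w' f x ⟨hx, hφ⟩) hx.1 hx.2
  obtain ⟨v, hv⟩ := exists_numeralSeq (K := K) (w := w₂)
  obtain ⟨o, hVo, ho⟩ := exists_range (e := v) fun w' f n => (hv.mono f).exists_ap n
  obtain ⟨k, hVk, hk⟩ := exists_isGraph (j := j) hv fun w' f n => by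
    obtain ⟨y, y', hy, -, hV, -⟩ := hj w' f n
    exact ⟨y, hy, hV⟩
  refine ⟨v, o, k, j, forces_numeralSeq _ _ hv, ⟨hVo, ?_⟩, ⟨hVk, ?_⟩, ?_, ?_⟩
  · rw [forces_interp, vec_one (K.eval _)]
    exact sat_isOmega hv ho
  · rw [forces_interp, vec_two (K.eval _)]
    exact sat_isFunOn hv hVo ho hVk hk
  · simpa using hj₀
  · intro w₃ f₃ n
    obtain ⟨y, y', hy, hy', hV, hφ, hψ⟩ := hj w₃ f₃ n
    obtain ⟨p, a, b, hp, ha, hb, -, h⟩ := hk.exists_EL w₃ f₃ n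
    rw [hb.unique hy] at h
    refine ⟨a, y, y', ?_⟩
    simpa [forces_interp, forces_subst, eval_vecCons, sat_opairMem] using
      ⟨ha, hy, hy', hV, hφ, ⟨p, hp, h⟩, hψ⟩

end KripkeModel

end VSets

/-- For every class given by a set-theoretic formula `φ`, whose parameters (the variables
`0, …, N - 1`) are v-sets, and for every relation given by an arbitrary formula `ψ`, Relativised
Dependent Choices for `φ` and `ψ` is derivable in the theory. -/
theorem mainTheorem12 (top bot : VSets.PRFun 0) (Pi : VSets.PRFun 2) {N : ℕ}
    (φ : VSets.SetFormula (N + 1)) (ψ : VSets.Formula) :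
    VSets.Derives (VSets.Theory top bot Pi)
      ((List.range N).map fun i => VSets.Formula.V (VSets.Term.var i)) (VSets.rdc φ ψ) := by
  refine VSets.derives_of_forces fun K hK w ρ hρ => ?_
  have : K.IsModel := ⟨top, bot, Pi, hK⟩
  refine VSets.KripkeModel.forces_rdc φ ψ ρ fun i => ?_
  exact hρ _ (List.mem_map.2 ⟨i, List.mem_range.2 i.2, rfl⟩)
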